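/- **Theorem (Approximate polynomials / variance domination).** Fix $\nu \in (2,3]$. There is a constant $C > 0$, not depending on any of the quantities introduced below, such that the following holds for all $n, m, d \in \mathbb{N}$. Let $X_1, \ldots, X_n$ be independent random vectors in $\mathbb{R}^d$ with finite second moments, not necessarily identically distributed, and let $Z_1, \ldots, Z_n$ be independent Gaussian vectors, with $Z=(Z_1,\ldots,Z_n)$ independent of $X = (X_1, \ldots, X_n)$ and $Z_i \sim \mathcal{N}(\mathbb{E}[X_i], \mathrm{Var}[X_i])$. Let $q_m : \mathbb{R}^{nd} \to \mathbb{R}$ be a polynomial of degree at most $m$ that is multilinear in the sense that, for every $1 \le i \le n$, the gradient $\partial_i q_m(x_1, \ldots, x_n)$ with respect to the $i$-th vector argument $x_i \in \mathbb{R}^d$ does not depend on $x_i$. Put $$\sigma = \sqrt{\mathrm{Var}\, q_m(X)}, \qquad M_{\nu;i} = \big\| \partial_i q_m(W_i)^\top (X_i - \mathbb{E}[X_i]) \big\|_{L_\nu}, \qquad W_i = (X_1, \ldots, X_{i-1}, 0, Z_{i+1}, \ldots, Z_n),$$ where $\|U\|_{L_p} = (\mathbb{E}|U|^p)^{1/p}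 \in [0,\infty]$. If $\sigma > 0$, then for every measurable function $f : \mathbb{R}^{nd} \to \mathbb{R}$, $$\sup_{t \in \mathbb{R}} \big| \mathbb{P}\big( \sigma^{-1} f(X) \le t \big) - \mathbb{P}\big( \sigma^{-1} q_m(Z) \le t \big) \big| \;\le\; C\, m \left( \Big( \frac{\| f(X) - q_m(X) \|_{L_2}}{\sigma} \Big)^{\frac{2}{2m+1}} + \Big( \frac{\sum_{i=1}^n M_{\nu;i}^\nu}{\sigma^\nu} \Big)^{\frac{1}{\nu m + 1}} \right).$$ -/

import Mathlib

open MeasureTheory ProbabilityTheory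
open scoped ENNReal NNReal

noncomputable section

/-- `q : (ℝ^d)^n → ℝ` is a polynomial function of (total) degree at most `m` in its `n * d`
real coordinates. -/
def IsPolyDegLE {n d : ℕ} (m : ℕ) (q : (Fin n → EuclideanSpace ℝ (Fin d)) → ℝ) : Prop :=
  ∃ p : MvPolynomial (Fin n × Fin d) ℝ,
    p.totalDegree ≤ m ∧ ∀ x, q x = MvPolynomial.eval (fun ij => x ij.1 ij.2) p

/-- The partial gradient `∂ᵢ q (x₁, …, xₙ) ∈ ℝ^d` with respect to the `i`-th vector argument. -/
def partialGrad {n d : ℕ} (q : (Fin n → EuclideanSpace ℝ (Fin d)) → ℝ) (i : Fin n)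
    (x : Fin n → EuclideanSpace ℝ (Fin d)) : EuclideanSpace ℝ (Fin d) :=
  gradient (fun y => q (Function.update x i y)) (x i)

/-- `∂ᵢ q (x₁, …, xₙ)` does not depend on `xᵢ`, for every `i`. -/
def IsMultilinearFn {n d : ℕ} (q : (Fin n → EuclideanSpace ℝ (Fin d)) → ℝ) : Prop :=
  ∀ (i : Fin n) (x : Fin n → EuclideanSpace ℝ (Fin d)) (v : EuclideanSpace ℝ (Fin d)),
    partialGrad q i (Function.update x i v) = partialGrad q i x

/-- The interpolating vector `Wᵢ = (X₁, …, Xᵢ₋₁, 0, Zᵢ₊₁, …, Zₙ)`. -/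
def lindebergW {Ω : Type*} {n d : ℕ} (X Z : Fin n → Ω → EuclideanSpace ℝ (Fin d)) (i : Fin n)
    (ω : Ω) : Fin n → EuclideanSpace ℝ (Fin d) :=
  fun j => if j < i then X j ω else if i < j then Z j ω else 0

/-- The influence `M_{ν;i} = ‖∂ᵢ q(Wᵢ)ᵀ (Xᵢ - 𝔼 Xᵢ)‖_{L_ν}`, with values in `[0, ∞]`. -/
def influence {Ω : Type*} [MeasurableSpace Ω] {n d : ℕ} (P : Measure Ω)
    (q : (Fin n → EuclideanSpace ℝ (Fin d)) → ℝ)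
    (X Z : Fin n → Ω → EuclideanSpace ℝ (Fin d)) (ν : ℝ) (i : Fin n) : ℝ≥0∞ :=
  eLpNorm (fun ω => inner ℝ (partialGrad q i (lindebergW X Z i ω)) (X i ω - ∫ ω', X i ω' ∂P))
    (ENNReal.ofReal ν) P

/-- The standard deviation of a real random variable. -/
def stdDev {Ω : Type*} [MeasurableSpace Ω] (P : Measure Ω) (U : Ω → ℝ) : ℝ :=
  Real.sqrt (variance U P)

/-- The Kolmogorov distance `sup_t |ℙ(U ≤ t) - ℙ(V ≤ t)|`; the supremum is taken in `[0, ∞]`. -/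
def kolmogorovDist {Ω : Type*} [MeasurableSpace Ω] (P : Measure Ω) (U V : Ω → ℝ) : ℝ≥0∞ :=
  ⨆ t : ℝ, ENNReal.ofReal |P.real {ω | U ω ≤ t} - P.real {ω | V ω ≤ t}|

/-- `Z` is Gaussian with the same mean and the same covariance matrix as `X`. -/
structure IsGaussianMatch {Ω : Type*} [MeasurableSpace Ω] {d : ℕ} (P : Measure Ω)
    (X Z : Ω → EuclideanSpace ℝ (Fin d)) : Prop where
  gaussian : HasGaussianLaw Z P
  mean : ∫ ω, Z ω ∂P = ∫ ω, X ω ∂P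
  cov : ∀ j k : Fin d, covariance (fun ω => Z ω j) (fun ω => Z ω k) P
    = covariance (fun ω => X ω j) (fun ω => X ω k) P

end

/-! Fix a threshold `s = σ t` and two scales `ε, δ > 0` in units of `σ`. By Chebyshev, replacing
`f(X)` by `q(X)` up to an error `σ ε` costs `(a/ε)²`, where `a` is the normalised `L²` distance.
Indicators of half-lines are then smoothed over a window of width `σ δ`. In the Lindeberg
replacement of the `Xᵢ` by the `Zᵢ`, multilinearity makes `q` affine in the block being replaced,
with increment `⟨∂ᵢq(Wᵢ), · - 𝔼 Xᵢ⟩` and with `Wᵢ` independent of both `Xᵢ` and `Zᵢ`. Two moments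
match, so only a Taylor remainder of order `ν` survives. The Gaussian remainder is dominated by that
of `Xᵢ`, and the total cost is a constant times `δ^(-ν) S` with `S = ∑ M_{ν;i}^ν / σ^ν`. Undoing the
smoothing costs `ℙ(|q(Z) - s| ≤ σ(ε + δ))`, which is at most a constant times `m (ε + δ)^(1/m)` by
the Carbery–Wright inequality. Its normalisation holds because `𝔼(q(Z) - s)² = 𝔼(q(X) - s)² ≥ σ²`,
the same replacement preserving second moments exactly. Balancing the three errors
(`le_of_forall_scales`) gives the two exponents.

Most of the work is the dimension-free Carbery–Wright inequality,
`PrekopaLeindler.measure_abs_eval_le`. Gaussian measures satisfy Prékopa–Leindler, and so do their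
restrictions to balls. On a ball the inequality, tested on continuous functions only, is closed
under weak limits, so compactness gives a log-concave measure maximising a continuous small-ball
functional under a second moment constraint. Among the maximisers one is taken whose barycentre has
maximal norm (`exists_extremal_weaklyLogConcave`). Split it by the weights `sigmoid w` and `1 -
sigmoid w`, where `w` is a linear form in two coordinates chosen to share the constraint equally.
Both halves are again maximisers, strict convexity forces them to have the same barycentre, and
hence `w` is almost surely constant. So the extremal measure lives on a line.

On the line a log-concave density is at most `C₀ exp(-|x|)` after an affine change of variable. A
polynomial that is small on a large set is small everywhere, by Remez, and this contradicts the
lower bound on its second moment unless its sublevel sets have measure of order `ε^(1/m)`. -/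

open Set Filter Topology Pointwise

/-! ### Prékopa–Leindler: the line, its stability properties, Gaussian measures -/

section PrekopaLeindler

/-- Brunn–Minkowski on the line, for compact sets. -/
theorem volume_add_le_volume_add_of_isCompact {A B : Set ℝ} (hA : IsCompact A) (hB : IsCompact B)
    (hA' : A.Nonempty) (hB' : B.Nonempty) : volume A + volume B ≤ volume (A + B) := by
  -- With `a = max A` and `b = min B`, the translates `A + b` and `a + B` both lie in `A + B` and
  -- meet only at `a + b`.
  obtain ⟨a, ha, hamax⟩ := hA.exists_isGreatest hA'
  obtain ⟨b, hb, hbmin⟩ := hB.exists_isLeast hB'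
  have h1 : volume ((fun x => x + b) '' A) = volume A := by
    rw [Set.image_add_right]; exact measure_preimage_add_right _ _ _
  have h2 : volume ((fun x => a + x) '' B) = volume B := by
    rw [Set.image_add_left]; exact measure_preimage_add _ _ _
  have hcap : volume ((fun x => x + b) '' A ∩ (fun x => a + x) '' B) = 0 := by
    refine measure_mono_null (t := {a + b}) ?_ (by simp)
    rintro _ ⟨⟨x, hx, rfl⟩, ⟨y, hy, hxy⟩⟩
    have := hamax hx
    have := hbmin hy
    simp only [mem_singleton_iff] at *
    linarith
  have hm : MeasurableSet ((fun x => a + x) '' B) :=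
    (hB.image (by fun_prop)).measurableSet
  calc volume A + volume B
      = volume ((fun x => x + b) '' A ∪ (fun x => a + x) '' B) := by
        rw [← h1, ← h2, ← measure_union_add_inter _ hm, hcap, add_zero]
    _ ≤ volume (A + B) := by
        refine measure_mono (union_subset ?_ ?_)
        · rintro _ ⟨x, hx, rfl⟩; exact add_mem_add hx hb
        · rintro _ ⟨x, hx, rfl⟩; exact add_mem_add ha hx

/-- The two nonvanishing hypotheses cannot be dropped: nothing is smaller than `0`, so `h` would be
vacuous. -/
theorem ENNReal.add_le_of_forall_lt_of_lt {a b c : ℝ≥0∞} (ha : a ≠ 0) (hb : b ≠ 0)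
    (h : ∀ a' < a, ∀ b' < b, a' + b' ≤ c) : a + b ≤ c := by
  have key : ∀ b' < b, a + b' ≤ c := by
    intro b' hb'
    rcases eq_or_ne c ∞ with rfl | hc
    · exact le_top
    have hb'c : b' ≤ c := by
      simpa using h 0 (pos_iff_ne_zero.2 ha) b' hb'
    have : a ≤ c - b' := le_of_forall_lt fun a' ha' => by
      obtain ⟨a'', h1, h2⟩ := exists_between ha'
      exact h1.trans_le (ENNReal.le_sub_of_add_le_right (ne_top_of_le_ne_top hc hb'c) (h a'' h2 b' hb'))
    calc a + b' ≤ c - b' + b' := by gcongr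
      _ = c := tsub_add_cancel_of_le hb'c
  rcases eq_or_ne c ∞ with rfl | hc
  · exact le_top
  have hac : a ≤ c := by simpa using key 0 (pos_iff_ne_zero.2 hb)
  have : b ≤ c - a := le_of_forall_lt fun b' hb' => by
    obtain ⟨b'', h1, h2⟩ := exists_between hb'
    refine h1.trans_le (ENNReal.le_sub_of_add_le_left (ne_top_of_le_ne_top hc hac) (key b'' h2))
  calc a + b ≤ a + (c - a) := by gcongr
    _ = c := add_tsub_cancel_of_le hac

/-- Inner regularity reduces to compact subsets of `A` and `B`. One point of each set is inserted so
that the compact subsets are nonempty. Passing through an arbitrary `C` avoids the measurability of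
`s • A + t • B`. -/
theorem volume_smul_add_le {A B C : Set ℝ} {s t : ℝ} (hs : 0 < s) (ht : 0 < t)
    (hA : MeasurableSet A) (hB : MeasurableSet B) (hA' : A.Nonempty) (hB' : B.Nonempty)
    (hC : ∀ a ∈ A, ∀ b ∈ B, s * a + t * b ∈ C) :
    ENNReal.ofReal s * volume A + ENNReal.ofReal t * volume B ≤ volume C := by
  have hcomp : ∀ K L : Set ℝ, K ⊆ A → L ⊆ B → IsCompact K → IsCompact L →
      ENNReal.ofReal s * volume K + ENNReal.ofReal t * volume L ≤ volume C := by
    intro K L hK hL hKc hLc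
    obtain ⟨a, ha⟩ := hA'
    obtain ⟨b, hb⟩ := hB'
    have hK' : insert a K ⊆ A := insert_subset ha hK
    have hL' : insert b L ⊆ B := insert_subset hb hL
    have hvK : ENNReal.ofReal s * volume K ≤ volume (s • (insert a K)) := by
      rw [Measure.addHaar_smul]
      simp only [Module.finrank_self, pow_one, abs_of_pos hs]
      gcongr
      exact subset_insert _ _
    have hvL : ENNReal.ofReal t * volume L ≤ volume (t • (insert b L)) := by
      rw [Measure.addHaar_smul]
      simp only [Module.finrank_self, pow_one, abs_of_pos ht]
      gcongr
      exact subset_insert _ _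
    refine (add_le_add hvK hvL).trans ((volume_add_le_volume_add_of_isCompact
      ((hKc.insert a).smul s) ((hLc.insert b).smul t) (by simp) (by simp)).trans
      (measure_mono ?_))
    rintro _ ⟨_, ⟨x, hx, rfl⟩, _, ⟨y, hy, rfl⟩, rfl⟩
    exact hC x (hK' hx) y (hL' hy)
  have hs' : ENNReal.ofReal s ≠ 0 := by simpa using hs
  have ht' : ENNReal.ofReal t ≠ 0 := by simpa using ht
  have aux : ∀ {D : Set ℝ} {r : ℝ}, 0 < r → MeasurableSet D → ∀ a' < ENNReal.ofReal r * volume D,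
      ∃ K ⊆ D, IsCompact K ∧ a' ≤ ENNReal.ofReal r * volume K := by
    intro D r hr hD a' ha'
    have hr' : ENNReal.ofReal r ≠ 0 := by simpa using hr
    have : a' / ENNReal.ofReal r < volume D :=
      ENNReal.div_lt_of_lt_mul' ha'
    obtain ⟨K, hKD, hK, hlt⟩ := hD.exists_lt_isCompact this
    refine ⟨K, hKD, hK, ?_⟩
    rw [mul_comm]
    exact (ENNReal.div_le_iff hr' ENNReal.ofReal_ne_top).1 hlt.le
  rcases eq_or_ne (ENNReal.ofReal s * volume A) 0 with h0 | h0
  · rw [h0, zero_add]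
    refine le_of_forall_lt fun b' hb' => ?_
    obtain ⟨b'', h1, h2⟩ := exists_between hb'
    obtain ⟨L, hL, hLc, hle⟩ := aux ht hB b'' h2
    have := hcomp ∅ L (by simp) hL isCompact_empty hLc
    simp only [measure_empty, mul_zero, zero_add] at this
    exact h1.trans_le (hle.trans this)
  rcases eq_or_ne (ENNReal.ofReal t * volume B) 0 with h0' | h0'
  · rw [h0', add_zero]
    refine le_of_forall_lt fun b' hb' => ?_
    obtain ⟨b'', h1, h2⟩ := exists_between hb'
    obtain ⟨L, hL, hLc, hle⟩ := aux hs hA b'' h2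
    have := hcomp L ∅ hL (by simp) hLc isCompact_empty
    simp only [measure_empty, mul_zero, add_zero] at this
    exact h1.trans_le (hle.trans this)
  refine ENNReal.add_le_of_forall_lt_of_lt h0 h0' fun a' ha' b' hb' => ?_
  obtain ⟨K, hK, hKc, hKle⟩ := aux hs hA a' ha'
  obtain ⟨L, hL, hLc, hLle⟩ := aux ht hB b' hb'
  exact (add_le_add hKle hLle).trans (hcomp K L hK hL hKc hLc)

/-- The Prékopa–Leindler inequality for the measure `μ`. -/
def PrekopaLeindler {E : Type*} [AddCommGroup E] [Module ℝ E] [MeasurableSpace E]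
    (μ : Measure E) : Prop :=
  ∀ ⦃s t : ℝ⦄, 0 < s → 0 < t → s + t = 1 → ∀ ⦃f g h : E → ℝ≥0∞⦄,
    Measurable f → Measurable g → Measurable h →
    (∀ x y, f x ^ s * g y ^ t ≤ h (s • x + t • y)) →
    (∫⁻ x, f x ∂μ) ^ s * (∫⁻ x, g x ∂μ) ^ t ≤ ∫⁻ x, h x ∂μ

theorem ENNReal.rpow_mul_rpow_le_add {s t : ℝ} (hs : 0 < s) (ht : 0 < t) (hst : s + t = 1)
    (a b : ℝ≥0∞) : a ^ s * b ^ t ≤ ENNReal.ofReal s * a + ENNReal.ofReal t * b := by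
  have hs' : ENNReal.ofReal s ≠ 0 := by simpa using hs
  have ht' : ENNReal.ofReal t ≠ 0 := by simpa using ht
  induction a with
  | top => simp [ENNReal.mul_top hs']
  | coe a =>
    induction b with
    | top => simp [ENNReal.mul_top ht']
    | coe b =>
      rw [← ENNReal.coe_rpow_of_nonneg _ hs.le, ← ENNReal.coe_rpow_of_nonneg _ ht.le,
        ENNReal.ofReal, ENNReal.ofReal]
      have := NNReal.geom_mean_le_arith_mean2_weighted s.toNNReal t.toNNReal a b
        (by rw [← Real.toNNReal_add hs.le ht.le, hst]; simp)
      rw [Real.coe_toNNReal _ hs.le, Real.coe_toNNReal _ ht.le] at this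
      exact_mod_cast this

/-- Prékopa–Leindler on the line for functions whose superlevel sets are nonempty up to height one. -/
theorem lintegral_add_le_of_superlevel {s t : ℝ} (hs : 0 < s) (ht : 0 < t)
    {F G H : ℝ → ℝ} (hF : Measurable F) (hG : Measurable G) (hH : Measurable H)
    (hF0 : ∀ x, 0 ≤ F x) (hG0 : ∀ x, 0 ≤ G x) (hH0 : ∀ x, 0 ≤ H x)
    (hF1 : ∀ x, F x ≤ 1) (hG1 : ∀ x, G x ≤ 1)
    (hFs : ∀ r, 0 < r → r < 1 → ∃ x, r < F x) (hGs : ∀ r, 0 < r → r < 1 → ∃ x, r < G x)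
    (hFGH : ∀ r, 0 < r → ∀ x y, r < F x → r < G y → r < H (s * x + t * y)) :
    ENNReal.ofReal s * (∫⁻ x, ENNReal.ofReal (F x)) + ENNReal.ofReal t * ∫⁻ x, ENNReal.ofReal (G x)
      ≤ ∫⁻ x, ENNReal.ofReal (H x) := by
  rw [lintegral_eq_lintegral_meas_lt _ (ae_of_all _ hF0) hF.aemeasurable,
    lintegral_eq_lintegral_meas_lt _ (ae_of_all _ hG0) hG.aemeasurable,
    lintegral_eq_lintegral_meas_lt _ (ae_of_all _ hH0) hH.aemeasurable]
  have hmeas : ∀ F : ℝ → ℝ, Measurable fun r : ℝ => volume {a | r < F a} := by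
    intro F
    refine Antitone.measurable fun a b hab => measure_mono fun x hx => ?_
    exact lt_of_le_of_lt hab hx
  rw [← lintegral_const_mul _ (hmeas F), ← lintegral_const_mul _ (hmeas G),
    ← lintegral_add_left ((hmeas F).const_mul _)]
  refine setLIntegral_mono (hmeas H) fun r hr => ?_
  rcases lt_or_ge r 1 with h1 | h1
  · exact volume_smul_add_le hs ht (measurableSet_lt measurable_const hF)
      (measurableSet_lt measurable_const hG) (hFs r hr h1) (hGs r hr h1)
      (fun a ha b hb => hFGH r hr a b ha hb)
  · have e1 : {a | r < F a} = ∅ := by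
      ext x; simpa using (hF1 x).trans h1
    have e2 : {a | r < G a} = ∅ := by
      ext x; simpa using (hG1 x).trans h1
    simp [e1, e2]

/-- Once `f` and `g` are divided by their suprema, their superlevel sets are nonempty at every
height below one and empty from one on. Brunn–Minkowski can then be integrated over heights. This
yields the arithmetic mean of the integrals, which dominates the geometric one. Capping `h / c` at
`1` only keeps it finite. -/
theorem prekopaLeindler_volume_of_bounded {s t : ℝ} (hs : 0 < s) (ht : 0 < t) (hst : s + t = 1)
    {f g h : ℝ → ℝ≥0∞} (hf : Measurable f) (hg : Measurable g) (hh : Measurable h)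
    (hfb : (⨆ x, f x) ≠ ∞) (hgb : (⨆ x, g x) ≠ ∞)
    (hfgh : ∀ x y, f x ^ s * g y ^ t ≤ h (s • x + t • y)) :
    (∫⁻ x, f x) ^ s * (∫⁻ x, g x) ^ t ≤ ∫⁻ x, h x := by
  set a := ⨆ x, f x with ha
  set b := ⨆ x, g x with hb
  rcases eq_or_ne a 0 with ha0 | ha0
  · have : ∀ x, f x = 0 := fun x => by
      have := le_iSup f x
      rw [← ha, ha0] at this
      exact le_antisymm this zero_le
    simp [this, hs]
  rcases eq_or_ne b 0 with hb0 | hb0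
  · have : ∀ x, g x = 0 := fun x => by
      have := le_iSup g x
      rw [← hb, hb0] at this
      exact le_antisymm this zero_le
    simp [this, ht]
  set c := a ^ s * b ^ t with hc
  have has0 : a ^ s ≠ 0 := by simp [ha0, hfb]
  have hbt0 : b ^ t ≠ 0 := by simp [hb0, hgb]
  have hasT : a ^ s ≠ ∞ := by simp [ha0, hfb]
  have hbtT : b ^ t ≠ ∞ := by simp [hb0, hgb]
  have hc0 : c ≠ 0 := mul_ne_zero has0 hbt0
  have hcT : c ≠ ∞ := ENNReal.mul_ne_top hasT hbtT
  have hf1 : ∀ x, f x / a ≤ 1 := fun x => ENNReal.div_le_of_le_mul (by simpa using le_iSup f x)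
  have hg1 : ∀ x, g x / b ≤ 1 := fun x => ENNReal.div_le_of_le_mul (by simpa using le_iSup g x)
  have hfT : ∀ x, f x / a ≠ ∞ := fun x => ne_top_of_le_ne_top ENNReal.one_ne_top (hf1 x)
  have hgT : ∀ x, g x / b ≠ ∞ := fun x => ne_top_of_le_ne_top ENNReal.one_ne_top (hg1 x)
  have hhT : ∀ x, min (h x / c) 1 ≠ ∞ := fun x =>
    ne_top_of_le_ne_top ENNReal.one_ne_top (min_le_right _ _)
  have hsup : ∀ {f : ℝ → ℝ≥0∞}, (⨆ x, f x) ≠ 0 → (⨆ x, f x) ≠ ∞ → (∀ x, f x / (⨆ x, f x) ≠ ∞) →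
      ∀ r : ℝ, 0 < r → r < 1 → ∃ x, r < (f x / (⨆ x, f x)).toReal := by
    intro f h0 hT hfT r hr0 hr
    have : ENNReal.ofReal r * (⨆ x, f x) < ⨆ x, f x := by
      conv_rhs => rw [← one_mul (⨆ x, f x)]
      refine (ENNReal.mul_lt_mul_iff_left h0 hT).2 ?_
      simpa using hr
    obtain ⟨x, hx⟩ := lt_iSup_iff.1 this
    refine ⟨x, ?_⟩
    have h2 : ENNReal.ofReal r < f x / (⨆ x, f x) :=
      (ENNReal.lt_div_iff_mul_lt (Or.inl h0) (Or.inl hT)).2 hx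
    exact (ENNReal.ofReal_lt_iff_lt_toReal hr0.le (hfT x)).1 h2
  have key := lintegral_add_le_of_superlevel hs ht (F := fun x => (f x / a).toReal)
    (G := fun x => (g x / b).toReal) (H := fun x => (min (h x / c) 1).toReal)
    (hf.div_const a).ennreal_toReal (hg.div_const b).ennreal_toReal
    ((hh.div_const c).min measurable_const).ennreal_toReal
    (fun _ => ENNReal.toReal_nonneg) (fun _ => ENNReal.toReal_nonneg)
    (fun _ => ENNReal.toReal_nonneg)
    (fun x => ENNReal.toReal_le_of_le_ofReal zero_le_one (by simpa using hf1 x))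
    (fun x => ENNReal.toReal_le_of_le_ofReal zero_le_one (by simpa using hg1 x))
    (hsup ha0 hfb hfT) (hsup hb0 hgb hgT) ?_
  · simp only [ENNReal.ofReal_toReal (hfT _), ENNReal.ofReal_toReal (hgT _),
      ENNReal.ofReal_toReal (hhT _)] at key
    have e1 : ∫⁻ x, f x = a * ∫⁻ x, f x / a := by
      rw [← lintegral_const_mul _ (hf.div_const a)]
      simp_rw [ENNReal.mul_div_cancel ha0 hfb]
    have e2 : ∫⁻ x, g x = b * ∫⁻ x, g x / b := by
      rw [← lintegral_const_mul _ (hg.div_const b)]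
      simp_rw [ENNReal.mul_div_cancel hb0 hgb]
    rw [e1, e2, ENNReal.mul_rpow_of_nonneg _ _ hs.le, ENNReal.mul_rpow_of_nonneg _ _ ht.le]
    calc a ^ s * (∫⁻ x, f x / a) ^ s * (b ^ t * (∫⁻ x, g x / b) ^ t)
        = c * ((∫⁻ x, f x / a) ^ s * (∫⁻ x, g x / b) ^ t) := by rw [hc]; ring
      _ ≤ c * ∫⁻ x, h x / c := by
          gcongr
          refine (ENNReal.rpow_mul_rpow_le_add hs ht hst _ _).trans (key.trans ?_)
          exact lintegral_mono fun x => min_le_left _ _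
      _ = ∫⁻ x, h x := by
          rw [← lintegral_const_mul _ (hh.div_const c)]
          simp_rw [ENNReal.mul_div_cancel hc0 hcT]
  · intro r hr x y hx hy
    have hx' := (ENNReal.ofReal_lt_iff_lt_toReal hr.le (hfT x)).2 hx
    have hy' := (ENNReal.ofReal_lt_iff_lt_toReal hr.le (hgT y)).2 hy
    rw [← ENNReal.ofReal_lt_iff_lt_toReal hr.le (hhT _)]
    refine lt_min ?_ (hx'.trans_le (hf1 x))
    calc ENNReal.ofReal r = ENNReal.ofReal r ^ s * ENNReal.ofReal r ^ t := by
          rw [← ENNReal.rpow_add _ _ (by simpa using hr) ENNReal.ofReal_ne_top, hst,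
            ENNReal.rpow_one]
      _ < (f x / a) ^ s * (g y / b) ^ t :=
          ENNReal.mul_lt_mul (ENNReal.rpow_lt_rpow hx' hs) (ENNReal.rpow_lt_rpow hy' ht)
      _ = f x ^ s * g y ^ t / c := by
          rw [ENNReal.div_rpow_of_nonneg _ _ hs.le, ENNReal.div_rpow_of_nonneg _ _ ht.le, hc,
            div_eq_mul_inv, div_eq_mul_inv, div_eq_mul_inv,
            ENNReal.mul_inv (Or.inl has0) (Or.inl hasT)]
          ring
      _ ≤ h (s * x + t * y) / c := by
          gcongr
          exact hfgh x y

/-- Truncation at height `k` and monotone convergence. Zero integrals are set aside because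
multiplication is discontinuous at `0 * ∞`. -/
theorem prekopaLeindler_volume : PrekopaLeindler (volume : Measure ℝ) := by
  intro s t hs ht hst f g h hf hg hh hfgh
  rcases eq_or_ne (∫⁻ x, f x) 0 with hf0 | hf0
  · simp [hf0, hs]
  rcases eq_or_ne (∫⁻ x, g x) 0 with hg0 | hg0
  · simp [hg0, ht]
  have htend : ∀ {f : ℝ → ℝ≥0∞}, Measurable f →
      Tendsto (fun k : ℕ => ∫⁻ x, min (f x) k) atTop (𝓝 (∫⁻ x, f x)) := by
    intro f hf
    refine lintegral_tendsto_of_tendsto_of_monotone (fun k => (hf.min measurable_const).aemeasurable)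
      (ae_of_all _ fun x a b hab => ?_) (ae_of_all _ fun x => ?_)
    · exact min_le_min le_rfl (by exact_mod_cast hab)
    · have := (tendsto_const_nhds (x := f x)).min ENNReal.tendsto_nat_nhds_top
      simpa using this
  have hlim := ENNReal.Tendsto.mul ((ENNReal.continuous_rpow_const (y := s)).continuousAt.tendsto.comp (htend hf))
    (Or.inl (by simp [hf0, hs.le])) ((ENNReal.continuous_rpow_const (y := t)).continuousAt.tendsto.comp (htend hg))
    (Or.inl (by simp [hg0, ht.le]))
  refine le_of_tendsto hlim (Eventually.of_forall fun k => ?_)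
  refine prekopaLeindler_volume_of_bounded hs ht hst (hf.min measurable_const)
    (hg.min measurable_const) hh ?_ ?_ fun x y => le_trans ?_ (hfgh x y)
  · exact ne_top_of_le_ne_top (ENNReal.natCast_ne_top k) (iSup_le fun x => min_le_right _ _)
  · exact ne_top_of_le_ne_top (ENNReal.natCast_ne_top k) (iSup_le fun x => min_le_right _ _)
  · gcongr <;> exact min_le_left _ _

variable {E F : Type*} [AddCommGroup E] [Module ℝ E] [MeasurableSpace E]
  [AddCommGroup F] [Module ℝ F] [MeasurableSpace F]

/-- The inequality on the fibres is exactly the hypothesis needed to apply the inequality on the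
base to the fibre integrals. -/
theorem PrekopaLeindler.prod {μ : Measure E} {ν : Measure F} [SFinite μ] [SFinite ν]
    (hμ : PrekopaLeindler μ) (hν : PrekopaLeindler ν) : PrekopaLeindler (μ.prod ν) := by
  intro s t hs ht hst f g h hf hg hh hfgh
  rw [lintegral_prod _ hf.aemeasurable, lintegral_prod _ hg.aemeasurable,
    lintegral_prod _ hh.aemeasurable]
  refine hμ hs ht hst hf.lintegral_prod_right' hg.lintegral_prod_right' hh.lintegral_prod_right'
    fun x y => ?_
  exact hν hs ht hst (hf.comp measurable_prodMk_left) (hg.comp measurable_prodMk_left)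
    (hh.comp measurable_prodMk_left) fun u v => hfgh (x, u) (y, v)

theorem PrekopaLeindler.map {μ : Measure E} (hμ : PrekopaLeindler μ) {T : E → F}
    (hT : Measurable T)
    (hTa : ∀ s t : ℝ, s + t = 1 → ∀ x y, T (s • x + t • y) = s • T x + t • T y) :
    PrekopaLeindler (μ.map T) := by
  intro s t hs ht hst f g h hf hg hh hfgh
  rw [lintegral_map hf hT, lintegral_map hg hT, lintegral_map hh hT]
  refine hμ hs ht hst (hf.comp hT) (hg.comp hT) (hh.comp hT) fun x y => ?_
  simpa [hTa s t hst] using hfgh (T x) (T y)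

theorem PrekopaLeindler.withDensity {μ : Measure E} (hμ : PrekopaLeindler μ) {ρ : E → ℝ≥0∞}
    (hρ : Measurable ρ)
    (hρ' : ∀ s t : ℝ, 0 < s → 0 < t → s + t = 1 →
      ∀ x y, ρ x ^ s * ρ y ^ t ≤ ρ (s • x + t • y)) :
    PrekopaLeindler (μ.withDensity ρ) := by
  intro s t hs ht hst f g h hf hg hh hfgh
  rw [lintegral_withDensity_eq_lintegral_mul _ hρ hf, lintegral_withDensity_eq_lintegral_mul _ hρ hg,
    lintegral_withDensity_eq_lintegral_mul _ hρ hh]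
  refine hμ hs ht hst (hρ.mul hf) (hρ.mul hg) (hρ.mul hh) fun x y => ?_
  simp only [Pi.mul_apply]
  rw [ENNReal.mul_rpow_of_nonneg _ _ hs.le, ENNReal.mul_rpow_of_nonneg _ _ ht.le]
  calc ρ x ^ s * f x ^ s * (ρ y ^ t * g y ^ t) = (ρ x ^ s * ρ y ^ t) * (f x ^ s * g y ^ t) := by ring
    _ ≤ _ := mul_le_mul' (hρ' s t hs ht hst x y) (hfgh x y)

theorem prekopaLeindler_gaussianReal : PrekopaLeindler (gaussianReal 0 1) := by
  rw [gaussianReal_of_var_ne_zero _ one_ne_zero]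
  refine prekopaLeindler_volume.withDensity (measurable_gaussianPDF _ _) ?_
  intro s t hs ht hst x y
  simp only [gaussianPDF]
  have h0 := gaussianPDFReal_nonneg 0 1
  rw [ENNReal.ofReal_rpow_of_nonneg (h0 x) hs.le, ENNReal.ofReal_rpow_of_nonneg (h0 y) ht.le,
    ← ENNReal.ofReal_mul (Real.rpow_nonneg (h0 x) _)]
  refine ENNReal.ofReal_le_ofReal ?_
  simp only [gaussianPDFReal, NNReal.coe_one, mul_one, sub_zero, smul_eq_mul]
  set c : ℝ := (√(2 * Real.pi))⁻¹ with hc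
  have hc0 : 0 < c := by positivity
  rw [Real.mul_rpow hc0.le (Real.exp_pos _).le, Real.mul_rpow hc0.le (Real.exp_pos _).le,
    ← Real.exp_mul, ← Real.exp_mul]
  calc c ^ s * Real.exp (-x ^ 2 / 2 * s) * (c ^ t * Real.exp (-y ^ 2 / 2 * t))
      = (c ^ s * c ^ t) * (Real.exp (-x ^ 2 / 2 * s) * Real.exp (-y ^ 2 / 2 * t)) := by ring
    _ = c * Real.exp (-x ^ 2 / 2 * s + -y ^ 2 / 2 * t) := by
        rw [← Real.rpow_add hc0, hst, Real.rpow_one, Real.exp_add]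
    _ ≤ c * Real.exp (-(s * x + t * y) ^ 2 / 2) := by
        gcongr
        have ht' : t = 1 - s := by linarith
        subst ht'
        -- Convexity of the square: `s x² + t y² - (s x + t y)² = s t (x - y)²`.
        nlinarith [mul_nonneg (mul_nonneg hs.le ht.le) (sq_nonneg (x - y))]

theorem prekopaLeindler_pi_fin (n : ℕ) {μ : Measure ℝ} [IsProbabilityMeasure μ]
    (hμ : PrekopaLeindler μ) : PrekopaLeindler (Measure.pi fun _ : Fin n => μ) := by
  induction n with
  | zero =>
    intro s t hs ht hst f g h hf hg hh hfgh
    rw [Measure.pi_of_empty]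
    simp only [lintegral_dirac]
    exact (hfgh _ _).trans_eq (congrArg h (Subsingleton.elim _ _))
  | succ n ih =>
    have h1 := (measurePreserving_piFinSuccAbove (fun _ : Fin (n + 1) => μ) 0).symm
    rw [← h1.map_eq]
    refine (hμ.prod ih).map h1.measurable fun s t _ x y => ?_
    ext i
    refine Fin.cases ?_ (fun j => ?_) i <;> simp [MeasurableEquiv.piFinSuccAbove]

theorem prekopaLeindler_pi {ι : Type*} [Fintype ι] {μ : Measure ℝ} [IsProbabilityMeasure μ]
    (hμ : PrekopaLeindler μ) : PrekopaLeindler (Measure.pi fun _ : ι => μ) := by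
  have h1 := measurePreserving_piCongrLeft (fun _ : ι => μ) (Fintype.equivFin ι).symm
  rw [← h1.map_eq]
  refine (prekopaLeindler_pi_fin _ hμ).map h1.measurable fun s t _ x y => ?_
  ext i
  simp [MeasurableEquiv.piCongrLeft, Equiv.piCongrLeft, Equiv.piCongrLeft']

/-- Every Gaussian measure is an affine image of the standard one. Arguing with images rather than
densities covers degenerate covariances. -/
theorem prekopaLeindler_of_isGaussian {ι : Type*} [Fintype ι] (μ : Measure (EuclideanSpace ℝ ι))
    [IsGaussian μ] : PrekopaLeindler μ := by
  classical
  let b := (EuclideanSpace.basisFun ι ℝ).toBasis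
  let S := LinearMap.toMatrix₂ b b (covarianceBilin μ).toBilinForm
  have hS : S.PosSemidef :=
    (LinearMap.isPosSemidef_iff_posSemidef_toMatrix b).1
      (LinearMap.BilinForm.isPosSemidef_iff.1 isPosSemidef_covarianceBilin)
  have hμ : μ = multivariateGaussian (∫ x, x ∂μ) S := by
    refine IsGaussian.ext (by simp) ?_
    ext x y
    rw [covarianceBilin_multivariateGaussian hS]
    exact apply_eq_dotProduct_toMatrix₂_mulVec b b (covarianceBilin μ).toBilinForm x y
  rw [hμ, multivariateGaussian, ← map_pi_eq_stdGaussian]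
  refine ((prekopaLeindler_pi prekopaLeindler_gaussianReal).map (by fun_prop) ?_).map
    (by fun_prop) ?_
  · intro s t _ x y; rfl
  · intro s t hst x y
    rw [map_add, map_smul, map_smul, smul_add, smul_add]
    nth_rw 1 [← one_smul ℝ (∫ x, x ∂μ), ← hst]
    rw [add_smul]
    abel

end PrekopaLeindler

/-! ### Remez inequality and small balls under exponentially decaying densities -/

/-- A compact set of reals of measure at least `n * η` contains `n + 1` points that are
`η`-separated. -/
theorem exists_separated_points {η : ℝ} (hη : 0 < η) (n : ℕ) :
    ∀ S : Set ℝ, IsCompact S → S.Nonempty → ENNReal.ofReal (n * η) ≤ volume S →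
      ∃ v : ℕ → ℝ, (∀ k ≤ n, v k ∈ S) ∧ ∀ k < n, v k + η ≤ v (k + 1) := by
  induction n with
  | zero =>
    rintro S - ⟨x, hx⟩ -
    exact ⟨fun _ => x, fun _ _ => hx, by simp⟩
  | succ n ih =>
    intro S hS hne hvol
    obtain ⟨a, ha, hamin⟩ := hS.exists_isLeast hne
    obtain ⟨b, hb, hbmax⟩ := hS.exists_isGreatest hne
    -- This keeps the maximum `b` in the set left after removing `[a, a + η)`, which is therefore
    -- nonempty.
    have hab : a + η ≤ b := by
      have h1 : volume S ≤ ENNReal.ofReal (b - a) := by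
        rw [← Real.volume_Icc]
        exact measure_mono fun x hx => ⟨hamin hx, hbmax hx⟩
      have h2 := hvol.trans h1
      have hba : a ≤ b := hamin hb
      rw [ENNReal.ofReal_le_ofReal_iff (by linarith)] at h2
      push_cast at h2
      have : 0 ≤ (n : ℝ) * η := by positivity
      linarith
    have hvol' : ENNReal.ofReal (n * η) ≤ volume (S ∩ Ici (a + η)) := by
      have h1 : volume S ≤ volume (S ∩ Ici (a + η)) + ENNReal.ofReal η := by
        have : S ⊆ (S ∩ Ici (a + η)) ∪ Ico a (a + η) := by
          intro x hx
          rcases le_or_gt (a + η) x with h | h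
          · exact Or.inl ⟨hx, h⟩
          · exact Or.inr ⟨hamin hx, h⟩
        refine (measure_mono this).trans ((measure_union_le _ _).trans ?_)
        rw [Real.volume_Ico]
        simp
      have h2 := hvol.trans h1
      have h3 : ENNReal.ofReal ((n + 1 : ℕ) * η)
          = ENNReal.ofReal (n * η) + ENNReal.ofReal η := by
        rw [← ENNReal.ofReal_add (by positivity) hη.le]
        push_cast; ring_nf
      rw [h3] at h2
      exact (ENNReal.add_le_add_iff_right ENNReal.ofReal_ne_top).1 h2
    obtain ⟨v, hv, hv'⟩ := ih _ (hS.inter_right isClosed_Ici) ⟨b, hb, hab⟩ hvol'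
    refine ⟨fun k => Nat.casesOn k a v, ?_, ?_⟩
    · rintro (_ | k) hk
      · exact ha
      · exact (hv k (by omega)).1
    · rintro (_ | k) hk
      · exact (hv 0 (by omega)).2
      · exact hv' k (by omega)

/-- The denominator of a Lagrange basis polynomial at the nodes `0, …, m`, the extreme case for
nodes with unit gaps. -/
theorem prod_erase_abs_sub {m k : ℕ} (hk : k ≤ m) :
    ∏ j ∈ (Finset.range (m + 1)).erase k, |(k : ℝ) - j| = k.factorial * (m - k).factorial := by
  induction m, hk using Nat.le_induction with
  | base =>
    have : (Finset.range (k + 1)).erase k = Finset.range k := by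
      ext; simp; omega
    rw [this, ← Finset.prod_range_reflect, ← Finset.prod_range_add_one_eq_factorial]
    simp only [Nat.sub_self, Nat.factorial_zero, Nat.cast_one, mul_one, Nat.cast_prod]
    refine Finset.prod_congr rfl fun j hj => ?_
    have hj' := Finset.mem_range.1 hj
    rw [show k - 1 - j = k - (j + 1) by omega, Nat.cast_sub (by omega)]
    push_cast
    rw [abs_of_nonneg] <;> [ring; (ring_nf; positivity)]
  | succ m hkm ih =>
    have : (Finset.range (m + 1 + 1)).erase k
        = insert (m + 1) ((Finset.range (m + 1)).erase k) := by
      ext; simp; omega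
    rw [this, Finset.prod_insert (by simp), ih, show m + 1 - k = (m - k) + 1 by omega,
      Nat.factorial_succ]
    push_cast
    rw [Nat.cast_sub hkm, abs_of_nonpos]
    · ring
    · have : (k : ℝ) ≤ m := by exact_mod_cast hkm
      linarith

theorem sum_inv_factorial_mul_factorial (m : ℕ) :
    ∑ k ∈ Finset.range (m + 1), ((k.factorial : ℝ) * (m - k).factorial)⁻¹
      = 2 ^ m / m.factorial := by
  have h : ∀ k ∈ Finset.range (m + 1), ((k.factorial : ℝ) * (m - k).factorial)⁻¹
      = (m.choose k : ℝ) / m.factorial := by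
    intro k hk
    have hk' : k ≤ m := by simpa [Nat.lt_succ_iff] using hk
    rw [Nat.cast_choose ℝ hk']
    field_simp
  rw [Finset.sum_congr rfl h, ← Finset.sum_div]
  congr 1
  exact_mod_cast Nat.sum_range_choose m

/-- A Remez-type inequality: a polynomial which is small on a set of large measure is controlled
everywhere. -/
theorem abs_eval_le_of_abs_le_on {Q : Polynomial ℝ} {m : ℕ} (hm : 1 ≤ m) (hQ : Q.natDegree ≤ m)
    {S : Set ℝ} (hS : IsCompact S) {R ε l : ℝ} (hl : 0 < l)
    (hSR : S ⊆ Icc (-R) R) (hSQ : ∀ x ∈ S, |Q.eval x| ≤ ε) (hSl : ENNReal.ofReal l ≤ volume S)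
    (x : ℝ) : |Q.eval x| ≤ ε * (4 * Real.exp 1 * max |x| R / l) ^ m := by
  have hm0 : (0 : ℝ) < m := by exact_mod_cast hm
  have hne : S.Nonempty := by
    rw [nonempty_iff_ne_empty]
    rintro rfl
    simp only [measure_empty, nonpos_iff_eq_zero, ENNReal.ofReal_eq_zero] at hSl
    linarith
  have hε : 0 ≤ ε := by
    obtain ⟨y, hy⟩ := hne
    exact (abs_nonneg _).trans (hSQ y hy)
  -- Measure `l` leaves room for `m + 1` nodes at mutual gaps `l / m`, as many as interpolation in
  -- degree `m` needs.
  set η := l / m with hη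
  have hη0 : 0 < η := by positivity
  obtain ⟨v, hvS, hv⟩ := exists_separated_points hη0 m S hS hne
    (by rwa [hη, mul_div_cancel₀ _ hm0.ne'])
  have hsep : ∀ i d : ℕ, i + d ≤ m → v i + d * η ≤ v (i + d) := by
    intro i d
    induction d with
    | zero => simp
    | succ d ih =>
      intro h
      have h1 := ih (by omega)
      have h2 := hv (i + d) (by omega)
      rw [← add_assoc]
      push_cast
      linarith
  have hsep' : ∀ i ≤ m, ∀ j ≤ m, |(i : ℝ) - j| * η ≤ |v i - v j| := by
    intro i hi j hj
    rcases le_total i j with hij | hij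
    · obtain ⟨d, rfl⟩ := Nat.exists_eq_add_of_le hij
      have h1 := hsep i d hj
      have : 0 ≤ (d : ℝ) * η := by positivity
      rw [abs_sub_comm (v i), abs_of_nonneg (a := v (i + d) - v i) (by linarith), abs_sub_comm]
      push_cast
      rw [add_sub_cancel_left, abs_of_nonneg (by positivity)]
      linarith
    · obtain ⟨d, rfl⟩ := Nat.exists_eq_add_of_le hij
      have h1 := hsep j d hi
      have : 0 ≤ (d : ℝ) * η := by positivity
      rw [abs_of_nonneg (a := v (j + d) - v j) (by linarith)]
      push_cast
      rw [add_sub_cancel_left, abs_of_nonneg (by positivity)]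
      linarith
  have hinj : InjOn v (Finset.range (m + 1) : Set ℕ) := by
    intro i hi j hj hij
    have hi' : i ≤ m := by simpa [Nat.lt_succ_iff] using hi
    have hj' : j ≤ m := by simpa [Nat.lt_succ_iff] using hj
    have := hsep' i hi' j hj'
    rw [hij, sub_self, abs_zero] at this
    have h0 : |(i : ℝ) - j| = 0 := le_antisymm (by
      by_contra hcon
      push Not at hcon
      have := mul_pos hcon hη0
      linarith) (abs_nonneg _)
    rw [abs_eq_zero, sub_eq_zero] at h0
    exact_mod_cast h0
  set A := max |x| R with hA
  have hA0 : 0 ≤ A := (abs_nonneg x).trans (le_max_left _ _)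
  have hxv : ∀ j ≤ m, |x - v j| ≤ 2 * A := by
    intro j hj
    have h1 := hSR (hvS j hj)
    have h2 : |v j| ≤ R := abs_le.2 h1
    have h3 := abs_sub x (v j)
    have h4 : |x| ≤ A := le_max_left _ _
    have h5 : R ≤ A := le_max_right _ _
    linarith
  have hdeg : Q.degree < ((Finset.range (m + 1)).card : WithBot ℕ) := by
    rw [Finset.card_range]
    exact lt_of_le_of_lt (Polynomial.degree_le_of_natDegree_le hQ)
      (by exact_mod_cast Nat.lt_succ_self m)
  have hInt := Lagrange.eq_interpolate hinj hdeg
  have heval : Q.eval x = ∑ k ∈ Finset.range (m + 1), Q.eval (v k) *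
      ∏ j ∈ (Finset.range (m + 1)).erase k, ((v k - v j)⁻¹ * (x - v j)) := by
    conv_lhs => rw [hInt]
    rw [Lagrange.interpolate_apply, Polynomial.eval_finsetSum]
    refine Finset.sum_congr rfl fun k _ => ?_
    rw [Polynomial.eval_mul, Polynomial.eval_C, Lagrange.basis, Polynomial.eval_prod]
    simp [Lagrange.basisDivisor]
  rw [heval]
  have hterm : ∀ k ∈ Finset.range (m + 1), |Q.eval (v k) *
      ∏ j ∈ (Finset.range (m + 1)).erase k, ((v k - v j)⁻¹ * (x - v j))|
      ≤ ε * (2 * A / η) ^ m * ((k.factorial : ℝ) * (m - k).factorial)⁻¹ := by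
    intro k hk
    have hk' : k ≤ m := by simpa [Nat.lt_succ_iff] using hk
    rw [abs_mul, mul_assoc]
    refine mul_le_mul (hSQ _ (hvS k hk')) ?_ (abs_nonneg _) hε
    rw [Finset.abs_prod, ← prod_erase_abs_sub hk', ← Finset.prod_inv_distrib]
    have hcard : ((Finset.range (m + 1)).erase k).card = m := by
      rw [Finset.card_erase_of_mem hk]; simp
    have : (2 * A / η) ^ m = ∏ _j ∈ (Finset.range (m + 1)).erase k, (2 * A / η) := by
      rw [Finset.prod_const, hcard]
    rw [this, ← Finset.prod_mul_distrib]
    refine Finset.prod_le_prod (fun _ _ => abs_nonneg _) fun j hj => ?_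
    have hj' : j ≤ m := by
      have := Finset.mem_of_mem_erase hj
      simpa [Nat.lt_succ_iff] using this
    have hkj : k ≠ j := (Finset.ne_of_mem_erase hj).symm
    have hpos : 0 < |(k : ℝ) - j| := abs_pos.2 (sub_ne_zero.2 (by exact_mod_cast hkj))
    rw [abs_mul, abs_inv]
    calc |v k - v j|⁻¹ * |x - v j| ≤ (|(k : ℝ) - j| * η)⁻¹ * (2 * A) := by
          gcongr
          · exact hsep' k hk' j hj'
          · exact hxv j hj'
      _ = 2 * A / η * |(k : ℝ) - j|⁻¹ := by
          rw [mul_inv]; ring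
  refine (Finset.abs_sum_le_sum_abs _ _).trans ((Finset.sum_le_sum hterm).trans ?_)
  rw [← Finset.mul_sum, sum_inv_factorial_mul_factorial, mul_assoc]
  gcongr
  -- The factor `m ^ m` from the gaps is absorbed by `m!`, since `m ^ m / m! ≤ e ^ m`. The constant
  -- inside the `m`-th power is thus independent of `m`.
  have hexp := Real.pow_div_factorial_le_exp m hm0.le m
  have e1 : (2 * A / η) ^ m * (2 ^ m / m.factorial)
      = (4 * A / l) ^ m * ((m : ℝ) ^ m / m.factorial) := by
    rw [hη, show 2 * A / (l / m) = (2 * A / l) * m by field_simp, mul_pow,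
      show 4 * A / l = 2 * A / l * 2 by ring, mul_pow]
    ring
  rw [e1]
  calc (4 * A / l) ^ m * ((m : ℝ) ^ m / m.factorial) ≤ (4 * A / l) ^ m * Real.exp m := by
        gcongr
    _ = (4 * Real.exp 1 * A / l) ^ m := by
        rw [← Real.exp_one_pow m, ← mul_pow]; ring

theorem lintegral_exp_neg_abs_div_two :
    ∫⁻ x : ℝ, ENNReal.ofReal (Real.exp (-|x| / 2)) = 4 := by
  rw [← lintegral_add_compl _ (measurableSet_Ioi (a := (0 : ℝ))), compl_Ioi]
  have h1 : ∫⁻ x in Ioi (0 : ℝ), ENNReal.ofReal (Real.exp (-|x| / 2)) = 2 := by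
    rw [setLIntegral_congr_fun (g := fun x => ENNReal.ofReal (Real.exp (-(1 / 2) * x)))
      measurableSet_Ioi, ← ofReal_integral_eq_lintegral_ofReal
      (integrableOn_exp_mul_Ioi (by norm_num) 0) (ae_of_all _ fun x => (Real.exp_pos _).le),
      integral_exp_mul_Ioi (by norm_num)]
    · norm_num
    · intro x hx
      simp only [abs_of_pos (show 0 < x from hx)]
      ring_nf
  have h2 : ∫⁻ x in Iic (0 : ℝ), ENNReal.ofReal (Real.exp (-|x| / 2)) = 2 := by
    rw [setLIntegral_congr_fun (g := fun x => ENNReal.ofReal (Real.exp ((1 / 2) * x)))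
      measurableSet_Iic, ← ofReal_integral_eq_lintegral_ofReal
      (integrableOn_exp_mul_Iic (by norm_num) 0) (ae_of_all _ fun x => (Real.exp_pos _).le),
      integral_exp_mul_Iic (by norm_num)]
    · norm_num
    · intro x hx
      simp only [abs_of_nonpos (show x ≤ 0 from hx)]
      ring_nf
  rw [h1, h2]
  norm_num

/-- Half of the exponential decay pays for the polynomial growth; the other half is kept for
integration. -/
theorem max_pow_mul_exp_neg_le {m : ℕ} (hm : 1 ≤ m) {R : ℝ} (hR : 0 ≤ R) (x : ℝ) :
    max |x| R ^ (2 * m) * Real.exp (-|x|) ≤ (R + 4 * m) ^ (2 * m) * Real.exp (-|x| / 2) := by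
  have h1 : |x| ^ (2 * m) ≤ (4 * m : ℝ) ^ (2 * m) * Real.exp (|x| / 2) := by
    have h := Real.pow_div_factorial_le_exp (|x| / 2) (by positivity) (2 * m)
    rw [div_pow, div_div, div_le_iff₀ (by positivity)] at h
    refine h.trans ?_
    rw [mul_comm]
    gcongr
    have h2 : ((2 * m).factorial : ℝ) ≤ (2 * m : ℝ) ^ (2 * m) := by
      exact_mod_cast Nat.factorial_le_pow (2 * m)
    calc (2 : ℝ) ^ (2 * m) * ((2 * m).factorial : ℝ) ≤ 2 ^ (2 * m) * (2 * m : ℝ) ^ (2 * m) := by gcongr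
      _ = (4 * m : ℝ) ^ (2 * m) := by rw [← mul_pow]; ring
  have h2 : max |x| R ^ (2 * m) ≤ (R + 4 * m) ^ (2 * m) * Real.exp (|x| / 2) := by
    have he : 1 ≤ Real.exp (|x| / 2) := Real.one_le_exp (by positivity)
    rcases le_total |x| R with h | h
    · rw [max_eq_right h]
      calc R ^ (2 * m) ≤ (R + 4 * m) ^ (2 * m) * 1 := by
            rw [mul_one]; gcongr; linarith [show (0 : ℝ) ≤ 4 * m by positivity]
        _ ≤ _ := by gcongr
    · rw [max_eq_left h]
      refine h1.trans ?_
      gcongr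
      linarith
  calc max |x| R ^ (2 * m) * Real.exp (-|x|)
      ≤ (R + 4 * m) ^ (2 * m) * Real.exp (|x| / 2) * Real.exp (-|x|) := by gcongr
    _ = (R + 4 * m) ^ (2 * m) * Real.exp (-|x| / 2) := by
        rw [mul_assoc, ← Real.exp_add]; ring_nf

/-- Sublevel sets of a polynomial with large second moment under a measure with exponentially
decaying density have small Lebesgue measure in bounded windows. -/
theorem volume_sublevel_inter_Icc_le {g : ℝ → ℝ} {C₀ : ℝ} (hC₀ : 0 < C₀)
    (hg0 : ∀ x, 0 ≤ g x) (hg : ∀ x, g x ≤ C₀ * Real.exp (-|x|))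
    {Q : Polynomial ℝ} {m : ℕ} (hm : 1 ≤ m) (hQ : Q.natDegree ≤ m)
    (hQg : 1 ≤ ∫⁻ x, ENNReal.ofReal (Q.eval x ^ 2 * g x)) {ε : ℝ} (hε : 0 < ε) {R : ℝ} (hR : 0 ≤ R) :
    volume ({x | |Q.eval x| ≤ ε} ∩ Icc (-R) R) ≤
      ENNReal.ofReal (4 * Real.exp 1 * (4 * C₀ + 1) * ε ^ (1 / (m : ℝ)) * (R + 4 * m)) := by
  by_contra hcon
  push Not at hcon
  have hm0 : (0 : ℝ) < m := by exact_mod_cast hm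
  set l := 4 * Real.exp 1 * (4 * C₀ + 1) * ε ^ (1 / (m : ℝ)) * (R + 4 * m) with hl
  have hl0 : 0 < l := by positivity
  have hcl : IsCompact ({x | |Q.eval x| ≤ ε} ∩ Icc (-R) R) :=
    isCompact_Icc.inter_left (isClosed_le (by fun_prop) continuous_const)
  have hQx := abs_eval_le_of_abs_le_on hm hQ hcl hl0 inter_subset_right (fun x hx => hx.1) hcon.le
  -- If the sublevel set were larger than `l`, Remez would bound `Q² g` by `B exp(-|x|/2)`, whose
  -- integral is `4 B`. The choice of `l` makes `4 B = 4 C₀ / (4 C₀ + 1) ^ (2 m) < 1`, against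
  -- `hQg`.
  set B := ε ^ 2 * (4 * Real.exp 1 / l) ^ (2 * m) * C₀ * (R + 4 * m) ^ (2 * m) with hB
  have hpt : ∀ x, Q.eval x ^ 2 * g x ≤ B * Real.exp (-|x| / 2) := by
    intro x
    have h1 : Q.eval x ^ 2 ≤ (ε * (4 * Real.exp 1 * max |x| R / l) ^ m) ^ 2 := by
      rw [← sq_abs]
      gcongr
      exact hQx x
    calc Q.eval x ^ 2 * g x
        ≤ (ε * (4 * Real.exp 1 * max |x| R / l) ^ m) ^ 2 * (C₀ * Real.exp (-|x|)) := by
          gcongr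
          · exact hg0 x
          · exact hg x
      _ = ε ^ 2 * (4 * Real.exp 1 / l) ^ (2 * m) * C₀ * (max |x| R ^ (2 * m) * Real.exp (-|x|)) := by
          rw [show 4 * Real.exp 1 * max |x| R / l = 4 * Real.exp 1 / l * max |x| R by ring,
            pow_mul', pow_mul' (max |x| R), mul_pow, mul_pow, mul_pow]
          ring
      _ ≤ ε ^ 2 * (4 * Real.exp 1 / l) ^ (2 * m) * C₀ *
            ((R + 4 * m) ^ (2 * m) * Real.exp (-|x| / 2)) := by
          exact mul_le_mul_of_nonneg_left (max_pow_mul_exp_neg_le hm hR x) (by positivity)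
      _ = B * Real.exp (-|x| / 2) := by rw [hB]; ring
  have hB0 : 0 ≤ B := by positivity
  have hB4 : B * 4 < 1 := by
    have e1 : 4 * Real.exp 1 / l = (ε ^ (1 / (m : ℝ)) * ((4 * C₀ + 1) * (R + 4 * m)))⁻¹ := by
      rw [hl]
      have := Real.exp_pos 1
      field_simp
    have e2 : (ε ^ (1 / (m : ℝ))) ^ (2 * m) = ε ^ 2 := by
      rw [mul_comm 2 m, pow_mul, one_div, Real.rpow_inv_natCast_pow hε.le (by omega)]
    have e3 : B * 4 = 4 * C₀ / (4 * C₀ + 1) ^ (2 * m) := by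
      have : 0 < R + 4 * m := by positivity
      rw [hB, e1, inv_pow, mul_pow, mul_pow, e2]
      field_simp
    rw [e3, div_lt_one (by positivity)]
    calc 4 * C₀ < 4 * C₀ + 1 := by linarith
      _ ≤ (4 * C₀ + 1) ^ (2 * m) := le_self_pow₀ (by linarith) (by omega)
  have : ∫⁻ x, ENNReal.ofReal (Q.eval x ^ 2 * g x) ≤ ENNReal.ofReal (B * 4) := by
    calc ∫⁻ x, ENNReal.ofReal (Q.eval x ^ 2 * g x)
        ≤ ∫⁻ x, ENNReal.ofReal B * ENNReal.ofReal (Real.exp (-|x| / 2)) := by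
          refine lintegral_mono fun x => ?_
          rw [← ENNReal.ofReal_mul (by positivity)]
          exact ENNReal.ofReal_le_ofReal (hpt x)
      _ = ENNReal.ofReal B * 4 := by
          rw [lintegral_const_mul _ (by fun_prop), lintegral_exp_neg_abs_div_two]
      _ = ENNReal.ofReal (B * 4) := by
          rw [ENNReal.ofReal_mul hB0]; norm_num
  have h1 := hQg.trans this
  rw [ENNReal.one_le_ofReal] at h1
  linarith

theorem lintegral_rpow_neg_half :
    ∫⁻ t in Ioc (0 : ℝ) 1, ENNReal.ofReal (t ^ (-(1 / 2) : ℝ)) = 2 := by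
  rw [← ofReal_integral_eq_lintegral_ofReal, ← intervalIntegral.integral_of_le zero_le_one,
    integral_rpow (Or.inl (by norm_num))]
  · norm_num
  · exact (intervalIntegrable_iff_integrableOn_Ioc_of_le zero_le_one).1
      (intervalIntegral.intervalIntegrable_rpow' (by norm_num))
  · filter_upwards [ae_restrict_mem measurableSet_Ioc] with t ht
    exact Real.rpow_nonneg ht.1.le _

/-- One-dimensional small ball estimate for densities bounded by `C₀ * exp (-|x|)`. -/
theorem setLIntegral_sublevel_le_of_le_exp {g : ℝ → ℝ} {C₀ : ℝ} (hC₀ : 0 < C₀)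
    (hg0 : ∀ x, 0 ≤ g x) (hg : ∀ x, g x ≤ C₀ * Real.exp (-|x|))
    {Q : Polynomial ℝ} {m : ℕ} (hm : 1 ≤ m) (hQ : Q.natDegree ≤ m)
    (hQg : 1 ≤ ∫⁻ x, ENNReal.ofReal (Q.eval x ^ 2 * g x)) {ε : ℝ} (hε : 0 < ε) :
    ∫⁻ x in {x | |Q.eval x| ≤ ε}, ENNReal.ofReal (g x) ≤
      ENNReal.ofReal (64 * Real.exp 1 * C₀ * (4 * C₀ + 1) * m * ε ^ (1 / (m : ℝ))) := by
  have hm0 : (1 : ℝ) ≤ m := by exact_mod_cast hm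
  set D := {x | |Q.eval x| ≤ ε} with hD
  have hDm : MeasurableSet D := (isClosed_le (by fun_prop) continuous_const).measurableSet
  set K := 4 * Real.exp 1 * (4 * C₀ + 1) * ε ^ (1 / (m : ℝ)) * (8 * m) with hK
  have hK0 : 0 ≤ K := by positivity
  -- Layer cake: the superlevel set of `exp(-|x|)` at height `t < 1` lies in the window of radius
  -- `-log t`. The resulting factor `-log t + 4 m` is at most `8 m t^(-1/2)`, which is integrable on
  -- `(0, 1]` with integral `16 m`.
  have hlayer : ∫⁻ x in D, ENNReal.ofReal (Real.exp (-|x|)) ≤ ENNReal.ofReal K * 2 := by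
    rw [lintegral_eq_lintegral_meas_lt _ (ae_of_all _ fun x => (Real.exp_pos _).le)
      (by fun_prop : Measurable fun x : ℝ => Real.exp (-|x|)).aemeasurable,
      ← lintegral_rpow_neg_half, ← lintegral_const_mul _ (by fun_prop),
      ← lintegral_indicator measurableSet_Ioi, ← lintegral_indicator measurableSet_Ioc]
    refine lintegral_mono fun t => ?_
    rcases le_or_gt t 0 with ht | ht
    · simp [not_lt.2 ht]
    rw [indicator_of_mem (show t ∈ Ioi 0 from ht)]
    rcases le_or_gt 1 t with ht1 | ht1
    · have : {a : ℝ | t < Real.exp (-|a|)} = ∅ := by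
        ext a
        simp only [mem_ofPred_eq, mem_empty_iff_false, iff_false, not_lt]
        exact (Real.exp_le_one_iff.2 (by simp)).trans ht1
      rw [this]; simp
    rw [indicator_of_mem (show t ∈ Ioc 0 1 from ⟨ht, ht1.le⟩)]
    have hR : 0 ≤ -Real.log t := by
      have := Real.log_nonpos ht.le ht1.le
      linarith
    have hsub : {a : ℝ | t < Real.exp (-|a|)} ⊆ Icc (Real.log t) (-Real.log t) := by
      intro a ha
      have h1 : Real.log t < -|a| := (Real.log_lt_iff_lt_exp ht).2 ha
      have h2 : |a| ≤ -Real.log t := by linarith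
      have := abs_le.1 h2
      simpa using this
    have hms : MeasurableSet {a : ℝ | t < Real.exp (-|a|)} :=
      measurableSet_lt measurable_const (by fun_prop)
    rw [Measure.restrict_apply hms, inter_comm, ← ENNReal.ofReal_mul hK0]
    refine (measure_mono (inter_subset_inter_right D hsub)).trans ?_
    have := volume_sublevel_inter_Icc_le hC₀ hg0 hg hm hQ hQg hε hR
    rw [neg_neg] at this
    refine this.trans (ENNReal.ofReal_le_ofReal ?_)
    rw [hK, mul_assoc _ (8 * (m : ℝ))]
    gcongr
    have e1 : t ^ (-(1 / 2) : ℝ) = Real.exp (-Real.log t / 2) := by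
      rw [Real.rpow_def_of_pos ht]; ring_nf
    have e2 := Real.add_one_le_exp (-Real.log t / 2)
    rw [e1]
    nlinarith
  calc ∫⁻ x in D, ENNReal.ofReal (g x)
      ≤ ∫⁻ x in D, ENNReal.ofReal C₀ * ENNReal.ofReal (Real.exp (-|x|)) := by
        refine lintegral_mono fun x => ?_
        rw [← ENNReal.ofReal_mul hC₀.le]
        exact ENNReal.ofReal_le_ofReal (hg x)
    _ = ENNReal.ofReal C₀ * ∫⁻ x in D, ENNReal.ofReal (Real.exp (-|x|)) :=
        lintegral_const_mul _ (by fun_prop)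
    _ ≤ ENNReal.ofReal C₀ * (ENNReal.ofReal K * 2) := by gcongr
    _ = _ := by
        rw [show (2 : ℝ≥0∞) = ENNReal.ofReal 2 by simp, ← ENNReal.ofReal_mul hK0,
          ← ENNReal.ofReal_mul hC₀.le]
        congr 1
        rw [hK]; ring

theorem lintegral_comp_add_mul {H : ℝ} (hH : 0 < H) (x₀ : ℝ) {f : ℝ → ℝ≥0∞} (hf : Measurable f) :
    ∫⁻ x, f x = ENNReal.ofReal H * ∫⁻ y, f (x₀ + H * y) := by
  have h1 := Real.smul_map_volume_mul_left hH.ne'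
  rw [← lintegral_add_left_eq_self f x₀]
  conv_lhs => rw [← h1]
  rw [lintegral_smul_measure, lintegral_map (by fun_prop) (by fun_prop), abs_of_pos hH, smul_eq_mul]

/-! ### Log-concave densities on the line -/

/-- A continuous compactly supported log-concave probability density decays exponentially. -/
theorem exists_le_exp_of_logConcave {g : ℝ → ℝ} (hgc : Continuous g) (hgs : HasCompactSupport g)
    (hg0 : ∀ x, 0 ≤ g x) (hg1 : ∫⁻ x, ENNReal.ofReal (g x) = 1)
    (hlc : ∀ s t : ℝ, 0 < s → 0 < t → s + t = 1 → ∀ x y, g x ^ s * g y ^ t ≤ g (s * x + t * y)) :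
    ∃ x₀ H : ℝ, 0 < H ∧
      ∀ x, g x ≤ 2 * Real.exp 1 ^ 2 / H * Real.exp (-|x - x₀| / H) := by
  obtain ⟨x₀, hx₀⟩ := hgc.exists_forall_ge_of_hasCompactSupport hgs
  set M := g x₀ with hM
  have he : 0 < Real.exp 1 := Real.exp_pos 1
  have hM0 : 0 < M := by
    rcases (hg0 x₀).eq_or_lt with h | h
    · exfalso
      have : ∀ x, g x = 0 := fun x => le_antisymm ((hx₀ x).trans h.symm.le) (hg0 x)
      simp [this] at hg1
    · exact h
  -- By log-concavity `S` contains the segment from the mode to any of its points. Markov's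
  -- inequality gives `M |S| ≤ e`. Beyond distance `|S|` from the mode, `g` has therefore lost a
  -- factor `e`.
  set S := {x | M / Real.exp 1 ≤ g x} with hS
  have hSc : IsClosed S := isClosed_le continuous_const hgc
  have hSfin : volume S ≠ ∞ := by
    have : S ⊆ tsupport g := fun x hx => subset_tsupport _ (by
      have : 0 < M / Real.exp 1 := by positivity
      exact (this.trans_le hx).ne')
    exact ((measure_mono this).trans_lt (hgs.measure_lt_top)).ne
  have hSpos : volume S ≠ 0 := by
    have hopen : IsOpen {x | M / Real.exp 1 < g x} := isOpen_lt continuous_const hgc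
    have hne : x₀ ∈ {x | M / Real.exp 1 < g x} := by
      have : 1 < Real.exp 1 := Real.one_lt_exp_iff.2 one_pos
      exact div_lt_self hM0 this
    have hsub : {x | M / Real.exp 1 < g x} ⊆ S := fun x hx => le_of_lt (by simpa using hx)
    have := hopen.measure_pos volume ⟨x₀, hne⟩
    exact (this.trans_le (measure_mono hsub)).ne'
  set h := (volume S).toReal with hh
  have hh0 : 0 < h := ENNReal.toReal_pos hSpos hSfin
  have hMh : M * h ≤ Real.exp 1 := by
    have h1 := mul_meas_ge_le_lintegral (μ := volume)
      (f := fun x => ENNReal.ofReal (g x)) (by fun_prop) (ENNReal.ofReal (M / Real.exp 1))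
    rw [hg1] at h1
    have e : {x | ENNReal.ofReal (M / Real.exp 1) ≤ ENNReal.ofReal (g x)} = S := by
      ext x
      simp only [mem_ofPred_eq, hS]
      exact ENNReal.ofReal_le_ofReal_iff (hg0 x)
    rw [e, ← ENNReal.ofReal_toReal hSfin, ← ENNReal.ofReal_mul (by positivity)] at h1
    rw [ENNReal.ofReal_le_one, div_mul_eq_mul_div, div_le_one he] at h1
    exact h1
  have hfar : ∀ y, h < |y - x₀| → g y < M / Real.exp 1 := by
    intro y hy
    by_contra hcon
    push Not at hcon
    have hseg : uIcc x₀ y ⊆ S := by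
      intro z hz
      rw [← segment_eq_uIcc] at hz
      obtain ⟨s, t, hs, ht, hst, rfl⟩ := hz
      rcases hs.eq_or_lt with rfl | hs
      · have : t = 1 := by linarith
        subst this
        simpa [hS] using hcon
      rcases ht.eq_or_lt with rfl | ht
      · have : s = 1 := by linarith
        subst this
        simp only [hS, mem_ofPred_eq, one_smul, zero_smul, add_zero]
        exact div_le_self hM0.le (Real.one_le_exp zero_le_one)
      have h1 := hlc s t hs ht hst x₀ y
      simp only [hS, mem_ofPred_eq, smul_eq_mul]
      refine le_trans ?_ h1
      have hMe : M / Real.exp 1 ≤ M := div_le_self hM0.le (Real.one_le_exp zero_le_one)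
      calc M / Real.exp 1 = (M / Real.exp 1) ^ s * (M / Real.exp 1) ^ t := by
            rw [← Real.rpow_add (by positivity), hst, Real.rpow_one]
        _ ≤ g x₀ ^ s * g y ^ t := by gcongr
    have h2 : ENNReal.ofReal |y - x₀| ≤ volume S := by
      rw [← Real.volume_interval]
      exact measure_mono hseg
    rw [ENNReal.ofReal_le_iff_le_toReal hSfin] at h2
    linarith
  -- Doubling `h` makes a point at distance `2 h` lie strictly beyond `h`, as `hfar` requires.
  refine ⟨x₀, 2 * h, by positivity, fun x => ?_⟩
  have hMle : M * Real.exp 1 ≤ 2 * Real.exp 1 ^ 2 / (2 * h) := by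
    rw [le_div_iff₀ (by positivity)]
    nlinarith
  rcases lt_or_ge |x - x₀| (2 * h) with hx | hx
  · calc g x ≤ M := hx₀ x
      _ = M * Real.exp 1 * Real.exp (-1) := by rw [mul_assoc, ← Real.exp_add]; simp
      _ ≤ 2 * Real.exp 1 ^ 2 / (2 * h) * Real.exp (-|x - x₀| / (2 * h)) := by
          gcongr
          rw [neg_div, neg_le_neg_iff, div_le_one (by positivity)]
          exact hx.le
  · have hd : 0 < |x - x₀| := by linarith
    -- This `s` puts `(1 - s) x₀ + s x` at distance exactly `2 h` from the mode. Log-concavity along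
    -- the segment then propagates the drop by `e` to exponential decay at `x`.
    set s := 2 * h / |x - x₀| with hs
    have hs0 : 0 < s := by positivity
    have hs1 : s ≤ 1 := (div_le_one hd).2 hx
    have hy : g ((1 - s) * x₀ + s * x) < M / Real.exp 1 := by
      refine hfar _ ?_
      rw [show (1 - s) * x₀ + s * x - x₀ = s * (x - x₀) by ring, abs_mul, abs_of_pos hs0, hs,
        div_mul_cancel₀ _ hd.ne']
      linarith
    have hgx : g x ≤ M * Real.exp (-|x - x₀| / (2 * h)) := by
      have hexp : -|x - x₀| / (2 * h) = -1 / s := by rw [hs]; field_simp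
      have hpow : g x ^ s ≤ (M * Real.exp (-|x - x₀| / (2 * h))) ^ s := by
        rw [hexp, Real.mul_rpow hM0.le (Real.exp_pos _).le, ← Real.exp_mul,
          div_mul_cancel₀ _ hs0.ne', Real.exp_neg, ← div_eq_mul_inv]
        rcases hs1.eq_or_lt with h1 | h1
        · rw [h1] at hy ⊢
          simp only [Real.rpow_one]
          refine le_of_lt (lt_of_eq_of_lt ?_ hy)
          ring_nf
        · have h2 := (hlc (1 - s) s (by linarith) hs0 (by ring) x₀ x).trans hy.le
          have h3 : M ^ (1 - s) * M ^ s = M := by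
            rw [← Real.rpow_add hM0]; simp
          have h4 : 0 < M ^ (1 - s) := Real.rpow_pos_of_pos hM0 _
          refine le_of_mul_le_mul_left ?_ h4
          calc M ^ (1 - s) * g x ^ s ≤ M / Real.exp 1 := h2
            _ = M ^ (1 - s) * (M ^ s / Real.exp 1) := by rw [← mul_div_assoc, h3]
      exact (Real.rpow_le_rpow_iff (hg0 x) (by positivity) hs0).1 hpow
    refine hgx.trans ?_
    gcongr
    refine le_trans ?_ hMle
    exact le_mul_of_one_le_right hM0.le (Real.one_le_exp zero_le_one)

/-- Small ball estimate for polynomials under a log-concave density on the line. -/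
theorem setLIntegral_sublevel_le_of_logConcave {g : ℝ → ℝ} (hgc : Continuous g)
    (hgs : HasCompactSupport g)
    (hg0 : ∀ x, 0 ≤ g x) (hg1 : ∫⁻ x, ENNReal.ofReal (g x) = 1)
    (hlc : ∀ s t : ℝ, 0 < s → 0 < t → s + t = 1 → ∀ x y, g x ^ s * g y ^ t ≤ g (s * x + t * y))
    {Q : Polynomial ℝ} {m : ℕ} (hm : 1 ≤ m) (hQ : Q.natDegree ≤ m)
    (hQg : 1 ≤ ∫⁻ x, ENNReal.ofReal (Q.eval x ^ 2 * g x)) {ε : ℝ} (hε : 0 < ε) :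
    ∫⁻ x in {x | |Q.eval x| ≤ ε}, ENNReal.ofReal (g x) ≤
      ENNReal.ofReal (128 * Real.exp 1 ^ 3 * (8 * Real.exp 1 ^ 2 + 1) * m * ε ^ (1 / (m : ℝ))) := by
  obtain ⟨x₀, H, hH, hle⟩ := exists_le_exp_of_logConcave hgc hgs hg0 hg1 hlc
  -- The affine change of variable gives the density the universal bound `2 e² exp(-|y|)` and does
  -- not raise the degree.
  set P := Q.comp (Polynomial.C x₀ + Polynomial.C H * Polynomial.X) with hP
  have hPe : ∀ y, P.eval y = Q.eval (x₀ + H * y) := by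
    intro y; simp [hP]
  have hPd : P.natDegree ≤ m := by
    refine Polynomial.natDegree_comp_le.trans ?_
    have : (Polynomial.C x₀ + Polynomial.C H * Polynomial.X).natDegree ≤ 1 := by
      compute_degree
    calc _ ≤ m * 1 := Nat.mul_le_mul hQ this
      _ = m := mul_one m
  have hgm : Measurable g := hgc.measurable
  have key := setLIntegral_sublevel_le_of_le_exp (g := fun y => H * g (x₀ + H * y))
    (C₀ := 2 * Real.exp 1 ^ 2) (by positivity) (fun y => mul_nonneg hH.le (hg0 _)) ?_ hm hPd ?_ hε
  · have e : ∫⁻ x in {x | |Q.eval x| ≤ ε}, ENNReal.ofReal (g x)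
        = ∫⁻ y in {y | |P.eval y| ≤ ε}, ENNReal.ofReal (H * g (x₀ + H * y)) := by
      have hm1 : MeasurableSet {x | |Q.eval x| ≤ ε} :=
        (isClosed_le (by fun_prop) continuous_const).measurableSet
      have hm2 : MeasurableSet {x | |P.eval x| ≤ ε} :=
        (isClosed_le (by fun_prop) continuous_const).measurableSet
      have hmc : Measurable fun y => {x | |Q.eval x| ≤ ε}.indicator
          (fun x => ENNReal.ofReal (g x)) (x₀ + H * y) :=
        (hgm.ennreal_ofReal.indicator hm1).comp (by fun_prop)
      rw [← lintegral_indicator hm1, ← lintegral_indicator hm2,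
        lintegral_comp_add_mul hH x₀ (hgm.ennreal_ofReal.indicator hm1),
        ← lintegral_const_mul _ hmc]
      refine lintegral_congr fun y => ?_
      simp only [indicator, mem_ofPred_eq, hPe]
      split_ifs
      · rw [ENNReal.ofReal_mul hH.le]
      · simp
    rw [e]
    refine key.trans_eq ?_
    congr 1
    ring
  · intro y
    have h1 := hle (x₀ + H * y)
    have h2 : -|x₀ + H * y - x₀| / H = -|y| := by
      rw [add_sub_cancel_left, abs_mul, abs_of_pos hH]; field_simp
    rw [h2] at h1
    calc H * g (x₀ + H * y) ≤ H * (2 * Real.exp 1 ^ 2 / H * Real.exp (-|y|)) := by gcongr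
      _ = _ := by field_simp
  · refine hQg.trans_eq ?_
    rw [lintegral_comp_add_mul hH x₀ (by fun_prop), ← lintegral_const_mul _ (by fun_prop)]
    refine lintegral_congr fun y => ?_
    rw [← ENNReal.ofReal_mul hH.le, hPe]
    ring_nf

/-! ### Log-concave measures on compact sets and localization to a line -/

/-- The Prékopa–Leindler inequality, for continuous functions, of a measure on a subset of `E`. -/
def WeaklyLogConcave {E : Type*} [AddCommGroup E] [Module ℝ E] [TopologicalSpace E]
    [MeasurableSpace E] {K : Set E} (μ : Measure K) : Prop :=
  ∀ ⦃s t : ℝ⦄, 0 < s → 0 < t → s + t = 1 → ∀ ⦃f g h : E → ℝ⦄,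
    Continuous f → Continuous g → Continuous h →
    (∀ x, 0 ≤ f x) → (∀ x, 0 ≤ g x) → (∀ x, 0 ≤ h x) →
    (∀ x y, f x ^ s * g y ^ t ≤ h (s • x + t • y)) →
    (∫ x, f x ∂μ) ^ s * (∫ x, g x ∂μ) ^ t ≤ ∫ x, h x ∂μ

theorem integrable_of_continuous_of_compactSpace {E : Type*} [TopologicalSpace E]
    [MeasurableSpace E] [BorelSpace E] {K : Set E} [CompactSpace K] (μ : Measure K) [IsFiniteMeasure μ] {f : K → ℝ}
    (hf : Continuous f) : Integrable f μ :=
  (BoundedContinuousFunction.mkOfCompact ⟨f, hf⟩).integrable μ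

theorem ProbabilityMeasure.continuous_integral_of_continuous {E : Type*} [TopologicalSpace E]
    [MeasurableSpace E] [BorelSpace E] {K : Set E} [CompactSpace K] {f : E → ℝ} (hf : Continuous f) :
    Continuous fun μ : ProbabilityMeasure K => ∫ x, f x ∂(μ : Measure K) :=
  ProbabilityMeasure.continuous_integral_boundedContinuousFunction
    (BoundedContinuousFunction.mkOfCompact ⟨fun x : K => f x, hf.comp continuous_subtype_val⟩)

section Compact

variable {E : Type*} [NormedAddCommGroup E] [NormedSpace ℝ E] [MeasurableSpace E] [BorelSpace E]
  {K : Set E} [CompactSpace K]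

/-- Continuous functions on a compact set have weakly continuous integrals, so each tested
inequality is a closed condition. This is why only continuous test functions enter
`WeaklyLogConcave`. -/
theorem isClosed_setOf_weaklyLogConcave :
    IsClosed {μ : ProbabilityMeasure K | WeaklyLogConcave (μ : Measure K)} := by
  have : {μ : ProbabilityMeasure K | WeaklyLogConcave (μ : Measure K)} =
      ⋂ (s : ℝ) (t : ℝ) (_ : 0 < s) (_ : 0 < t) (_ : s + t = 1) (f : E → ℝ) (g : E → ℝ) (h : E → ℝ)
        (_ : Continuous f) (_ : Continuous g) (_ : Continuous h)
        (_ : ∀ x, 0 ≤ f x) (_ : ∀ x, 0 ≤ g x) (_ : ∀ x, 0 ≤ h x)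
        (_ : ∀ x y, f x ^ s * g y ^ t ≤ h (s • x + t • y)),
        {μ : ProbabilityMeasure K | (∫ x, f x ∂(μ : Measure K)) ^ s * (∫ x, g x ∂(μ : Measure K)) ^ t
          ≤ ∫ x, h x ∂(μ : Measure K)} := by
    ext μ
    simp only [mem_iInter, mem_ofPred_eq]
    rfl
  rw [this]
  iterate 3 refine isClosed_iInter fun _ => ?_
  rename_i s t hs
  refine isClosed_iInter fun ht => ?_
  iterate 4 refine isClosed_iInter fun _ => ?_
  rename_i f g h
  refine isClosed_iInter fun hf => isClosed_iInter fun hg => isClosed_iInter fun hh => ?_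
  iterate 4 refine isClosed_iInter fun _ => ?_
  refine isClosed_le (Continuous.mul ?_ ?_) (ProbabilityMeasure.continuous_integral_of_continuous hh)
  · exact (ProbabilityMeasure.continuous_integral_of_continuous hf).rpow_const fun _ => Or.inr hs.le
  · exact (ProbabilityMeasure.continuous_integral_of_continuous hg).rpow_const fun _ => Or.inr ht.le

/-- Reweighting a log-concave measure by a continuous log-concave density. -/
theorem exists_tilt (μ : ProbabilityMeasure K) (hμ : WeaklyLogConcave (μ : Measure K))
    {χ : E → ℝ} (hχ : Continuous χ) (hχ0 : ∀ x, 0 < χ x)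
    (hlc : ∀ s t : ℝ, 0 < s → 0 < t → s + t = 1 → ∀ x y, χ x ^ s * χ y ^ t ≤ χ (s • x + t • y)) :
    ∃ μ' : ProbabilityMeasure K, WeaklyLogConcave (μ' : Measure K) ∧
      ∀ f : K → ℝ, ∫ x, f x ∂(μ' : Measure K) =
        (∫ x, χ x * f x ∂(μ : Measure K)) / ∫ x, χ x ∂(μ : Measure K) := by
  have hχc : Continuous fun x : K => χ x := hχ.comp continuous_subtype_val
  have hInt := integrable_of_continuous_of_compactSpace (μ : Measure K) hχc
  set c := ∫ x, χ x ∂(μ : Measure K) with hc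
  have hc0 : 0 < c := by
    rw [hc, integral_pos_iff_support_of_nonneg (fun x : K => (hχ0 x).le) hInt]
    have : Function.support (fun x : K => χ x) = univ := by
      ext x; simpa using (hχ0 x).ne'
    rw [this]; simp
  have hprob : IsProbabilityMeasure ((μ : Measure K).withDensity
      fun x => ENNReal.ofReal (χ x / c)) := by
    refine ⟨?_⟩
    rw [withDensity_apply _ MeasurableSet.univ, Measure.restrict_univ,
      ← ofReal_integral_eq_lintegral_ofReal (hInt.div_const c)
        (ae_of_all _ fun x => (div_pos (hχ0 x) hc0).le), integral_div, ← hc, div_self hc0.ne']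
    simp
  have hval : ∀ f : K → ℝ, ∫ x, f x ∂((μ : Measure K).withDensity
      fun x => ENNReal.ofReal (χ x / c)) = (∫ x, χ x * f x ∂(μ : Measure K)) / c := by
    intro f
    rw [integral_withDensity_eq_integral_toReal_smul (by fun_prop)
      (ae_of_all _ fun x => ENNReal.ofReal_lt_top), ← integral_div]
    refine integral_congr_ae (ae_of_all _ fun x => ?_)
    simp only [ENNReal.toReal_ofReal (div_pos (hχ0 x) hc0).le, smul_eq_mul]
    ring
  refine ⟨⟨_, hprob⟩, ?_, hval⟩
  intro s t hs ht hst f g h hf hg hh hf0 hg0 hh0 hfgh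
  have key := hμ hs ht hst (f := fun x => χ x * f x) (g := fun x => χ x * g x)
    (h := fun x => χ x * h x) (hχ.mul hf) (hχ.mul hg) (hχ.mul hh)
    (fun x => mul_nonneg (hχ0 x).le (hf0 x)) (fun x => mul_nonneg (hχ0 x).le (hg0 x))
    (fun x => mul_nonneg (hχ0 x).le (hh0 x)) fun x y => by
      rw [Real.mul_rpow (hχ0 x).le (hf0 x), Real.mul_rpow (hχ0 y).le (hg0 y)]
      calc χ x ^ s * f x ^ s * (χ y ^ t * g y ^ t) = (χ x ^ s * χ y ^ t) * (f x ^ s * g y ^ t) := by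
            ring
        _ ≤ _ := mul_le_mul (hlc s t hs ht hst x y) (hfgh x y)
            (mul_nonneg (Real.rpow_nonneg (hf0 x) _) (Real.rpow_nonneg (hg0 y) _)) (hχ0 _).le
  simp only [ProbabilityMeasure.coe_mk]
  rw [hval, hval, hval, Real.div_rpow (integral_nonneg fun x : K => mul_nonneg (hχ0 x).le (hf0 x)) hc0.le,
    Real.div_rpow (integral_nonneg fun x : K => mul_nonneg (hχ0 x).le (hg0 x)) hc0.le,
    div_mul_div_comm, ← Real.rpow_add hc0, hst, Real.rpow_one]
  gcongr

end Compact

/-- Add the weighted AM–GM inequalities for `sigmoid` and for `1 - sigmoid`: with `A` the left-hand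
side, the second geometric mean is `A exp(-(s a + t b))`, and the arithmetic means add up to `1`.
Thus `sigmoid w` and its complement `sigmoid (-w)` are continuous log-concave substitutes for the
indicators of complementary half-spaces. -/
theorem Real.sigmoid_logConcave {s t : ℝ} (hs : 0 < s) (ht : 0 < t) (hst : s + t = 1) (a b : ℝ) :
    Real.sigmoid a ^ s * Real.sigmoid b ^ t ≤ Real.sigmoid (s * a + t * b) := by
  have h1 := Real.geom_mean_le_arith_mean2_weighted hs.le ht.le (Real.sigmoid_nonneg a)
    (Real.sigmoid_nonneg b) hst
  have h2 := Real.geom_mean_le_arith_mean2_weighted hs.le ht.le (Real.sigmoid_nonneg (-a))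
    (Real.sigmoid_nonneg (-b)) hst
  rw [← Real.sigmoid_mul_rexp_neg, ← Real.sigmoid_mul_rexp_neg,
    Real.mul_rpow (Real.sigmoid_nonneg a) (Real.exp_pos _).le,
    Real.mul_rpow (Real.sigmoid_nonneg b) (Real.exp_pos _).le, ← Real.exp_mul, ← Real.exp_mul] at h2
  set A := Real.sigmoid a ^ s * Real.sigmoid b ^ t with hA
  have e1 : Real.sigmoid a ^ s * Real.exp (-a * s) * (Real.sigmoid b ^ t * Real.exp (-b * t))
      = A * Real.exp (-(s * a + t * b)) := by
    rw [show -(s * a + t * b) = -a * s + -b * t by ring, Real.exp_add, hA]; ring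
  rw [e1, Real.sigmoid_mul_rexp_neg, Real.sigmoid_mul_rexp_neg, Real.sigmoid_neg,
    Real.sigmoid_neg] at h2
  rw [Real.sigmoid_def, ← one_div, le_div_iff₀ (by positivity)]
  nlinarith

section Localization

variable {ι : Type*} [Fintype ι] {K : Set (ι → ℝ)} [CompactSpace K]

/-- An extremal log-concave measure cannot be split by any sigmoid weight in two coordinates. -/
theorem exists_extremal_weaklyLogConcave {φ ψ : (ι → ℝ) → ℝ} (hφ : Continuous φ) (hψ : Continuous ψ)
    (μ₀ : ProbabilityMeasure K) (hμ₀ : WeaklyLogConcave (μ₀ : Measure K))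
    (hψ₀ : 0 ≤ ∫ x, ψ x ∂(μ₀ : Measure K)) :
    ∃ μ : ProbabilityMeasure K, WeaklyLogConcave (μ : Measure K) ∧
      0 ≤ ∫ x, ψ x ∂(μ : Measure K) ∧
      ∫ x, φ x ∂(μ₀ : Measure K) ≤ ∫ x, φ x ∂(μ : Measure K) ∧
      ∀ i j, ∃ a b c : ℝ, (a ≠ 0 ∨ b ≠ 0) ∧
        ∀ᵐ x : K ∂(μ : Measure K), a * (x : ι → ℝ) i + b * (x : ι → ℝ) j = c := by
  set S := {μ : ProbabilityMeasure K | WeaklyLogConcave (μ : Measure K)} ∩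
    {μ | 0 ≤ ∫ x, ψ x ∂(μ : Measure K)} with hS
  have hSc : IsClosed S := isClosed_setOf_weaklyLogConcave.inter
    (isClosed_le continuous_const (ProbabilityMeasure.continuous_integral_of_continuous hψ))
  obtain ⟨μ₁, hμ₁, hmax₁⟩ := hSc.isCompact.exists_isMaxOn ⟨μ₀, hμ₀, hψ₀⟩
    (ProbabilityMeasure.continuous_integral_of_continuous hφ).continuousOn
  set S₁ := S ∩ {μ : ProbabilityMeasure K |
    ∫ x, φ x ∂(μ₁ : Measure K) ≤ ∫ x, φ x ∂(μ : Measure K)} with hS₁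
  have hS₁c : IsClosed S₁ := hSc.inter
    (isClosed_le continuous_const (ProbabilityMeasure.continuous_integral_of_continuous hφ))
  -- The tie-break among the maximisers of `∫ φ`: a strictly convex function of the barycentre,
  -- which a mixture of maximisers with different barycentres cannot maximise.
  have hNc : Continuous fun μ : ProbabilityMeasure K =>
      ∑ k, (∫ x, (x : ι → ℝ) k ∂(μ : Measure K)) ^ 2 :=
    continuous_finsetSum _ fun k _ => (ProbabilityMeasure.continuous_integral_of_continuous
      (f := fun x : ι → ℝ => x k) (continuous_apply k)).pow 2
  obtain ⟨μ, hμ, hmax⟩ := hS₁c.isCompact.exists_isMaxOn ⟨μ₁, hμ₁, by simp⟩ hNc.continuousOn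
  refine ⟨μ, hμ.1.1, hμ.1.2, (hmax₁ (show μ₀ ∈ S from ⟨hμ₀, hψ₀⟩)).trans hμ.2, fun i j => ?_⟩
  have hInt : ∀ {f : K → ℝ}, Continuous f → Integrable f (μ : Measure K) := fun hf =>
    integrable_of_continuous_of_compactSpace _ hf
  have hψc : Continuous fun x : K => ψ x := hψ.comp continuous_subtype_val
  have hφc : Continuous fun x : K => φ x := hφ.comp continuous_subtype_val
  have hxc : ∀ k, Continuous fun x : K => (x : ι → ℝ) k := fun k =>
    (continuous_apply k).comp continuous_subtype_val
  -- balance the constraint between the two weights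
  obtain ⟨θ, hθ⟩ : ∃ θ : ℝ, ∫ x : K, Real.sigmoid (Real.cos θ * (x : ι → ℝ) i +
      Real.sin θ * (x : ι → ℝ) j) * ψ x ∂(μ : Measure K) = (∫ x, ψ x ∂(μ : Measure K)) / 2 := by
    set F : ℝ → ℝ := fun θ => ∫ x : K, Real.sigmoid (Real.cos θ * (x : ι → ℝ) i +
      Real.sin θ * (x : ι → ℝ) j) * ψ x ∂(μ : Measure K) with hF
    have hFc : Continuous F := by
      refine continuous_of_dominated (bound := fun x => |ψ x|) (fun θ => ?_) (fun θ => ?_)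
        (hInt hψc.abs) (ae_of_all _ fun x => ?_)
      · refine Continuous.aestronglyMeasurable ?_
        exact (continuous_sigmoid.comp (((hxc i).const_mul _).add ((hxc j).const_mul _))).mul hψc
      · refine ae_of_all _ fun x => ?_
        rw [norm_mul, Real.norm_eq_abs, Real.norm_eq_abs, abs_of_pos (Real.sigmoid_pos _)]
        exact mul_le_of_le_one_left (abs_nonneg _) (Real.sigmoid_le_one _)
      · exact (continuous_sigmoid.comp (by fun_prop)).mul continuous_const
    -- The angles `0` and `π` give complementary weights, so half of `∫ ψ` lies between `F 0` and `F
    -- π`.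
    have hFsum : F 0 + F Real.pi = ∫ x, ψ x ∂(μ : Measure K) := by
      have i1 : Integrable (fun x : K => Real.sigmoid ((x : ι → ℝ) i) * ψ x) (μ : Measure K) :=
        hInt ((continuous_sigmoid.comp (hxc i)).mul hψc)
      have i2 : Integrable (fun x : K => Real.sigmoid (-(x : ι → ℝ) i) * ψ x) (μ : Measure K) :=
        hInt ((continuous_sigmoid.comp (hxc i).neg).mul hψc)
      simp only [hF, Real.cos_zero, Real.sin_zero, Real.cos_pi, Real.sin_pi, zero_mul, add_zero,
        one_mul, neg_mul]
      rw [← integral_add i1 i2]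
      refine integral_congr_ae (ae_of_all _ fun x => ?_)
      simp only [Real.sigmoid_neg]
      ring
    have hmem : (∫ x, ψ x ∂(μ : Measure K)) / 2 ∈ uIcc (F 0) (F Real.pi) := by
      rw [mem_uIcc]
      rcases le_total (F 0) (F Real.pi) with h | h
      · left; constructor <;> linarith
      · right; constructor <;> linarith
    obtain ⟨θ, -, hθ⟩ := intermediate_value_uIcc hFc.continuousOn hmem
    exact ⟨θ, hθ⟩
  set w : (ι → ℝ) → ℝ := fun x => Real.cos θ * x i + Real.sin θ * x j with hw
  have hwc : Continuous w := by fun_prop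
  have hwl : ∀ (s t : ℝ) x y, w (s • x + t • y) = s * w x + t * w y := by
    intro s t x y; simp [hw]; ring
  have hwK : Continuous fun x : K => w x := hwc.comp continuous_subtype_val
  have hσ1 : Continuous fun x : K => Real.sigmoid (w x) := continuous_sigmoid.comp hwK
  have hσf : ∀ {f : K → ℝ}, Continuous f →
      Integrable (fun x : K => Real.sigmoid (w x) * f x) (μ : Measure K) :=
    fun hf => hInt (hσ1.mul hf)
  obtain ⟨ν₁, hν₁, hν₁v⟩ := exists_tilt μ hμ.1.1 (χ := fun x => Real.sigmoid (w x))
    (continuous_sigmoid.comp hwc) (fun x => Real.sigmoid_pos _) fun s t hs ht hst x y => by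
      rw [hwl]; exact Real.sigmoid_logConcave hs ht hst _ _
  obtain ⟨ν₂, hν₂, hν₂v⟩ := exists_tilt μ hμ.1.1 (χ := fun x => Real.sigmoid (-w x))
    (continuous_sigmoid.comp hwc.neg) (fun x => Real.sigmoid_pos _)
    fun s t hs ht hst x y => by
      rw [hwl, show -(s * w x + t * w y) = s * (-w x) + t * (-w y) by ring]
      exact Real.sigmoid_logConcave hs ht hst _ _
  set τ := ∫ x : K, Real.sigmoid (w x) ∂(μ : Measure K) with hτ
  have hτ' : ∫ x : K, Real.sigmoid (-w x) ∂(μ : Measure K) = 1 - τ := by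
    simp only [Real.sigmoid_neg]
    rw [integral_sub (integrable_const _) (hInt hσ1)]
    simp [hτ]
  have hcompl : ∀ {f : K → ℝ}, Continuous f → ∫ x : K, Real.sigmoid (-w x) * f x ∂(μ : Measure K) =
      ∫ x, f x ∂(μ : Measure K) - ∫ x : K, Real.sigmoid (w x) * f x ∂(μ : Measure K) := by
    intro f hf
    rw [← integral_sub (hInt hf) (hσf hf)]
    refine integral_congr_ae (ae_of_all _ fun x => ?_)
    simp only [Real.sigmoid_neg]
    ring
  have hpos : ∀ {u : K → ℝ}, Continuous u → 0 < ∫ x, Real.sigmoid (u x) ∂(μ : Measure K) := by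
    intro u hu
    rw [integral_pos_iff_support_of_nonneg (fun x => Real.sigmoid_nonneg _)
      (hInt (continuous_sigmoid.comp hu))]
    have : Function.support (fun x : K => Real.sigmoid (u x)) = univ := by
      ext x; simpa using (Real.sigmoid_pos _).ne'
    rw [this]; simp
  have hτ0 : 0 < τ := hpos hwK
  have hτ1 : 0 < 1 - τ := hτ' ▸ hpos hwK.neg
  have hsplit : ∀ {f : K → ℝ}, Continuous f → ∫ x, f x ∂(μ : Measure K) =
      τ * ∫ x, f x ∂(ν₁ : Measure K) + (1 - τ) * ∫ x, f x ∂(ν₂ : Measure K) := by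
    intro f hf
    rw [hν₁v, hν₂v, hτ', hcompl hf, mul_div_cancel₀ _ hτ0.ne', mul_div_cancel₀ _ hτ1.ne']
    ring
  have hψμ : 0 ≤ ∫ x, ψ x ∂(μ : Measure K) := hμ.1.2
  have hν₁S : ν₁ ∈ S := by
    refine ⟨hν₁, ?_⟩
    rw [mem_ofPred_eq, hν₁v, hθ]
    positivity
  have hν₂S : ν₂ ∈ S := by
    refine ⟨hν₂, ?_⟩
    rw [mem_ofPred_eq, hν₂v, hcompl hψc, hθ, hτ']
    exact div_nonneg (by linarith) hτ1.le
  have hφ₁ := hmax₁ hν₁S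
  have hφ₂ := hmax₁ hν₂S
  have hφμ := hμ.2
  have hφs := hsplit hφc
  simp only [mem_ofPred_eq] at hφ₁ hφ₂ hφμ
  have hν₁S₁ : ν₁ ∈ S₁ := ⟨hν₁S, by
    rw [mem_ofPred_eq]
    nlinarith⟩
  have hν₂S₁ : ν₂ ∈ S₁ := ⟨hν₂S, by
    rw [mem_ofPred_eq]
    nlinarith⟩
  have hN₁ := hmax hν₁S₁
  have hN₂ := hmax hν₂S₁
  simp only [mem_ofPred_eq] at hN₁ hN₂
  -- `μ` is the mixture of `ν₁` and `ν₂` with weights `τ` and `1 - τ`. The left-hand side is the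
  -- convexity gap of the squared norm of the barycentre, nonpositive because `μ` is maximal.
  have hsum : τ * (1 - τ) * ∑ k, (∫ x, (x : ι → ℝ) k ∂(ν₁ : Measure K)
      - ∫ x, (x : ι → ℝ) k ∂(ν₂ : Measure K)) ^ 2 ≤ 0 := by
    have e : τ * (1 - τ) * ∑ k, (∫ x, (x : ι → ℝ) k ∂(ν₁ : Measure K)
        - ∫ x, (x : ι → ℝ) k ∂(ν₂ : Measure K)) ^ 2
        = τ * ∑ k, (∫ x, (x : ι → ℝ) k ∂(ν₁ : Measure K)) ^ 2
          + (1 - τ) * ∑ k, (∫ x, (x : ι → ℝ) k ∂(ν₂ : Measure K)) ^ 2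
          - ∑ k, (∫ x, (x : ι → ℝ) k ∂(μ : Measure K)) ^ 2 := by
      rw [Finset.mul_sum, Finset.mul_sum, Finset.mul_sum, ← Finset.sum_add_distrib,
        ← Finset.sum_sub_distrib]
      refine Finset.sum_congr rfl fun k _ => ?_
      rw [hsplit (hxc k)]
      ring
    rw [e]
    nlinarith
  have hmean : ∀ k, ∫ x, (x : ι → ℝ) k ∂(ν₁ : Measure K) = ∫ x, (x : ι → ℝ) k ∂(μ : Measure K) := by
    have h0 : ∑ k, (∫ x, (x : ι → ℝ) k ∂(ν₁ : Measure K)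
      - ∫ x, (x : ι → ℝ) k ∂(ν₂ : Measure K)) ^ 2 = 0 := by
      refine le_antisymm ?_ (Finset.sum_nonneg fun _ _ => sq_nonneg _)
      by_contra hcon
      push Not at hcon
      have := mul_pos (mul_pos hτ0 hτ1) hcon
      linarith
    intro k
    have hk := (Finset.sum_eq_zero_iff_of_nonneg fun _ _ => sq_nonneg _).1 h0 k (Finset.mem_univ k)
    have hk' := sub_eq_zero.1 (pow_eq_zero_iff two_ne_zero |>.1 hk)
    rw [hsplit (hxc k), ← hk']
    ring
  set c := ∫ x : K, w x ∂(μ : Measure K) with hc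
  have hwmean : ∫ x : K, Real.sigmoid (w x) * w x ∂(μ : Measure K) = τ * c := by
    have h1 : ∫ x : K, w x ∂(ν₁ : Measure K) = c := by
      have hadd : ∀ ρ : ProbabilityMeasure K, ∫ x : K, w x ∂(ρ : Measure K) =
          Real.cos θ * ∫ x, (x : ι → ℝ) i ∂(ρ : Measure K)
            + Real.sin θ * ∫ x, (x : ι → ℝ) j ∂(ρ : Measure K) := by
        intro ρ
        rw [← integral_const_mul, ← integral_const_mul, ← integral_add]
        · exact (integrable_of_continuous_of_compactSpace _ (hxc i)).const_mul _
        · exact (integrable_of_continuous_of_compactSpace _ (hxc j)).const_mul _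
      rw [hc, hadd, hadd, hmean, hmean]
    rw [hν₁v, div_eq_iff hτ0.ne'] at h1
    rw [h1, mul_comm]
  -- Equal barycentres make `w` and `sigmoid w` uncorrelated under `μ`. As `sigmoid` is strictly
  -- increasing, this integrand is nonnegative and vanishes only where `w = c`.
  have hzero : ∫ x : K, (w x - c) * (Real.sigmoid (w x) - Real.sigmoid c) ∂(μ : Measure K) = 0 := by
    have e : ∀ x : K, (w x - c) * (Real.sigmoid (w x) - Real.sigmoid c) =
        (Real.sigmoid (w x) * w x - c * Real.sigmoid (w x)) - (Real.sigmoid c * w x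
          - Real.sigmoid c * c) := fun x => by ring
    simp_rw [e]
    have i1 : Integrable (fun x : K => Real.sigmoid (w x) * w x - c * Real.sigmoid (w x))
        (μ : Measure K) := (hσf hwK).sub ((hInt hσ1).const_mul c)
    have i2 : Integrable (fun x : K => Real.sigmoid c * w x - Real.sigmoid c * c)
        (μ : Measure K) := ((hInt hwK).const_mul _).sub (integrable_const _)
    rw [integral_sub i1 i2,
      integral_sub (hσf hwK) ((hInt hσ1).const_mul c),
      integral_sub ((hInt hwK).const_mul _) (integrable_const _), integral_const_mul,
      integral_const_mul, hwmean, ← hτ, ← hc]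
    simp
    ring
  have hnn : ∀ x : K, 0 ≤ (w x - c) * (Real.sigmoid (w x) - Real.sigmoid c) := by
    intro x
    rcases le_total (w x) c with h | h
    · exact mul_nonneg_of_nonpos_of_nonpos (by linarith) (by linarith [Real.sigmoid_le h])
    · exact mul_nonneg (by linarith) (by linarith [Real.sigmoid_le h])
  have hae := (integral_eq_zero_iff_of_nonneg hnn
    (hInt ((hwK.sub continuous_const).mul (hσ1.sub continuous_const)))).1 hzero
  refine ⟨Real.cos θ, Real.sin θ, c, ?_, ?_⟩
  · by_contra hcon
    push Not at hcon
    have := Real.cos_sq_add_sin_sq θ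
    rw [hcon.1, hcon.2] at this
    norm_num at this
  · filter_upwards [hae] with x hx
    simp only [Pi.zero_apply, mul_eq_zero, sub_eq_zero] at hx
    rcases hx with hx | hx
    · exact hx
    · exact Real.sigmoid_injective hx

end Localization

/-- A coordinate that is not almost surely constant serves as parameter. In its relation with any
coordinate `j` the coefficient of `x j` is nonzero, for otherwise the parameter would be constant.
If every coordinate is constant, `L = 0` works. -/
theorem exists_line_of_forall_pair {ι : Type*} [Fintype ι] {K : Set (ι → ℝ)} {μ : Measure K}
    (h : ∀ i j, ∃ a b c : ℝ, (a ≠ 0 ∨ b ≠ 0) ∧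
      ∀ᵐ x : K ∂μ, a * (x : ι → ℝ) i + b * (x : ι → ℝ) j = c) :
    ∃ (L : (ι → ℝ) →L[ℝ] ℝ) (x₀ v : ι → ℝ), ∀ᵐ x : K ∂μ, ∀ k, (x : ι → ℝ) k = x₀ k + L x * v k := by
  by_cases hconst : ∀ i, ∃ c : ℝ, ∀ᵐ x : K ∂μ, (x : ι → ℝ) i = c
  · choose c hc using hconst
    refine ⟨0, c, 0, ?_⟩
    filter_upwards [ae_all_iff.2 hc] with x hx k
    simp [hx k]
  · obtain ⟨i, hi⟩ := not_forall.1 hconst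
    have : ∀ j, ∃ y v : ℝ, ∀ᵐ x : K ∂μ, (x : ι → ℝ) j = y + (x : ι → ℝ) i * v := by
      intro j
      obtain ⟨a, b, c, hab, hae⟩ := h i j
      have hb : b ≠ 0 := by
        rintro rfl
        have ha : a ≠ 0 := by simpa using hab
        refine hi ⟨c / a, ?_⟩
        filter_upwards [hae] with x hx
        field_simp
        linarith
      refine ⟨c / b, -a / b, ?_⟩
      filter_upwards [hae] with x hx
      field_simp
      linarith
    choose y v hyv using this
    refine ⟨ContinuousLinearMap.proj i, y, v, ?_⟩
    filter_upwards [ae_all_iff.2 hyv] with x hx k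
    exact hx k

/-! ### From measures on a line to densities -/

/-- There is a continuous log-concave probability density supported in `[-1, 1]`. -/
theorem exists_logConcave_kernel : ∃ k : ℝ → ℝ, Continuous k ∧ (∀ u, 0 ≤ k u) ∧
    (∀ u, 1 ≤ |u| → k u = 0) ∧ ∫⁻ u, ENNReal.ofReal (k u) = 1 ∧
    ∀ s t : ℝ, 0 < s → 0 < t → s + t = 1 → ∀ x y, k x ^ s * k y ^ t ≤ k (s * x + t * y) := by
  -- The tent is concave where positive, hence log-concave by weighted AM–GM.
  set T : ℝ → ℝ := fun u => max 0 (1 - |u|) with hT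
  have hTc : Continuous T := by fun_prop
  have hT0 : ∀ u, 0 ≤ T u := fun u => le_max_left _ _
  have hTs : ∀ u, 1 ≤ |u| → T u = 0 := fun u hu => max_eq_left (by linarith)
  have hTlc : ∀ s t : ℝ, 0 < s → 0 < t → s + t = 1 → ∀ x y,
      T x ^ s * T y ^ t ≤ T (s * x + t * y) := by
    intro s t hs ht hst x y
    rcases le_or_gt 1 |x| with hx | hx
    · rw [hTs x hx, Real.zero_rpow hs.ne', zero_mul]; exact hT0 _
    rcases le_or_gt 1 |y| with hy | hy
    · rw [hTs y hy, Real.zero_rpow ht.ne', mul_zero]; exact hT0 _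
    refine (Real.geom_mean_le_arith_mean2_weighted hs.le ht.le (hT0 x) (hT0 y) hst).trans ?_
    have ex : T x = 1 - |x| := max_eq_right (by linarith)
    have ey : T y = 1 - |y| := max_eq_right (by linarith)
    rw [ex, ey]
    refine le_trans ?_ (le_max_right _ _)
    have h1 := abs_add_le (s * x) (t * y)
    rw [abs_mul, abs_mul, abs_of_pos hs, abs_of_pos ht] at h1
    nlinarith
  have hcs : HasCompactSupport T := by
    refine HasCompactSupport.intro (isCompact_Icc (a := -1) (b := 1)) fun x hx => hTs x ?_
    by_contra hcon
    push Not at hcon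
    exact hx (abs_le.1 hcon.le)
  have hInt : Integrable T := hTc.integrable_of_hasCompactSupport hcs
  set c := ∫ u, T u with hc
  have hc0 : 0 < c := by
    refine hTc.integral_pos_of_hasCompactSupport_nonneg_nonzero hcs hT0 (x := 0) ?_
    simp [hT]
  refine ⟨fun u => T u / c, hTc.div_const c, fun u => div_nonneg (hT0 u) hc0.le,
    fun u hu => by simp [hTs u hu], ?_, ?_⟩
  · rw [← ofReal_integral_eq_lintegral_ofReal (hInt.div_const c)
      (ae_of_all _ fun u => div_nonneg (hT0 u) hc0.le), integral_div, ← hc, div_self hc0.ne']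
    simp
  · intro s t hs ht hst x y
    rw [Real.div_rpow (hT0 x) hc0.le, Real.div_rpow (hT0 y) hc0.le, div_mul_div_comm,
      ← Real.rpow_add hc0, hst, Real.rpow_one]
    exact div_le_div_of_nonneg_right (hTlc s t hs ht hst x y) hc0.le

/-- Small ball estimate for a polynomial of a linear functional under a log-concave measure. -/
theorem measure_abs_eval_linear_le {E : Type*} [NormedAddCommGroup E] [NormedSpace ℝ E]
    [MeasurableSpace E] [BorelSpace E] {K : Set E} [CompactSpace K] (μ : ProbabilityMeasure K)
    (hμ : WeaklyLogConcave (μ : Measure K)) (L : E →L[ℝ] ℝ) {Q : Polynomial ℝ} {m : ℕ}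
    (hm : 1 ≤ m) (hQ : Q.natDegree ≤ m)
    (hQ1 : 1 ≤ ∫⁻ x : K, ENNReal.ofReal (Q.eval (L x) ^ 2) ∂(μ : Measure K)) {ε : ℝ} (hε : 0 < ε) :
    (μ : Measure K) {x : K | |Q.eval (L x)| ≤ ε} ≤
      ENNReal.ofReal (512 * Real.exp 1 ^ 3 * (8 * Real.exp 1 ^ 2 + 1) * m * ε ^ (1 / (m : ℝ))) := by
  obtain ⟨k, hkc, hk0, hks, hk1, hklc⟩ := exists_logConcave_kernel
  have hLK : Continuous fun x : K => L x := L.continuous.comp continuous_subtype_val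
  obtain ⟨B, hB⟩ : ∃ B : ℝ, ∀ x : K, |L x| ≤ B := by
    obtain ⟨B, hB⟩ := isCompact_univ.exists_bound_of_continuousOn hLK.continuousOn
    exact ⟨B, fun x => by simpa using hB x (mem_univ x)⟩
  obtain ⟨Mk, hMk⟩ : ∃ Mk : ℝ, ∀ u, k u ≤ Mk := by
    obtain ⟨x₁, hx₁⟩ := hkc.exists_forall_ge_of_hasCompactSupport
      (HasCompactSupport.intro (isCompact_Icc (a := -1) (b := 1)) fun x hx => hks x (by
        by_contra hcon
        push Not at hcon
        exact hx (abs_le.1 hcon.le)))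
    exact ⟨_, hx₁⟩
  -- Smearing `L x` at scale `τ` may move `Q` by at most `η`: the bound `ε` controls the sublevel
  -- set, the bound `1/2` the second moment.
  set η := min ε (1 / 2) with hη
  have hη0 : 0 < η := by positivity
  obtain ⟨τ, hτ0, hτ1, hτ⟩ : ∃ τ : ℝ, 0 < τ ∧ τ ≤ 1 ∧ ∀ (x : K) (u : ℝ), |u| ≤ 1 →
      |Q.eval (L x + τ * u) - Q.eval (L x)| ≤ η := by
    have huc : UniformContinuousOn (fun y => Q.eval y) (Icc (-B - 1) (B + 1)) :=
      isCompact_Icc.uniformContinuousOn_of_continuous (by fun_prop)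
    obtain ⟨δ, hδ, hδ'⟩ := Metric.uniformContinuousOn_iff.1 huc η hη0
    refine ⟨min 1 (δ / 2), by positivity, min_le_left _ _, fun x u hu => ?_⟩
    have h1 := abs_le.1 (hB x)
    have hτu : |min 1 (δ / 2) * u| ≤ min 1 (δ / 2) := by
      rw [abs_mul, abs_of_pos (by positivity : 0 < min 1 (δ / 2))]
      exact mul_le_of_le_one_right (by positivity) hu
    have hτ1 : |min 1 (δ / 2) * u| ≤ 1 := hτu.trans (min_le_left _ _)
    have hτδ : |min 1 (δ / 2) * u| < δ := by
      have := hτu.trans (min_le_right 1 (δ / 2))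
      linarith
    have h2 := abs_le.1 hτ1
    have := hδ' (L x + min 1 (δ / 2) * u) ⟨by linarith, by linarith⟩ (L x)
      ⟨by linarith, by linarith⟩ (by rw [Real.dist_eq]; simpa using hτδ)
    rw [Real.dist_eq] at this
    exact this.le
  set f : ℝ → E → ℝ := fun y x => τ⁻¹ * k ((y - L x) / τ) with hf
  have hf0 : ∀ y x, 0 ≤ f y x := fun y x => mul_nonneg (inv_nonneg.2 hτ0.le) (hk0 _)
  have hfc : ∀ y, Continuous (f y) := fun y => by
    have := L.continuous
    simp only [hf]; fun_prop
  have hfint : ∀ y, Integrable (fun x : K => f y x) (μ : Measure K) := fun y =>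
    integrable_of_continuous_of_compactSpace _ ((hfc y).comp continuous_subtype_val)
  -- The law of `L` may have no density; `g` is the density of its convolution with the rescaled
  -- kernel. Since `f` is jointly log-concave, `hμ` makes `g` log-concave.
  set g : ℝ → ℝ := fun y => ∫ x : K, f y x ∂(μ : Measure K) with hg
  have hgc : Continuous g := by
    refine continuous_of_dominated (bound := fun _ => τ⁻¹ * Mk) (fun y => (hfint y).1)
      (fun y => ae_of_all _ fun x => ?_) (integrable_const _) (ae_of_all _ fun x => ?_)
    · rw [Real.norm_eq_abs, abs_of_nonneg (hf0 y x)]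
      exact mul_le_mul_of_nonneg_left (hMk _) (inv_nonneg.2 hτ0.le)
    · simp only [hf]; fun_prop
  have hg0 : ∀ y, 0 ≤ g y := fun y => integral_nonneg fun x => hf0 y x
  have hgs : HasCompactSupport g := by
    refine HasCompactSupport.intro (isCompact_Icc (a := -B - 1) (b := B + 1)) fun y hy => ?_
    refine integral_eq_zero_of_ae (ae_of_all _ fun x => ?_)
    simp only [hf, Pi.zero_apply, mul_eq_zero]
    right
    refine hks _ ?_
    rw [abs_div, abs_of_pos hτ0, one_le_div hτ0]
    by_contra hcon
    push Not at hcon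
    have h1 := abs_lt.1 hcon
    have h2 := abs_le.1 (hB x)
    exact hy ⟨by linarith, by linarith⟩
  have hglc : ∀ s t : ℝ, 0 < s → 0 < t → s + t = 1 → ∀ x y, g x ^ s * g y ^ t ≤ g (s * x + t * y) := by
    intro s t hs ht hst y z
    refine hμ hs ht hst (hfc y) (hfc z) (hfc _) (hf0 y) (hf0 z) (hf0 _) fun x x' => ?_
    have hτi : 0 < τ⁻¹ := inv_pos.2 hτ0
    simp only [hf]
    rw [Real.mul_rpow hτi.le (hk0 _), Real.mul_rpow hτi.le (hk0 _)]
    have e1 : (s * y + t * z - L (s • x + t • x')) / τ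
        = s * ((y - L x) / τ) + t * ((z - L x') / τ) := by
      rw [map_add, map_smul, map_smul, smul_eq_mul, smul_eq_mul]; ring
    rw [e1]
    calc τ⁻¹ ^ s * k ((y - L x) / τ) ^ s * (τ⁻¹ ^ t * k ((z - L x') / τ) ^ t)
        = τ⁻¹ ^ s * τ⁻¹ ^ t * (k ((y - L x) / τ) ^ s * k ((z - L x') / τ) ^ t) := by ring
      _ = τ⁻¹ * (k ((y - L x) / τ) ^ s * k ((z - L x') / τ) ^ t) := by
          rw [← Real.rpow_add hτi, hst, Real.rpow_one]
      _ ≤ _ := mul_le_mul_of_nonneg_left (hklc s t hs ht hst _ _) hτi.le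
  have hswap : ∀ F : ℝ → ℝ≥0∞, Measurable F → ∫⁻ y, F y * ENNReal.ofReal (g y) =
      ∫⁻ x : K, (∫⁻ u, F (L x + τ * u) * ENNReal.ofReal (k u)) ∂(μ : Measure K) := by
    intro F hF
    have hfm : Measurable fun p : ℝ × K => ENNReal.ofReal (f p.1 p.2) := by
      refine ENNReal.measurable_ofReal.comp (Continuous.measurable ?_)
      simp only [hf]
      have : Continuous fun p : ℝ × K => L p.2 := hLK.comp continuous_snd
      fun_prop
    have e1 : ∀ y, F y * ENNReal.ofReal (g y)
        = ∫⁻ x : K, F y * ENNReal.ofReal (f y x) ∂(μ : Measure K) := by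
      intro y
      rw [hg, ofReal_integral_eq_lintegral_ofReal (hfint y) (ae_of_all _ fun x => hf0 y x),
        lintegral_const_mul _ (show Measurable fun x : K => ENNReal.ofReal (f y x) from
          hfm.comp measurable_prodMk_left)]
    simp_rw [e1]
    rw [lintegral_lintegral_swap ((hF.comp measurable_fst).mul hfm).aemeasurable]
    refine lintegral_congr fun x => ?_
    have hfx : Measurable fun y => ENNReal.ofReal (f y x) := hfm.comp measurable_prodMk_right
    have hFf : Measurable fun y => F y * ENNReal.ofReal (f y x) := hF.mul hfx
    rw [lintegral_comp_add_mul hτ0 (L x) hFf, ← lintegral_const_mul _ (by fun_prop)]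
    refine lintegral_congr fun u => ?_
    simp only [hf, add_sub_cancel_left, mul_div_cancel_left₀ _ hτ0.ne']
    rw [mul_left_comm, ← ENNReal.ofReal_mul hτ0.le, mul_inv_cancel_left₀ hτ0.ne']
  have hlow : ∀ F : ℝ → ℝ≥0∞, Measurable F → ∀ G : K → ℝ≥0∞,
      (∀ (x : K) u, |u| ≤ 1 → G x ≤ F (L x + τ * u)) →
      ∫⁻ x, G x ∂(μ : Measure K) ≤ ∫⁻ y, F y * ENNReal.ofReal (g y) := by
    intro F hF G hG
    rw [hswap F hF]
    refine lintegral_mono fun x => ?_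
    calc G x = ∫⁻ u, G x * ENNReal.ofReal (k u) := by
          rw [lintegral_const_mul _ (by fun_prop), hk1, mul_one]
      _ ≤ ∫⁻ u, F (L x + τ * u) * ENNReal.ofReal (k u) := by
          refine lintegral_mono fun u => ?_
          rcases le_or_gt |u| 1 with hu | hu
          · gcongr
            exact hG x u hu
          · simp [hks u hu.le]
  have hg1 : ∫⁻ y, ENNReal.ofReal (g y) = 1 := by
    have := hswap (fun _ => 1) measurable_const
    simpa [hk1] using this
  -- A displacement of at most `1/2` gives `Q(L x)² ≤ 2 Q(y)² + 1/2`. Doubling `Q` compensates the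
  -- loss, and the sublevel `ε` becomes `2 (ε + ε) = 4 ε`.
  have hmass : 1 ≤ ∫⁻ y, ENNReal.ofReal ((Polynomial.C 2 * Q).eval y ^ 2 * g y) := by
    have h1 := hlow (fun y => ENNReal.ofReal (2 * Q.eval y ^ 2 + 1 / 2)) (by fun_prop)
      (fun x => ENNReal.ofReal (Q.eval (L x) ^ 2)) fun x u hu => by
        refine ENNReal.ofReal_le_ofReal ?_
        have h2 := abs_le.1 ((hτ x u hu).trans (min_le_right _ _))
        nlinarith [sq_nonneg (Q.eval (L x) - 2 * Q.eval (L x + τ * u))]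
    have h2 : ∫⁻ y, ENNReal.ofReal (2 * Q.eval y ^ 2 + 1 / 2) * ENNReal.ofReal (g y)
        = ENNReal.ofReal (1 / 2) * (∫⁻ y, ENNReal.ofReal ((Polynomial.C 2 * Q).eval y ^ 2 * g y))
          + ENNReal.ofReal (1 / 2) := by
      have e : ∀ y, ENNReal.ofReal (2 * Q.eval y ^ 2 + 1 / 2) * ENNReal.ofReal (g y) =
          ENNReal.ofReal (1 / 2) * ENNReal.ofReal ((Polynomial.C 2 * Q).eval y ^ 2 * g y)
          + ENNReal.ofReal (1 / 2) * ENNReal.ofReal (g y) := by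
        intro y
        have := hg0 y
        rw [← ENNReal.ofReal_mul (by positivity), ← ENNReal.ofReal_mul (by positivity),
          ← ENNReal.ofReal_mul (by positivity), ← ENNReal.ofReal_add (by positivity) (by positivity)]
        congr 1
        simp
        ring
      simp_rw [e]
      have hgm := hgc.measurable
      rw [lintegral_add_left (by fun_prop), lintegral_const_mul _ (by fun_prop),
        lintegral_const_mul _ (by fun_prop), hg1, mul_one]
    have h3 := (hQ1.trans h1).trans_eq h2
    set I := ∫⁻ y, ENNReal.ofReal ((Polynomial.C 2 * Q).eval y ^ 2 * g y)
    have h4 : (1 : ℝ≥0∞) = ENNReal.ofReal (1 / 2) * 1 + ENNReal.ofReal (1 / 2) := by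
      rw [mul_one, ← ENNReal.ofReal_add (by norm_num) (by norm_num)]; norm_num
    rw [h4, ENNReal.add_le_add_iff_right ENNReal.ofReal_ne_top,
      ENNReal.mul_le_mul_iff_right (by simp) ENNReal.ofReal_ne_top] at h3
    exact h3
  have hdeg : (Polynomial.C 2 * Q).natDegree ≤ m := (Polynomial.natDegree_C_mul_le _ _).trans hQ
  have hsb := setLIntegral_sublevel_le_of_logConcave hgc hgs hg0 hg1 hglc hm hdeg hmass
    (show 0 < 4 * ε by positivity)
  have hD : MeasurableSet {y | |(Polynomial.C 2 * Q).eval y| ≤ 4 * ε} :=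
    (isClosed_le (by fun_prop) continuous_const).measurableSet
  have hA : MeasurableSet {x : K | |Q.eval (L x)| ≤ ε} :=
    (isClosed_le (by fun_prop) continuous_const).measurableSet
  have h1 := hlow ({y | |(Polynomial.C 2 * Q).eval y| ≤ 4 * ε}.indicator 1)
    (measurable_one.indicator hD) ({x : K | |Q.eval (L x)| ≤ ε}.indicator 1) fun x u hu => by
      by_cases hx : |Q.eval (L x)| ≤ ε
      · have h2 := abs_le.1 ((hτ x u hu).trans (min_le_left _ _))
        have h3 := abs_le.1 hx
        have : |(Polynomial.C 2 * Q).eval (L x + τ * u)| ≤ 4 * ε := by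
          simp only [Polynomial.eval_mul, Polynomial.eval_C]
          rw [abs_le]; constructor <;> linarith
        have hmem : L x + τ * u ∈ {y | |(Polynomial.C 2 * Q).eval y| ≤ 4 * ε} := this
        rw [indicator_of_mem hmem]
        exact indicator_le_self' (by simp) x
      · rw [indicator_of_notMem (by simpa using hx)]
        exact zero_le
  rw [lintegral_indicator_one hA] at h1
  refine h1.trans (le_trans (le_of_eq ?_) (hsb.trans (ENNReal.ofReal_le_ofReal ?_)))
  · rw [← lintegral_indicator hD]
    refine lintegral_congr fun y => ?_
    by_cases hy : y ∈ {y | |(Polynomial.C 2 * Q).eval y| ≤ 4 * ε}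
    · rw [indicator_of_mem hy, indicator_of_mem hy, Pi.one_apply, one_mul]
    · rw [indicator_of_notMem hy, indicator_of_notMem hy, zero_mul]
  · have h4 : (4 * ε) ^ (1 / (m : ℝ)) ≤ 4 * ε ^ (1 / (m : ℝ)) := by
      rw [Real.mul_rpow (by norm_num) hε.le]
      gcongr
      have hm1 : (1 : ℝ) ≤ m := by exact_mod_cast hm
      calc (4 : ℝ) ^ (1 / (m : ℝ)) ≤ 4 ^ (1 : ℝ) :=
            Real.rpow_le_rpow_of_exponent_le (by norm_num) ((div_le_one (by linarith)).2 hm1)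
        _ = 4 := by norm_num
    calc 128 * Real.exp 1 ^ 3 * (8 * Real.exp 1 ^ 2 + 1) * m * (4 * ε) ^ (1 / (m : ℝ))
        ≤ 128 * Real.exp 1 ^ 3 * (8 * Real.exp 1 ^ 2 + 1) * m * (4 * ε ^ (1 / (m : ℝ))) := by
          gcongr
      _ = _ := by ring

/-! ### The Carbery–Wright inequality -/

section CarberyWright

/-- The absolute constant in the small ball estimate for polynomials. -/
noncomputable def smallBallConst : ℝ := 2048 * Real.exp 1 ^ 3 * (8 * Real.exp 1 ^ 2 + 1)

theorem smallBallConst_pos : 0 < smallBallConst := by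
  unfold smallBallConst; positivity

theorem two_mul_rpow_inv_natCast_le {m : ℕ} (hm : 1 ≤ m) {ε : ℝ} (hε : 0 < ε) :
    (2 * ε) ^ (1 / (m : ℝ)) ≤ 2 * ε ^ (1 / (m : ℝ)) := by
  rw [Real.mul_rpow (by norm_num) hε.le]
  gcongr
  have hm1 : (1 : ℝ) ≤ m := by exact_mod_cast hm
  calc (2 : ℝ) ^ (1 / (m : ℝ)) ≤ 2 ^ (1 : ℝ) :=
        Real.rpow_le_rpow_of_exponent_le (by norm_num) ((div_le_one (by linarith)).2 hm1)
    _ = 2 := by norm_num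

variable {ι : Type*} [Fintype ι]

/-- Localization with a continuous `φ` lying between the indicators of `|P| ≤ ε` and `|P| ≤ 2 ε`,
and with `ψ = P² - 1` as constraint. On the line carrying the extremal measure, `P` is a polynomial
in one linear functional. -/
theorem measure_abs_eval_le_of_weaklyLogConcave {K : Set (ι → ℝ)} [CompactSpace K]
    (μ₀ : ProbabilityMeasure K) (hμ₀ : WeaklyLogConcave (μ₀ : Measure K))
    {p : MvPolynomial ι ℝ} {m : ℕ} (hm : 1 ≤ m) (hp : p.totalDegree ≤ m)
    (hp1 : 1 ≤ ∫ x : K, MvPolynomial.eval (x : ι → ℝ) p ^ 2 ∂(μ₀ : Measure K)) {ε : ℝ} (hε : 0 < ε) :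
    (μ₀ : Measure K) {x : K | |MvPolynomial.eval (x : ι → ℝ) p| ≤ ε} ≤
      ENNReal.ofReal (smallBallConst / 2 * m * ε ^ (1 / (m : ℝ))) := by
  have hpc : Continuous fun x : ι → ℝ => MvPolynomial.eval x p := MvPolynomial.continuous_eval p
  set P : (ι → ℝ) → ℝ := fun x => MvPolynomial.eval x p with hP
  have hPK : Continuous fun x : K => P x := hpc.comp continuous_subtype_val
  set φ : (ι → ℝ) → ℝ := fun x => max 0 (min 1 (2 - |P x| / ε)) with hφ
  have hφc : Continuous φ := by fun_prop
  have hφK : Continuous fun x : K => φ x := hφc.comp continuous_subtype_val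
  have hInt : ∀ (μ : ProbabilityMeasure K) {f : K → ℝ}, Continuous f →
      Integrable f (μ : Measure K) := fun μ _ hf => integrable_of_continuous_of_compactSpace _ hf
  obtain ⟨μ, hμ, hψ, hφle, hline⟩ := exists_extremal_weaklyLogConcave (φ := φ)
    (ψ := fun x => P x ^ 2 - 1) hφc (by fun_prop) μ₀ hμ₀ (by
      rw [integral_sub (hInt _ (by fun_prop)) (integrable_const _)]
      simpa using hp1)
  obtain ⟨L, x₀, v, hL⟩ := exists_line_of_forall_pair hline
  set Q : Polynomial ℝ := MvPolynomial.aeval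
    (fun k => Polynomial.C (x₀ k) + Polynomial.X * Polynomial.C (v k)) p with hQ
  have hQd : Q.natDegree ≤ m := by
    have := MvPolynomial.aeval_natDegree_le (m := m) (n := 1) p hp
      (fun k => Polynomial.C (x₀ k) + Polynomial.X * Polynomial.C (v k)) (fun k => by
        compute_degree)
    rwa [mul_one] at this
  have hQe : ∀ᵐ x : K ∂(μ : Measure K), P x = Q.eval (L x) := by
    filter_upwards [hL] with x hx
    have h1 : ∀ y : ℝ, Q.eval y = MvPolynomial.eval (fun k => x₀ k + y * v k) p := by
      intro y
      have h2 := MvPolynomial.comp_aeval_apply (R := ℝ)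
        (fun k => Polynomial.C (x₀ k) + Polynomial.X * Polynomial.C (v k)) (Polynomial.aeval y) p
      rw [← hQ] at h2
      rw [← Polynomial.coe_aeval_eq_eval, h2, ← MvPolynomial.coe_aeval_eq_eval]
      simp only [map_add, map_mul, Polynomial.aeval_C, Polynomial.aeval_X]
      rfl
    rw [h1, hP]
    congr 2
    ext k
    exact hx k
  have hQ1 : 1 ≤ ∫⁻ x : K, ENNReal.ofReal (Q.eval (L x) ^ 2) ∂(μ : Measure K) := by
    have e : ∫⁻ x : K, ENNReal.ofReal (Q.eval (L x) ^ 2) ∂(μ : Measure K)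
        = ∫⁻ x : K, ENNReal.ofReal (P x ^ 2) ∂(μ : Measure K) := by
      refine lintegral_congr_ae ?_
      filter_upwards [hQe] with x hx
      rw [hx]
    rw [e, ← ofReal_integral_eq_lintegral_ofReal (hInt _ (by fun_prop))
      (ae_of_all _ fun x => sq_nonneg _), ENNReal.one_le_ofReal]
    rw [integral_sub (hInt _ (by fun_prop)) (integrable_const _)] at hψ
    simpa using hψ
  have hmeas : ∀ r : ℝ, MeasurableSet {x : K | |P x| ≤ r} := fun r =>
    (isClosed_le (by fun_prop) continuous_const).measurableSet
  have hlow : (μ₀ : Measure K) {x : K | |P x| ≤ ε} ≤ ENNReal.ofReal (∫ x, φ x ∂(μ₀ : Measure K)) := by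
    rw [ofReal_integral_eq_lintegral_ofReal (hInt _ hφK) (ae_of_all _ fun x => le_max_left _ _),
      ← lintegral_indicator_one (hmeas ε)]
    refine lintegral_mono fun x => ?_
    by_cases hx : x ∈ {x : K | |P x| ≤ ε}
    · rw [indicator_of_mem hx, Pi.one_apply, ENNReal.one_le_ofReal]
      have hx' : |P x| ≤ ε := hx
      have : |P x| / ε ≤ 1 := (div_le_one hε).2 hx'
      exact le_max_of_le_right (le_min le_rfl (by linarith))
    · rw [indicator_of_notMem hx]; exact zero_le
  have hup : ENNReal.ofReal (∫ x, φ x ∂(μ : Measure K)) ≤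
      (μ : Measure K) {x : K | |P x| ≤ 2 * ε} := by
    rw [ofReal_integral_eq_lintegral_ofReal (hInt _ hφK) (ae_of_all _ fun x => le_max_left _ _),
      ← lintegral_indicator_one (hmeas (2 * ε))]
    refine lintegral_mono fun x => ?_
    by_cases hx : x ∈ {x : K | |P x| ≤ 2 * ε}
    · rw [indicator_of_mem hx, Pi.one_apply, ENNReal.ofReal_le_one]
      exact max_le zero_le_one (min_le_left _ _)
    · rw [indicator_of_notMem hx]
      have hx' : 2 * ε < |P x| := by simpa using hx
      have : 2 ≤ |P x| / ε := (le_div_iff₀ hε).2 hx'.le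
      rw [nonpos_iff_eq_zero, ENNReal.ofReal_eq_zero]
      exact max_le le_rfl ((min_le_right _ _).trans (by linarith))
  have hfin := measure_abs_eval_linear_le μ hμ L hm hQd hQ1 (show 0 < 2 * ε by positivity)
  have hset : (μ : Measure K) {x : K | |P x| ≤ 2 * ε} = (μ : Measure K) {x : K | |Q.eval (L x)| ≤ 2 * ε} := by
    refine measure_congr ?_
    filter_upwards [hQe] with x hx
    exact propext (by show |P x| ≤ _ ↔ |Q.eval (L x)| ≤ _; rw [hx])
  refine hlow.trans ((ENNReal.ofReal_le_ofReal hφle).trans (hup.trans (hset.le.trans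
    (hfin.trans (ENNReal.ofReal_le_ofReal ?_)))))
  have := two_mul_rpow_inv_natCast_le hm hε
  calc 512 * Real.exp 1 ^ 3 * (8 * Real.exp 1 ^ 2 + 1) * m * (2 * ε) ^ (1 / (m : ℝ))
      ≤ 512 * Real.exp 1 ^ 3 * (8 * Real.exp 1 ^ 2 + 1) * m * (2 * ε ^ (1 / (m : ℝ))) := by gcongr
    _ = _ := by rw [smallBallConst]; ring

/-- The normalised restriction to a compact convex set of a measure satisfying the
Prékopa–Leindler inequality is log-concave. -/
theorem PrekopaLeindler.exists_restrict {μ : Measure (ι → ℝ)} [IsProbabilityMeasure μ]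
    (hμ : PrekopaLeindler μ) {K : Set (ι → ℝ)} (hK : IsCompact K) (hKc : Convex ℝ K)
    (hK0 : μ K ≠ 0) :
    ∃ ν : ProbabilityMeasure K, WeaklyLogConcave (ν : Measure K) ∧
      (ν : Measure K) = (μ K)⁻¹ • μ.comap (Subtype.val : K → ι → ℝ) := by
  have hKm : MeasurableSet K := hK.measurableSet
  have hprob : IsProbabilityMeasure ((μ K)⁻¹ • μ.comap (Subtype.val : K → ι → ℝ)) := by
    refine ⟨?_⟩
    rw [Measure.smul_apply, comap_subtype_coe_apply hKm]
    simp [ENNReal.inv_mul_cancel hK0 (measure_ne_top μ K)]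
  refine ⟨⟨_, hprob⟩, ?_, rfl⟩
  intro s t hs ht hst f g h hf hg hh hf0 hg0 hh0 hfgh
  simp only [ProbabilityMeasure.coe_mk, integral_smul_measure]
  have hc0 : 0 < (μ K)⁻¹.toReal :=
    ENNReal.toReal_pos (ENNReal.inv_ne_zero.2 (measure_ne_top μ K)) (ENNReal.inv_ne_top.2 hK0)
  set c := (μ K)⁻¹.toReal with hc
  have hsub : ∀ F : (ι → ℝ) → ℝ, ∫ x : K, F x ∂(μ.comap (Subtype.val : K → ι → ℝ))
      = ∫ x in K, F x ∂μ := fun F => integral_subtype_comap hKm F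
  rw [hsub, hsub, hsub]
  have hlint : ∀ F : (ι → ℝ) → ℝ, Continuous F → (∀ x, 0 ≤ F x) →
      ∫⁻ x, K.indicator (fun x => ENNReal.ofReal (F x)) x ∂μ = ENNReal.ofReal (∫ x in K, F x ∂μ) := by
    intro F hF hF0
    rw [lintegral_indicator hKm, ofReal_integral_eq_lintegral_ofReal
      (hF.continuousOn.integrableOn_compact hK) (ae_of_all _ hF0)]
  have hm : ∀ F : (ι → ℝ) → ℝ, Continuous F →
      Measurable (K.indicator fun x => ENNReal.ofReal (F x)) := fun F hF =>
    hF.measurable.ennreal_ofReal.indicator hKm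
  have key := hμ hs ht hst (hm f hf) (hm g hg) (hm h hh) fun x y => by
    by_cases hx : x ∈ K
    · by_cases hy : y ∈ K
      · rw [indicator_of_mem hx, indicator_of_mem hy,
          indicator_of_mem (hKc hx hy hs.le ht.le hst),
          ENNReal.ofReal_rpow_of_nonneg (hf0 x) hs.le, ENNReal.ofReal_rpow_of_nonneg (hg0 y) ht.le,
          ← ENNReal.ofReal_mul (Real.rpow_nonneg (hf0 x) _)]
        exact ENNReal.ofReal_le_ofReal (hfgh x y)
      · rw [indicator_of_notMem hy, ENNReal.zero_rpow_of_pos ht, mul_zero]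
        exact zero_le
    · rw [indicator_of_notMem hx, ENNReal.zero_rpow_of_pos hs, zero_mul]
      exact zero_le
  rw [hlint f hf hf0, hlint g hg hg0, hlint h hh hh0] at key
  have hIf : 0 ≤ ∫ x in K, f x ∂μ := integral_nonneg hf0
  have hIg : 0 ≤ ∫ x in K, g x ∂μ := integral_nonneg hg0
  have hIh : 0 ≤ ∫ x in K, h x ∂μ := integral_nonneg hh0
  rw [ENNReal.ofReal_rpow_of_nonneg hIf hs.le, ENNReal.ofReal_rpow_of_nonneg hIg ht.le,
    ← ENNReal.ofReal_mul (Real.rpow_nonneg hIf _), ENNReal.ofReal_le_ofReal_iff hIh] at key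
  simp only [smul_eq_mul]
  rw [Real.mul_rpow hc0.le hIf, Real.mul_rpow hc0.le hIg]
  calc c ^ s * (∫ x in K, f x ∂μ) ^ s * (c ^ t * (∫ x in K, g x ∂μ) ^ t)
      = (c ^ s * c ^ t) * ((∫ x in K, f x ∂μ) ^ s * (∫ x in K, g x ∂μ) ^ t) := by ring
    _ = c * ((∫ x in K, f x ∂μ) ^ s * (∫ x in K, g x ∂μ) ^ t) := by
        rw [← Real.rpow_add hc0, hst, Real.rpow_one]
    _ ≤ c * ∫ x in K, h x ∂μ := by gcongr

/-- The Carbery–Wright inequality. -/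
theorem PrekopaLeindler.measure_abs_eval_le {μ : Measure (ι → ℝ)} [IsProbabilityMeasure μ]
    (hμ : PrekopaLeindler μ) {p : MvPolynomial ι ℝ} {m : ℕ} (hm : 1 ≤ m) (hp : p.totalDegree ≤ m)
    (hp1 : 1 ≤ ∫⁻ x, ENNReal.ofReal (MvPolynomial.eval x p ^ 2) ∂μ) {ε : ℝ} (hε : 0 < ε) :
    μ {x | |MvPolynomial.eval x p| ≤ ε} ≤
      ENNReal.ofReal (smallBallConst * m * ε ^ (1 / (m : ℝ))) := by
  have hpc : Continuous fun x : ι → ℝ => MvPolynomial.eval x p := MvPolynomial.continuous_eval p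
  set P : (ι → ℝ) → ℝ := fun x => MvPolynomial.eval x p with hP
  set K : ℕ → Set (ι → ℝ) := fun n => Metric.closedBall 0 n with hK
  have hKm : ∀ n, MeasurableSet (K n) := fun n => measurableSet_closedBall
  have hKmono : Monotone K := fun a b hab =>
    Metric.closedBall_subset_closedBall (by exact_mod_cast hab)
  have hKU : ⋃ n, K n = univ := by
    rw [eq_univ_iff_forall]
    intro x
    obtain ⟨n, hn⟩ := exists_nat_ge ‖x‖
    exact mem_iUnion.2 ⟨n, by simpa [hK] using hn⟩
  have hlim1 : Tendsto (fun n => ∫⁻ x in K n, ENNReal.ofReal (P x ^ 2) ∂μ) atTop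
      (𝓝 (∫⁻ x, ENNReal.ofReal (P x ^ 2) ∂μ)) := by
    have := tendsto_measure_iUnion_atTop (μ := μ.withDensity fun x => ENNReal.ofReal (P x ^ 2)) hKmono
    rw [hKU] at this
    simp only [Function.comp_def, withDensity_apply _ (hKm _), withDensity_apply _ MeasurableSet.univ,
      Measure.restrict_univ] at this
    exact this
  have hlim2 : Tendsto (fun n => μ ({x | |P x| ≤ ε} ∩ K n)) atTop (𝓝 (μ {x | |P x| ≤ ε})) := by
    have := tendsto_measure_iUnion_atTop (μ := μ)
      (s := fun n => {x | |P x| ≤ ε} ∩ K n) fun a b hab => inter_subset_inter_right _ (hKmono hab)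
    rwa [← inter_iUnion, hKU, inter_univ] at this
  -- A large ball keeps a quarter of the unit second moment; doubling `p` restores it, and
  -- normalising the restriction can only increase it.
  have hev : ∀ᶠ n in atTop, ENNReal.ofReal (1 / 4) < ∫⁻ x in K n, ENNReal.ofReal (P x ^ 2) ∂μ :=
    hlim1.eventually_const_lt (lt_of_lt_of_le (by rw [ENNReal.ofReal_lt_one]; norm_num) hp1)
  refine le_of_tendsto hlim2 (hev.mono fun n hn => ?_)
  have hKn0 : μ (K n) ≠ 0 := by
    intro h0
    rw [setLIntegral_measure_zero _ _ h0] at hn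
    exact not_lt_zero hn
  have hKcomp : IsCompact (K n) := isCompact_closedBall 0 _
  have : CompactSpace (K n) := isCompact_iff_compactSpace.1 hKcomp
  obtain ⟨ν, hν, hνe⟩ := hμ.exists_restrict hKcomp (convex_closedBall 0 _) hKn0
  have hinv : 1 ≤ (μ (K n))⁻¹ := ENNReal.one_le_inv.2 prob_le_one
  have hdeg : (MvPolynomial.C 2 * p).totalDegree ≤ m := by
    refine (MvPolynomial.totalDegree_mul _ _).trans ?_
    simpa using hp
  have hmain := measure_abs_eval_le_of_weaklyLogConcave ν hν hm hdeg (ε := 2 * ε) ?_ (by positivity)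
  · have hset : {x : K n | |MvPolynomial.eval (x : ι → ℝ) (MvPolynomial.C 2 * p)| ≤ 2 * ε}
        = Subtype.val ⁻¹' {x | |P x| ≤ ε} := by
      ext x
      simp only [mem_ofPred_eq, mem_preimage, map_mul, MvPolynomial.eval_C, abs_mul, abs_two, hP]
      constructor <;> intro h <;> linarith
    rw [hset, hνe, Measure.smul_apply, comap_subtype_coe_apply (hKm n),
      Subtype.image_preimage_coe, inter_comm] at hmain
    refine le_trans (le_mul_of_one_le_left zero_le hinv) (hmain.trans (ENNReal.ofReal_le_ofReal ?_))
    have := two_mul_rpow_inv_natCast_le hm hε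
    have hc := smallBallConst_pos
    calc smallBallConst / 2 * m * (2 * ε) ^ (1 / (m : ℝ))
        ≤ smallBallConst / 2 * m * (2 * ε ^ (1 / (m : ℝ))) := by gcongr
      _ = _ := by ring
  · rw [← ENNReal.one_le_ofReal, ofReal_integral_eq_lintegral_ofReal
      (integrable_of_continuous_of_compactSpace _ (by
        have := MvPolynomial.continuous_eval (MvPolynomial.C 2 * p)
        fun_prop)) (ae_of_all _ fun x => sq_nonneg _), hνe, lintegral_smul_measure]
    have e1 : ∫⁻ x : K n, ENNReal.ofReal (MvPolynomial.eval (x : ι → ℝ) (MvPolynomial.C 2 * p) ^ 2)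
        ∂(μ.comap Subtype.val) = 4 * ∫⁻ x in K n, ENNReal.ofReal (P x ^ 2) ∂μ := by
      rw [lintegral_subtype_comap (hKm n)
        (fun x => ENNReal.ofReal (MvPolynomial.eval x (MvPolynomial.C 2 * p) ^ 2)),
        ← lintegral_const_mul _ (by fun_prop)]
      refine lintegral_congr fun x => ?_
      rw [map_mul, MvPolynomial.eval_C, mul_pow, ENNReal.ofReal_mul (by norm_num)]
      norm_num [hP]
    rw [e1]
    refine le_trans ?_ (le_mul_of_one_le_left zero_le hinv)
    calc (1 : ℝ≥0∞) = 4 * ENNReal.ofReal (1 / 4) := by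
          rw [show (4 : ℝ≥0∞) = ENNReal.ofReal 4 by simp, ← ENNReal.ofReal_mul (by norm_num)]
          norm_num
      _ ≤ 4 * ∫⁻ x in K n, ENNReal.ofReal (P x ^ 2) ∂μ := by gcongr

end CarberyWright

/-! ### The smooth test function -/

/-- Mean value inequality on the segment from `0` to `b`. Applied twice, it turns Hölder continuity
of a second derivative into a Taylor remainder bound. -/
theorem abs_le_rpow_of_abs_deriv_le {f f' : ℝ → ℝ} (hf : ∀ x, HasDerivAt f (f' x) x)
    (h0 : f 0 = 0) {C α : ℝ} (hC : 0 ≤ C) (hα : 0 ≤ α) (hf' : ∀ x, |f' x| ≤ C * |x| ^ α) (b : ℝ) :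
    |f b| ≤ C * |b| ^ (α + 1) := by
  have key := Convex.norm_image_sub_le_of_norm_hasDerivWithin_le (f := f) (f' := f')
    (s := uIcc 0 b) (C := C * |b| ^ α) (x := 0) (y := b)
    (fun x _ => (hf x).hasDerivWithinAt) (fun x hx => ?_) (convex_uIcc 0 b) left_mem_uIcc
    right_mem_uIcc
  · rw [h0, sub_zero, sub_zero, Real.norm_eq_abs, Real.norm_eq_abs] at key
    rw [Real.rpow_add_one' (abs_nonneg b) (by positivity), ← mul_assoc]
    exact key
  · refine (hf' x).trans (mul_le_mul_of_nonneg_left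
      (Real.rpow_le_rpow (abs_nonneg x) ?_ hα) hC)
    have := abs_sub_left_of_mem_uIcc hx
    simpa using this

/-- A smooth step from `1` to `0` across `[0, 1]`, with a second order Taylor expansion whose
remainder is controlled by any power between `2` and `3`. -/
theorem exists_smooth_step : ∃ (h h₁ h₂ : ℝ → ℝ) (K : ℝ), 0 < K ∧ Continuous h ∧
    (∀ x, 0 ≤ h x) ∧ (∀ x, h x ≤ 1) ∧ (∀ x ≤ 0, h x = 1) ∧ (∀ x, 1 ≤ x → h x = 0) ∧
    ∀ ν : ℝ, 2 ≤ ν → ν ≤ 3 → ∀ a b : ℝ,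
      |h (a + b) - h a - h₁ a * b - h₂ a * b ^ 2 / 2| ≤ K * |b| ^ ν := by
  set g := Real.smoothTransition with hg
  have gs : ContDiff ℝ 3 g := Real.smoothTransition.contDiff (n := 3)
  have g1s : ContDiff ℝ 2 (deriv g) := by
    have := gs
    rw [show (3 : WithTop ℕ∞) = 2 + 1 by norm_num, contDiff_succ_iff_deriv] at this
    exact this.2.2
  have g2s : ContDiff ℝ 1 (deriv (deriv g)) := by
    have := g1s
    rw [show (2 : WithTop ℕ∞) = 1 + 1 by norm_num, contDiff_succ_iff_deriv] at this
    exact this.2.2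
  have g3s : Continuous (deriv (deriv (deriv g))) := g2s.continuous_deriv le_rfl
  have c1 : HasCompactSupport (deriv g) := by
    refine HasCompactSupport.intro (isCompact_Icc (a := (0 : ℝ)) (b := 1)) fun x hx => ?_
    rw [mem_Icc, not_and_or, not_le, not_le] at hx
    rcases hx with hx | hx
    · have : g =ᶠ[𝓝 x] fun _ => 0 := by
        filter_upwards [Iio_mem_nhds hx] with y hy
        exact Real.smoothTransition.zero_of_nonpos hy.le
      rw [this.deriv_eq]; simp
    · have : g =ᶠ[𝓝 x] fun _ => 1 := by
        filter_upwards [Ioi_mem_nhds hx] with y hy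
        exact Real.smoothTransition.one_of_one_le hy.le
      rw [this.deriv_eq]; simp
  obtain ⟨B2, hB2⟩ := c1.deriv.exists_bound_of_continuous g2s.continuous
  obtain ⟨B3, hB3⟩ := c1.deriv.deriv.exists_bound_of_continuous g3s
  have d0 : ∀ x, HasDerivAt g (deriv g x) x := fun x =>
    (gs.differentiable (by norm_num) x).hasDerivAt
  have d1 : ∀ x, HasDerivAt (deriv g) (deriv (deriv g) x) x := fun x =>
    (g1s.differentiable (by norm_num) x).hasDerivAt
  have d2 : ∀ x, HasDerivAt (deriv (deriv g)) (deriv (deriv (deriv g)) x) x := fun x =>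
    (g2s.differentiable (by norm_num) x).hasDerivAt
  have B2n : 0 ≤ B2 := (norm_nonneg _).trans (hB2 0)
  have B3n : 0 ≤ B3 := (norm_nonneg _).trans (hB3 0)
  -- For `|b| ≤ 1` the Lipschitz bound `B3 |b|` suffices because `ν - 2 ≤ 1`; for `|b| ≥ 1` the
  -- crude bound `2 B2` does. One `K` thus serves every `ν` in `[2, 3]`.
  set K := 2 * B2 + B3 + 1 with hK
  have Kp : 0 < K := by positivity
  have lip : ∀ ν : ℝ, 2 ≤ ν → ν ≤ 3 → ∀ a b : ℝ,
      |deriv (deriv g) (a + b) - deriv (deriv g) a| ≤ K * |b| ^ (ν - 2) := by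
    intro ν h2 h3 a b
    rcases le_total |b| 1 with hb | hb
    · have h1 : ‖deriv (deriv g) (a + b) - deriv (deriv g) a‖ ≤ B3 * ‖(a + b) - a‖ :=
        Convex.norm_image_sub_le_of_norm_hasDerivWithin_le (s := univ)
          (fun x _ => (d2 x).hasDerivWithinAt) (fun x _ => hB3 x) convex_univ (mem_univ _)
          (mem_univ _)
      rw [add_sub_cancel_left, Real.norm_eq_abs, Real.norm_eq_abs] at h1
      have h5 : |b| ≤ |b| ^ (ν - 2) := by
        rcases (abs_nonneg b).eq_or_lt with h | h
        · rw [← h]; exact Real.rpow_nonneg le_rfl _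
        · simpa using Real.rpow_le_rpow_of_exponent_ge h hb (show ν - 2 ≤ 1 by linarith)
      calc _ ≤ B3 * |b| := h1
        _ ≤ K * |b| ^ (ν - 2) := mul_le_mul (by linarith) h5 (abs_nonneg _) Kp.le
    · have h5 : (1 : ℝ) ≤ |b| ^ (ν - 2) := Real.one_le_rpow hb (by linarith)
      have h6 := hB2 (a + b)
      have h7 := hB2 a
      rw [Real.norm_eq_abs] at h6 h7
      calc _ ≤ |deriv (deriv g) (a + b)| + |deriv (deriv g) a| := abs_sub _ _
        _ ≤ K * 1 := by linarith
        _ ≤ _ := mul_le_mul_of_nonneg_left h5 Kp.le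
  refine ⟨fun x => 1 - g x, fun x => -deriv g x, fun x => -deriv (deriv g) x, K, Kp,
    continuous_const.sub gs.continuous, fun x => sub_nonneg.2 (Real.smoothTransition.le_one x),
    fun x => by simpa using Real.smoothTransition.nonneg x, fun x hx => ?_, fun x hx => ?_,
    fun ν h2 h3 a b => ?_⟩
  · simp [hg, Real.smoothTransition.zero_of_nonpos hx]
  · simp [hg, Real.smoothTransition.one_of_one_le hx]
  have s1 : ∀ y, |deriv g (a + y) - deriv g a - deriv (deriv g) a * y|
      ≤ K * |y| ^ (ν - 2 + 1) := by
    refine abs_le_rpow_of_abs_deriv_le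
      (f' := fun y => deriv (deriv g) (a + y) - deriv (deriv g) a) (fun x => ?_) (by simp) Kp.le
      (by linarith) (lip ν h2 h3 a)
    have h1 : HasDerivAt (fun y => deriv g (a + y)) (deriv (deriv g) (a + x)) x :=
      (d1 (a + x)).comp_const_add a x
    have h2 := (h1.sub_const (deriv g a)).sub
      ((hasDerivAt_id x).const_mul (deriv (deriv g) a))
    rw [mul_one] at h2
    exact h2
  have s2 : |g (a + b) - g a - deriv g a * b - deriv (deriv g) a * b ^ 2 / 2|
      ≤ K * |b| ^ (ν - 2 + 1 + 1) := by
    refine abs_le_rpow_of_abs_deriv_le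
      (f := fun y => g (a + y) - g a - deriv g a * y - deriv (deriv g) a * y ^ 2 / 2)
      (f' := fun y => deriv g (a + y) - deriv g a - deriv (deriv g) a * y) (fun x => ?_)
      (by simp) Kp.le (by linarith) s1 b
    have h1 : HasDerivAt (fun y => g (a + y)) (deriv g (a + x)) x :=
      (d0 (a + x)).comp_const_add a x
    have h2 := ((h1.sub_const (g a)).sub ((hasDerivAt_id x).const_mul (deriv g a))).sub
      (((hasDerivAt_pow 2 x).const_mul (deriv (deriv g) a)).div_const 2)
    refine h2.congr_deriv ?_
    push_cast; ring
  rw [show ν - 2 + 1 + 1 = ν by ring] at s2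
  rw [← abs_neg]
  convert s2 using 2
  ring

/-! ### Comparison of laws with two matching moments -/

section Moments

variable {Ω : Type*} [MeasurableSpace Ω] {P : Measure Ω}

theorem lintegral_rpow_enorm_eq_eLpNorm {U : Ω → ℝ} {ν : ℝ} (hν : 0 < ν) :
    ∫⁻ ω, ‖U ω‖ₑ ^ ν ∂P = eLpNorm U (ENNReal.ofReal ν) P ^ ν := by
  rw [eLpNorm_eq_lintegral_rpow_enorm_toReal (by simpa using hν) ENNReal.ofReal_ne_top,
    ENNReal.toReal_ofReal hν.le, ← ENNReal.rpow_mul, one_div, inv_mul_cancel₀ hν.ne',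
    ENNReal.rpow_one]

variable [IsProbabilityMeasure P]

/-- A function with a second order Taylor expansion with remainder `K |b| ^ ν` has nearly the same
expectation under two laws which share their first two moments. -/
theorem abs_integral_comp_sub_le_of_moments {U V : Ω → ℝ} (hU : MemLp U 2 P) (hV : MemLp V 2 P)
    (h1 : ∫ ω, U ω ∂P = ∫ ω, V ω ∂P) (h2 : ∫ ω, U ω ^ 2 ∂P = ∫ ω, V ω ^ 2 ∂P)
    {h : ℝ → ℝ} (hc : Continuous h) {B : ℝ} (hB : ∀ x, |h x| ≤ B) {K ν a c₁ c₂ : ℝ}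
    (hK : 0 ≤ K) (hν : 0 ≤ ν)
    (hh : ∀ b, |h (a + b) - h a - c₁ * b - c₂ * b ^ 2 / 2| ≤ K * |b| ^ ν) :
    ENNReal.ofReal |∫ ω, h (a + U ω) ∂P - ∫ ω, h (a + V ω) ∂P|
      ≤ ENNReal.ofReal K * (∫⁻ ω, ‖U ω‖ₑ ^ ν ∂P + ∫⁻ ω, ‖V ω‖ₑ ^ ν ∂P) := by
  set F : ℝ → ℝ := fun b => h (a + b) - h a - c₁ * b - c₂ * b ^ 2 / 2 with hF
  have ih : ∀ {U : Ω → ℝ}, MemLp U 2 P → Integrable (fun ω => h (a + U ω)) P := by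
    intro U hU
    refine Integrable.of_bound (C := B) ?_ (ae_of_all _ fun ω => by simpa using hB _)
    exact hc.comp_aestronglyMeasurable (hU.1.const_add a)
  have key : ∀ {U : Ω → ℝ}, MemLp U 2 P → ∫ ω, F (U ω) ∂P
      = ∫ ω, h (a + U ω) ∂P - h a - c₁ * ∫ ω, U ω ∂P - c₂ * (∫ ω, U ω ^ 2 ∂P) / 2 := by
    intro U hU
    have i0 := ih hU
    have i1 : Integrable (fun ω => c₁ * U ω) P := (hU.integrable one_le_two).const_mul _
    have i2 : Integrable (fun ω => c₂ * U ω ^ 2 / 2) P := (hU.integrable_sq.const_mul c₂).div_const 2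
    have i3 : Integrable (fun ω => h (a + U ω) - h a) P := i0.sub (integrable_const _)
    have i4 : Integrable (fun ω => h (a + U ω) - h a - c₁ * U ω) P := i3.sub i1
    simp only [hF]
    rw [integral_sub i4 i2, integral_sub i3 i1, integral_sub i0 (integrable_const _),
      integral_const_mul, integral_div, integral_const_mul]
    simp
  have bd : ∀ {U : Ω → ℝ}, MemLp U 2 P →
      ‖∫ ω, F (U ω) ∂P‖ₑ ≤ ENNReal.ofReal K * ∫⁻ ω, ‖U ω‖ₑ ^ ν ∂P := by
    intro U hU
    refine (enorm_integral_le_lintegral_enorm _).trans ?_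
    rw [← lintegral_const_mul' _ _ ENNReal.ofReal_ne_top]
    refine lintegral_mono fun ω => ?_
    rw [Real.enorm_eq_ofReal_abs, Real.enorm_eq_ofReal_abs,
      ENNReal.ofReal_rpow_of_nonneg (abs_nonneg _) hν, ← ENNReal.ofReal_mul hK]
    exact ENNReal.ofReal_le_ofReal (hh _)
  have e : ∫ ω, h (a + U ω) ∂P - ∫ ω, h (a + V ω) ∂P = ∫ ω, F (U ω) ∂P - ∫ ω, F (V ω) ∂P := by
    rw [key hU, key hV, h1, h2]; ring
  rw [e, ← Real.enorm_eq_ofReal_abs, mul_add]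
  exact enorm_sub_le.trans (add_le_add (bd hU) (bd hV))

/-- The absolute moment of order `ν` of the standard Gaussian law. -/
noncomputable def gaussianMoment (ν : ℝ) : ℝ≥0∞ := ∫⁻ x, ‖x‖ₑ ^ ν ∂gaussianReal 0 1

theorem gaussianMoment_ne_top {ν : ℝ} (hν : 0 < ν) : gaussianMoment ν ≠ ∞ := by
  have h := memLp_id_gaussianReal' (μ := 0) (v := 1) (ENNReal.ofReal ν) ENNReal.ofReal_ne_top
  have h2 := lintegral_rpow_enorm_lt_top_of_eLpNorm_lt_top (by simpa using hν)
    ENNReal.ofReal_ne_top h.2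
  rw [ENNReal.toReal_ofReal hν.le] at h2
  exact h2.ne

/-- Among the centred laws of given variance, the Gaussian one has the smallest absolute moment of
order `ν`, up to a constant. -/
theorem lintegral_rpow_enorm_gaussian_le {U V : Ω → ℝ} (hU : MemLp U 2 P)
    (hV : HasGaussianLaw V P) (h0 : ∫ ω, V ω ∂P = 0)
    (h2 : ∫ ω, U ω ^ 2 ∂P = ∫ ω, V ω ^ 2 ∂P) {ν : ℝ} (hν : 2 ≤ ν) :
    ∫⁻ ω, ‖V ω‖ₑ ^ ν ∂P ≤ gaussianMoment ν * ∫⁻ ω, ‖U ω‖ₑ ^ ν ∂P := by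
  have hν0 : 0 < ν := by linarith
  set v := ∫ ω, U ω ^ 2 ∂P with hv
  have hv0 : 0 ≤ v := integral_nonneg fun _ => sq_nonneg _
  have hVm : AEMeasurable V P := hV.aemeasurable
  have hvar : Var[V; P] = v := by
    rw [variance_eq_integral hVm, h0]; simpa using h2.symm
  have law : P.map V = (gaussianReal 0 1).map (fun x => Real.sqrt v * x) := by
    rw [hV.map_eq_gaussianReal, gaussianReal_map_const_mul, h0, hvar, mul_zero, mul_one]
    congr 1
    ext
    simp [hv0, Real.sq_sqrt hv0]
  have e1 : ∫⁻ ω, ‖V ω‖ₑ ^ ν ∂P = ENNReal.ofReal (Real.sqrt v) ^ ν * gaussianMoment ν := by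
    have m : Measurable fun x : ℝ => ‖x‖ₑ ^ ν := by fun_prop
    rw [← lintegral_map' (f := fun x : ℝ => ‖x‖ₑ ^ ν) m.aemeasurable hVm, law,
      lintegral_map m (by fun_prop), gaussianMoment, ← lintegral_const_mul _ m]
    refine lintegral_congr fun x => ?_
    rw [enorm_mul, ENNReal.mul_rpow_of_nonneg _ _ hν0.le, Real.enorm_eq_ofReal (Real.sqrt_nonneg v)]
  -- `V` is distributed as `√v` times a standard Gaussian, so its moment scales as `√v ^ ν`. The
  -- claim reduces to monotonicity of `L^p` norms on a probability space.
  have e2 : ENNReal.ofReal (Real.sqrt v) = eLpNorm U 2 P := by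
    rw [hU.eLpNorm_eq_integral_rpow_norm (by simp) (by simp)]
    congr 1
    rw [Real.sqrt_eq_rpow, hv]
    simp
  rw [e1, mul_comm, e2, lintegral_rpow_enorm_eq_eLpNorm hν0]
  gcongr
  refine eLpNorm_le_eLpNorm_of_exponent_le ?_ hU.1
  rw [show (2 : ℝ≥0∞) = ENNReal.ofReal 2 by simp]
  exact ENNReal.ofReal_le_ofReal hν

end Moments

/-! ### Replacement of one independent block by its Gaussian match -/

section Swap

variable {Ω : Type*} [MeasurableSpace Ω] {P : Measure Ω} {d : ℕ}
  {X Z : Ω → EuclideanSpace ℝ (Fin d)}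

theorem ProbabilityTheory.HasGaussianLaw.inner_sub (h : HasGaussianLaw Z P) (g c : EuclideanSpace ℝ (Fin d)) :
    HasGaussianLaw (fun ω => inner ℝ g (Z ω - c)) P := by
  have h1 : HasGaussianLaw (fun ω => Z ω - c) P := by
    have := h.isGaussian_map
    refine ⟨?_⟩
    have e : P.map (fun ω => Z ω - c) = (P.map Z).map (fun x => x - c) :=
      (AEMeasurable.map_map_of_aemeasurable (g := fun x => x - c) (by fun_prop)
        h.aemeasurable).symm
    rw [e]
    infer_instance
  exact h1.map_fun (innerSL ℝ g)

variable [IsProbabilityMeasure P]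

theorem integral_inner_sub_integral (hX : Integrable X P) (g : EuclideanSpace ℝ (Fin d)) :
    ∫ ω, inner ℝ g (X ω - ∫ ω', X ω' ∂P) ∂P = 0 := by
  have hi : Integrable (fun ω => X ω - ∫ ω', X ω' ∂P) P := hX.sub (integrable_const _)
  rw [integral_inner hi g, integral_sub hX (integrable_const _)]
  simp

theorem memLp_inner_sub {p : ℝ≥0∞} (hX : MemLp X p P) (g c : EuclideanSpace ℝ (Fin d)) :
    MemLp (fun ω => inner ℝ g (X ω - c)) p P :=
  (hX.sub (memLp_const c)).const_inner g

theorem integral_inner_sub_sq (hX : MemLp X 2 P) (g : EuclideanSpace ℝ (Fin d)) :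
    ∫ ω, inner ℝ g (X ω - ∫ ω', X ω' ∂P) ^ 2 ∂P
      = ∑ j, ∑ k, g j * (g k * covariance (fun ω => X ω j) (fun ω => X ω k) P) := by
  have hi : Integrable X P := hX.integrable one_le_two
  have hj : ∀ j, MemLp (fun ω => X ω j) 2 P := fun j =>
    hX.continuousLinearMap_comp (EuclideanSpace.proj (𝕜 := ℝ) j)
  have hgj : ∀ j, MemLp (fun ω => g j * X ω j) 2 P := fun j => (hj j).const_mul _
  have e : (fun ω => inner ℝ g (X ω)) = fun ω => ∑ j, g j * X ω j := by
    ext ω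
    simp [PiLp.inner_apply, mul_comm]
  have h1 : Var[fun ω => inner ℝ g (X ω); P]
      = ∫ ω, inner ℝ g (X ω - ∫ ω', X ω' ∂P) ^ 2 ∂P := by
    rw [variance_eq_integral (hX.const_inner g).1.aemeasurable, integral_inner hi g]
    simp only [inner_sub_right]
  rw [← h1, e, ← covariance_self (by fun_prop), covariance_fun_sum_fun_sum hgj hgj]
  simp_rw [covariance_const_mul_left, covariance_const_mul_right]

theorem IsGaussianMatch.integral_inner_sub_sq (h : IsGaussianMatch P X Z) (hX : MemLp X 2 P)
    (g : EuclideanSpace ℝ (Fin d)) :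
    ∫ ω, inner ℝ g (X ω - ∫ ω', X ω' ∂P) ^ 2 ∂P
      = ∫ ω, inner ℝ g (Z ω - ∫ ω', X ω' ∂P) ^ 2 ∂P := by
  rw [← h.mean, _root_.integral_inner_sub_sq h.gaussian.memLp_two, h.mean,
    _root_.integral_inner_sub_sq hX]
  simp_rw [h.cov]

theorem IsGaussianMatch.integral_inner_sub (h : IsGaussianMatch P X Z)
    (g : EuclideanSpace ℝ (Fin d)) :
    ∫ ω, inner ℝ g (Z ω - ∫ ω', X ω' ∂P) ∂P = 0 := by
  rw [← h.mean]; exact integral_inner_sub_integral h.gaussian.integrable g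

section Fubini

variable {F G : Type*} [MeasurableSpace F] [MeasurableSpace G] {W : Ω → F} {Y : Ω → G}

theorem ProbabilityTheory.IndepFun.lintegral_eq (h : IndepFun W Y P) (hW : Measurable W)
    (hY : Measurable Y) {Φ : F × G → ℝ≥0∞} (hΦ : Measurable Φ) :
    ∫⁻ ω, Φ (W ω, Y ω) ∂P = ∫⁻ ω, ∫⁻ ω', Φ (W ω, Y ω') ∂P ∂P := by
  have h1 := h.map_prod_eq_prod_map_map hW.aemeasurable hY.aemeasurable
  rw [← lintegral_map hΦ (hW.prodMk hY), h1, lintegral_prod _ hΦ.aemeasurable,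
    lintegral_map hΦ.lintegral_prod_right' hW]
  exact lintegral_congr fun ω => lintegral_map (hΦ.comp measurable_prodMk_left) hY

theorem ProbabilityTheory.IndepFun.integral_eq (h : IndepFun W Y P) (hW : Measurable W)
    (hY : Measurable Y) {Φ : F × G → ℝ} (hΦ : Measurable Φ) {B : ℝ} (hB : ∀ x, |Φ x| ≤ B) :
    Integrable (fun ω => ∫ ω', Φ (W ω, Y ω') ∂P) P ∧
    ∫ ω, Φ (W ω, Y ω) ∂P = ∫ ω, ∫ ω', Φ (W ω, Y ω') ∂P ∂P := by
  have h1 := h.map_prod_eq_prod_map_map hW.aemeasurable hY.aemeasurable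
  have := Measure.isProbabilityMeasure_map (μ := P) hW.aemeasurable
  have := Measure.isProbabilityMeasure_map (μ := P) hY.aemeasurable
  have hi : Integrable Φ ((P.map W).prod (P.map Y)) :=
    Integrable.of_bound (C := B) hΦ.aestronglyMeasurable (ae_of_all _ fun x => by simpa using hB x)
  have e : ∀ w, ∫ y, Φ (w, y) ∂(P.map Y) = ∫ ω', Φ (w, Y ω') ∂P := fun w =>
    integral_map hY.aemeasurable (hΦ.comp measurable_prodMk_left).aestronglyMeasurable
  have hl := hi.integral_prod_left
  simp only [e] at hl
  refine ⟨hl.comp_measurable hW, ?_⟩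
  rw [← integral_map (hW.prodMk hY).aemeasurable hΦ.aestronglyMeasurable, h1, integral_prod _ hi]
  simp only [e]
  exact integral_map hW.aemeasurable hl.1

variable {Φ : F × EuclideanSpace ℝ (Fin d) → ℝ} {g : F → EuclideanSpace ℝ (Fin d)}

/-- Replacing the independent argument of an affine function by a Gaussian one with the same mean
and covariance. -/
theorem IsGaussianMatch.abs_integral_comp_sub_le (h : IsGaussianMatch P X Z) (hX : MemLp X 2 P)
    (hWm : Measurable W) (hXm : Measurable X) (hZm : Measurable Z)
    (hWX : IndepFun W X P) (hWZ : IndepFun W Z P) (hΦ : Measurable Φ)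
    (hg : ∀ w y, Φ (w, y)
      = Φ (w, ∫ ω, X ω ∂P) + inner ℝ (g w) (y - ∫ ω, X ω ∂P))
    {H : ℝ → ℝ} (hc : Continuous H) {B : ℝ} (hB : ∀ x, |H x| ≤ B) {K ν : ℝ}
    (hK : 0 ≤ K) (hν : 2 ≤ ν)
    (hH : ∀ a, ∃ c₁ c₂, ∀ b, |H (a + b) - H a - c₁ * b - c₂ * b ^ 2 / 2| ≤ K * |b| ^ ν) :
    ENNReal.ofReal |∫ ω, H (Φ (W ω, X ω)) ∂P - ∫ ω, H (Φ (W ω, Z ω)) ∂P|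
      ≤ ENNReal.ofReal K * (1 + gaussianMoment ν)
        * ∫⁻ ω, ‖(inner ℝ (g (W ω)) (X ω - ∫ ω', X ω' ∂P) : ℝ)‖ₑ ^ ν ∂P := by
  set c := ∫ ω, X ω ∂P with hcdef
  have mH : Measurable fun x => H (Φ x) := hc.measurable.comp hΦ
  obtain ⟨iX, eX⟩ := hWX.integral_eq hWm hXm mH (fun x => hB _)
  obtain ⟨iZ, eZ⟩ := hWZ.integral_eq hWm hZm mH (fun x => hB _)
  have hin : ∀ w y, (inner ℝ (g w) (y - c) : ℝ) = Φ (w, y) - Φ (w, c) := fun w y => by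
    rw [hg w y]; ring
  -- No measurability of `g` is assumed; the increment is measurable because it equals `Φ (w, y) - Φ
  -- (w, c)`.
  obtain ⟨ψ, mψ, hψ⟩ : ∃ ψ : F × EuclideanSpace ℝ (Fin d) → ℝ≥0∞, Measurable ψ ∧
      ∀ w y, ‖(inner ℝ (g w) (y - c) : ℝ)‖ₑ ^ ν = ψ (w, y) := by
    refine ⟨fun x => ‖Φ x - Φ (x.1, c)‖ₑ ^ ν, ?_, fun w y => by rw [hin]⟩
    have h1 : Measurable fun x : F × EuclideanSpace ℝ (Fin d) => Φ (x.1, c) :=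
      hΦ.comp (measurable_fst.prodMk measurable_const)
    exact (hΦ.sub h1).enorm.pow_const ν
  rw [eX, eZ, ← integral_sub iX iZ, ← Real.enorm_eq_ofReal_abs]
  refine (enorm_integral_le_lintegral_enorm _).trans ?_
  have m1 : Measurable fun x : F × Ω => ψ (x.1, X x.2) :=
    mψ.comp (measurable_fst.prodMk (hXm.comp measurable_snd))
  have m2 : Measurable fun ω => ∫⁻ ω', ψ (W ω, X ω') ∂P := m1.lintegral_prod_right'.comp hWm
  simp only [hψ]
  rw [hWX.lintegral_eq hWm hXm mψ, ← lintegral_const_mul _ m2]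
  refine lintegral_mono fun ω => ?_
  obtain ⟨c₁, c₂, hT⟩ := hH (Φ (W ω, c))
  have mU := memLp_inner_sub hX (g (W ω)) c
  have mV := memLp_inner_sub h.gaussian.memLp_two (g (W ω)) c
  have z1 := integral_inner_sub_integral (hX.integrable one_le_two) (g (W ω))
  have z2 := h.integral_inner_sub (g (W ω))
  have z3 := h.integral_inner_sub_sq hX (g (W ω))
  have k1 := abs_integral_comp_sub_le_of_moments mU mV (z1.trans z2.symm) z3 hc hB hK
    (by linarith) hT
  have k2 := lintegral_rpow_enorm_gaussian_le mU (h.gaussian.inner_sub (g (W ω)) c) z2 z3 hν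
  simp only [hψ] at k1 k2
  rw [Real.enorm_eq_ofReal_abs]
  simp only [hg (W ω) (X _), hg (W ω) (Z _)]
  refine k1.trans ?_
  rw [mul_assoc]
  refine mul_le_mul_right ((add_le_add_right k2 _).trans (le_of_eq ?_)) _
  ring

/-- Given `W`, the second moment of an affine function depends only on the mean and covariance of
its argument. The extended-valued integral spares any integrability condition on `Φ`. -/
theorem IsGaussianMatch.lintegral_sq_eq (h : IsGaussianMatch P X Z) (hX : MemLp X 2 P)
    (hWm : Measurable W) (hXm : Measurable X) (hZm : Measurable Z)
    (hWX : IndepFun W X P) (hWZ : IndepFun W Z P) (hΦ : Measurable Φ)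
    (hg : ∀ w y, Φ (w, y)
      = Φ (w, ∫ ω, X ω ∂P) + inner ℝ (g w) (y - ∫ ω, X ω ∂P)) :
    ∫⁻ ω, ENNReal.ofReal (Φ (W ω, X ω) ^ 2) ∂P = ∫⁻ ω, ENNReal.ofReal (Φ (W ω, Z ω) ^ 2) ∂P := by
  have mΦ : Measurable fun x => ENNReal.ofReal (Φ x ^ 2) := by fun_prop
  rw [hWX.lintegral_eq hWm hXm mΦ, hWZ.lintegral_eq hWm hZm mΦ]
  refine lintegral_congr fun ω => ?_
  set c := ∫ ω, X ω ∂P with hcdef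
  have key : ∀ {U : Ω → ℝ} (a : ℝ), MemLp U 2 P → ∫ ω, U ω ∂P = 0 →
      ∫⁻ ω, ENNReal.ofReal ((a + U ω) ^ 2) ∂P = ENNReal.ofReal (a ^ 2 + ∫ ω, U ω ^ 2 ∂P) := by
    intro U a hU h0
    have i1 : Integrable (fun ω => a ^ 2 + 2 * a * U ω) P :=
      (integrable_const _).add ((hU.integrable one_le_two).const_mul _)
    have e : ∀ ω, (a + U ω) ^ 2 = (a ^ 2 + 2 * a * U ω) + U ω ^ 2 := fun ω => by ring
    simp only [e]
    have i2 : Integrable (fun ω => a ^ 2 + 2 * a * U ω + U ω ^ 2) P := i1.add hU.integrable_sq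
    rw [← ofReal_integral_eq_lintegral_ofReal i2
      (ae_of_all _ fun ω => by simp only [← e]; exact sq_nonneg _)]
    rw [integral_add i1 hU.integrable_sq, integral_add (integrable_const _)
      ((hU.integrable one_le_two).const_mul _), integral_const_mul, h0]
    simp
  simp only [hg (W ω) (X _), hg (W ω) (Z _)]
  rw [key _ (memLp_inner_sub hX _ c) (integral_inner_sub_integral (hX.integrable one_le_two) _),
    key _ (memLp_inner_sub h.gaussian.memLp_two _ c) (h.integral_inner_sub _),
    h.integral_inner_sub_sq hX]

end Fubini

end Swap

/-! ### Multilinear polynomials are affine in each block -/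

section Multilinear

variable {n d m : ℕ} {q : (Fin n → EuclideanSpace ℝ (Fin d)) → ℝ}

theorem MvPolynomial.differentiable_eval_comp {κ E : Type*} [NormedAddCommGroup E]
    [NormedSpace ℝ E] {c : κ → E → ℝ} (hc : ∀ k, Differentiable ℝ (c k)) (p : MvPolynomial κ ℝ) :
    Differentiable ℝ fun y => MvPolynomial.eval (fun k => c k y) p := by
  induction p using MvPolynomial.induction_on with
  | C a => simp
  | add p r hp hr => simp only [map_add]; exact hp.add hr
  | mul_X p k hp => simp only [map_mul, MvPolynomial.eval_X]; exact hp.mul (hc k)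

theorem IsPolyDegLE.continuous (hq : IsPolyDegLE m q) : Continuous q := by
  obtain ⟨p, -, hp⟩ := hq
  rw [funext hp]
  exact (MvPolynomial.continuous_eval p).comp (by fun_prop)

theorem IsPolyDegLE.differentiable_update (hq : IsPolyDegLE m q) (i : Fin n)
    (x : Fin n → EuclideanSpace ℝ (Fin d)) :
    Differentiable ℝ fun y => q (Function.update x i y) := by
  obtain ⟨p, -, hp⟩ := hq
  simp only [hp]
  refine MvPolynomial.differentiable_eval_comp (fun jk => ?_) p
  by_cases h : jk.1 = i
  · subst h
    simp only [Function.update_self]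
    exact (EuclideanSpace.proj (𝕜 := ℝ) jk.2).differentiable
  · simp [Function.update_of_ne h]

/-- The gradient in the `i`-th block is constant, so subtracting the corresponding linear form
leaves a function with zero derivative. -/
theorem IsMultilinearFn.update_eq (hm : IsMultilinearFn q) (hq : IsPolyDegLE m q) (i : Fin n)
    (x : Fin n → EuclideanSpace ℝ (Fin d)) (y c : EuclideanSpace ℝ (Fin d)) :
    q (Function.update x i y)
      = q (Function.update x i c) + inner ℝ (partialGrad q i x) (y - c) := by
  set φ := fun y => q (Function.update x i y) with hφ
  set g := partialGrad q i x with hg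
  have hd : Differentiable ℝ φ := hq.differentiable_update i x
  have hgrad : ∀ y, HasGradientAt φ g y := by
    intro y
    have h1 : gradient φ y = g := by
      have h2 := hm i x y
      simp only [partialGrad, Function.update_idem, Function.update_self] at h2
      rw [hg, partialGrad]
      exact h2
    rw [← h1]
    exact (hd y).hasGradientAt
  have h0 : ∀ y, HasFDerivAt (fun y => φ y - innerSL ℝ g y) (0 : EuclideanSpace ℝ (Fin d) →L[ℝ] ℝ) y := by
    intro y
    have h1 := (hgrad y).hasFDerivAt.sub (innerSL ℝ g).hasFDerivAt (x := y)
    have e : (InnerProductSpace.toDual ℝ (EuclideanSpace ℝ (Fin d))) g - innerSL ℝ g = 0 := by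
      ext v; simp
    rw [e] at h1
    exact h1
  have h1 := is_const_of_fderiv_eq_zero (fun y => (h0 y).differentiableAt)
    (fun y => (h0 y).fderiv) y c
  simp only [innerSL_apply_apply] at h1
  rw [inner_sub_right]
  change φ y = φ c + _
  linarith

end Multilinear

/-! ### Independence of the interpolating vectors -/

section Independence

variable {Ω : Type*} [MeasurableSpace Ω] {P : Measure Ω}

theorem ProbabilityTheory.iIndepFun.sumElim {ι E : Type*} [MeasurableSpace E] {X Z : ι → Ω → E}
    (hX : iIndepFun X P) (hZ : iIndepFun Z P)
    (hXZ : IndepFun (fun ω i => X i ω) (fun ω i => Z i ω) P) : iIndepFun (Sum.elim X Z) P := by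
  rw [iIndepFun_iff_measure_inter_preimage_eq_mul] at hX hZ ⊢
  rw [indepFun_iff_measure_inter_preimage_eq_mul] at hXZ
  intro S sets H
  have e : ⋂ i ∈ S, Sum.elim X Z i ⁻¹' sets i
      = (⋂ i ∈ S.toLeft, X i ⁻¹' sets (.inl i)) ∩ ⋂ i ∈ S.toRight, Z i ⁻¹' sets (.inr i) := by
    ext ω
    simp
  have hL : ∀ i ∈ S.toLeft, MeasurableSet (sets (.inl i)) := fun i hi => H _ (by simpa using hi)
  have hR : ∀ i ∈ S.toRight, MeasurableSet (sets (.inr i)) := fun i hi => H _ (by simpa using hi)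
  have key := hXZ (⋂ i ∈ S.toLeft, (fun x : ι → E => x i) ⁻¹' sets (.inl i))
    (⋂ i ∈ S.toRight, (fun x : ι → E => x i) ⁻¹' sets (.inr i))
    (Finset.measurableSet_biInter _ fun i hi => measurable_pi_apply i (hL i hi))
    (Finset.measurableSet_biInter _ fun i hi => measurable_pi_apply i (hR i hi))
  simp only [preimage_iInter, preimage_preimage] at key
  rw [e]
  have e1 := hX S.toLeft (sets := fun i => sets (.inl i)) hL
  have e2 := hZ S.toRight (sets := fun i => sets (.inr i)) hR
  conv_rhs => rw [← Finset.toLeft_disjSum_toRight (u := S), Finset.prod_disjSum]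
  simp only [Sum.elim_inl, Sum.elim_inr]
  rw [← e1, ← e2]
  exact key

variable {n d : ℕ} {X Z : Fin n → Ω → EuclideanSpace ℝ (Fin d)}

theorem measurable_lindebergW (hX : ∀ i, Measurable (X i)) (hZ : ∀ i, Measurable (Z i))
    (i : Fin n) : Measurable (lindebergW X Z i) := by
  refine measurable_pi_lambda _ fun j => ?_
  unfold lindebergW
  split_ifs
  · exact hX j
  · exact hZ j
  · exact measurable_const

/-- `lindebergW X Z i` is a measurable function of the members of the joint family other than `X i`
and `Z i`. -/
theorem indepFun_lindebergW (hXm : ∀ i, Measurable (X i)) (hZm : ∀ i, Measurable (Z i))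
    (h : iIndepFun (Sum.elim X Z) P) (i : Fin n) :
    IndepFun (lindebergW X Z i) (X i) P ∧ IndepFun (lindebergW X Z i) (Z i) P := by
  classical
  let S : Finset (Fin n ⊕ Fin n) := Finset.univ \ {.inl i, .inr i}
  let T : Finset (Fin n ⊕ Fin n) := {.inl i, .inr i}
  have hm : ∀ k, Measurable (Sum.elim X Z k) := by
    rintro (k | k)
    · exact hXm k
    · exact hZm k
  have h1 := h.indepFun_finset S T Finset.sdiff_disjoint hm
  let φ : (S → EuclideanSpace ℝ (Fin d)) → Fin n → EuclideanSpace ℝ (Fin d) := fun y j =>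
    if hj : j < i then y ⟨.inl j, by simp [S, hj.ne]⟩
    else if hj : i < j then y ⟨.inr j, by simp [S, hj.ne']⟩ else 0
  have hφ : Measurable φ := by
    refine measurable_pi_lambda _ fun j => ?_
    simp only [φ]
    split_ifs
    · exact measurable_pi_apply _
    · exact measurable_pi_apply _
    · exact measurable_const
  have e : lindebergW X Z i = φ ∘ fun ω (k : S) => Sum.elim X Z k ω := by
    ext ω j
    simp only [lindebergW, φ, Function.comp]
    split_ifs <;> rfl
  rw [e]
  exact ⟨h1.comp hφ (measurable_pi_apply (⟨.inl i, by simp [T]⟩ : T)),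
    h1.comp hφ (measurable_pi_apply (⟨.inr i, by simp [T]⟩ : T))⟩

theorem prekopaLeindler_map_gaussian (hZ : ∀ i, HasGaussianLaw (Z i) P) (hi : iIndepFun Z P) :
    PrekopaLeindler (P.map fun ω (jk : Fin n × Fin d) => Z jk.1 ω jk.2) := by
  have h1 : HasGaussianLaw (fun ω => (Z · ω)) P := hi.hasGaussianLaw hZ
  let L : (Fin n → EuclideanSpace ℝ (Fin d)) →L[ℝ] EuclideanSpace ℝ (Fin n × Fin d) :=
    (EuclideanSpace.equiv (Fin n × Fin d) ℝ).symm.toContinuousLinearMap ∘L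
      ContinuousLinearMap.pi fun jk => (EuclideanSpace.proj (𝕜 := ℝ) jk.2) ∘L
        ContinuousLinearMap.proj jk.1
  have h2 := (h1.map_fun L).isGaussian_map
  have h3 := (prekopaLeindler_of_isGaussian (P.map fun ω => L (Z · ω))).map
    (T := fun x : EuclideanSpace ℝ (Fin n × Fin d) => (x : Fin n × Fin d → ℝ))
    (by fun_prop) (fun s t _ x y => by ext; simp)
  rw [AEMeasurable.map_map_of_aemeasurable (by fun_prop) (h1.map_fun L).aemeasurable] at h3
  exact h3

end Independence

/-! ### The Lindeberg telescope -/

section Chain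

variable {Ω : Type*} {n d m : ℕ} {X Z : Fin n → Ω → EuclideanSpace ℝ (Fin d)}
  {q : (Fin n → EuclideanSpace ℝ (Fin d)) → ℝ}

/-- The vector `(X₁, …, Xₖ, Zₖ₊₁, …, Zₙ)`. -/
def hybrid (X Z : Fin n → Ω → EuclideanSpace ℝ (Fin d)) (k : ℕ) (ω : Ω) :
    Fin n → EuclideanSpace ℝ (Fin d) :=
  fun j => if j.val < k then X j ω else Z j ω

/-- With `hybrid_val`, this shows that consecutive hybrids are two fillings of the same `lindebergW
X Z i`. Blocks count from `0`, so step `i + 1` is the first to contain `X i`. -/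
theorem hybrid_succ (i : Fin n) (ω : Ω) :
    hybrid X Z (i + 1) ω = Function.update (lindebergW X Z i ω) i (X i ω) := by
  ext1 j
  rcases eq_or_ne j i with rfl | h
  · simp [hybrid]
  · rw [Function.update_of_ne h, hybrid, lindebergW]
    rcases lt_or_gt_of_ne h with h' | h'
    · rw [if_pos h', if_pos (by have := Fin.lt_def.1 h'; omega)]
    · rw [if_neg (not_lt.2 h'.le), if_pos h', if_neg (by have := Fin.lt_def.1 h'; omega)]

theorem hybrid_val (i : Fin n) (ω : Ω) :
    hybrid X Z i ω = Function.update (lindebergW X Z i ω) i (Z i ω) := by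
  ext1 j
  rcases eq_or_ne j i with rfl | h
  · simp [hybrid]
  · rw [Function.update_of_ne h, hybrid, lindebergW]
    rcases lt_or_gt_of_ne h with h' | h'
    · rw [if_pos h', if_pos (Fin.lt_def.1 h')]
    · rw [if_neg (not_lt.2 h'.le), if_pos h', if_neg (by have := Fin.lt_def.1 h'; omega)]

theorem hybrid_zero (ω : Ω) : hybrid X Z 0 ω = fun i => Z i ω := by
  ext1 j; simp [hybrid]

theorem hybrid_last (ω : Ω) : hybrid X Z n ω = fun i => X i ω := by
  ext1 j; simp [hybrid]

theorem IsPolyDegLE.measurable_update (hq : IsPolyDegLE m q) (i : Fin n) :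
    Measurable fun x : (Fin n → EuclideanSpace ℝ (Fin d)) × EuclideanSpace ℝ (Fin d) =>
      q (Function.update x.1 i x.2) := by
  refine hq.continuous.measurable.comp (measurable_pi_lambda _ fun j => ?_)
  rcases eq_or_ne j i with rfl | h
  · simp only [Function.update_self]; exact measurable_snd
  · simp only [Function.update_of_ne h]; exact (measurable_pi_apply j).comp measurable_fst

variable [MeasurableSpace Ω] {P : Measure Ω} [IsProbabilityMeasure P]

/-- The Lindeberg replacement bound for multilinear polynomials. -/
theorem abs_integral_comp_multilinear_sub_le (hXm : ∀ i, Measurable (X i))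
    (hZm : ∀ i, Measurable (Z i)) (hX : ∀ i, MemLp (X i) 2 P)
    (hXZ : iIndepFun (Sum.elim X Z) P) (hG : ∀ i, IsGaussianMatch P (X i) (Z i))
    (hq : IsPolyDegLE m q) (hm : IsMultilinearFn q)
    {H : ℝ → ℝ} (hc : Continuous H) {B : ℝ} (hB : ∀ x, |H x| ≤ B) {K ν : ℝ}
    (hK : 0 ≤ K) (hν : 2 ≤ ν)
    (hH : ∀ a, ∃ c₁ c₂, ∀ b, |H (a + b) - H a - c₁ * b - c₂ * b ^ 2 / 2| ≤ K * |b| ^ ν) :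
    ENNReal.ofReal |∫ ω, H (q fun i => X i ω) ∂P - ∫ ω, H (q fun i => Z i ω) ∂P|
      ≤ ENNReal.ofReal K * (1 + gaussianMoment ν) * ∑ i, influence P q X Z ν i ^ ν := by
  set A : ℕ → ℝ := fun k => ∫ ω, H (q (hybrid X Z k ω)) ∂P with hA
  have e : ∫ ω, H (q fun i => X i ω) ∂P - ∫ ω, H (q fun i => Z i ω) ∂P
      = ∑ i : Fin n, (A (i + 1) - A i) := by
    rw [Fin.sum_univ_eq_sum_range (fun i => A (i + 1) - A i), Finset.sum_range_sub]
    simp only [hA, hybrid_zero, hybrid_last]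
  rw [e, ← Real.enorm_eq_ofReal_abs, Finset.mul_sum]
  refine (enorm_sum_le _ _).trans (Finset.sum_le_sum fun i _ => ?_)
  obtain ⟨i1, i2⟩ := indepFun_lindebergW hXm hZm hXZ i
  have key := (hG i).abs_integral_comp_sub_le (hX i) (measurable_lindebergW hXm hZm i) (hXm i)
    (hZm i) i1 i2 (hq.measurable_update i)
    (g := partialGrad q i) (fun w y => hm.update_eq hq i w y _) hc hB hK hν hH
  rw [lintegral_rpow_enorm_eq_eLpNorm (by linarith)] at key
  rw [Real.enorm_eq_ofReal_abs]
  simp only [hA, hybrid_succ, hybrid_val]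
  exact key

/-- Each replacement preserves the second moment of `q - t` exactly. This transfers the variance
lower bound from `q(X)` to `q(Z)`, where anti-concentration is available. -/
theorem lintegral_sq_sub_eq (hXm : ∀ i, Measurable (X i))
    (hZm : ∀ i, Measurable (Z i)) (hX : ∀ i, MemLp (X i) 2 P)
    (hXZ : iIndepFun (Sum.elim X Z) P) (hG : ∀ i, IsGaussianMatch P (X i) (Z i))
    (hq : IsPolyDegLE m q) (hm : IsMultilinearFn q) (t : ℝ) :
    ∫⁻ ω, ENNReal.ofReal (((q fun i => X i ω) - t) ^ 2) ∂P
      = ∫⁻ ω, ENNReal.ofReal (((q fun i => Z i ω) - t) ^ 2) ∂P := by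
  have step : ∀ k ≤ n, ∫⁻ ω, ENNReal.ofReal ((q (hybrid X Z k ω) - t) ^ 2) ∂P
      = ∫⁻ ω, ENNReal.ofReal (((q fun i => Z i ω) - t) ^ 2) ∂P := by
    intro k
    induction k with
    | zero => intro _; simp only [hybrid_zero]
    | succ k ih =>
      intro hk
      rw [← ih (by omega)]
      set i : Fin n := ⟨k, hk⟩ with hi
      obtain ⟨i1, i2⟩ := indepFun_lindebergW hXm hZm hXZ i
      have key := (hG i).lintegral_sq_eq (hX i) (measurable_lindebergW hXm hZm i) (hXm i)
        (hZm i) i1 i2 ((hq.measurable_update i).sub_const t)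
        (g := partialGrad q i) (fun w y => by simp only [hm.update_eq hq i w y (∫ ω, X i ω ∂P)]; ring)
      simp only [← hybrid_succ, ← hybrid_val] at key
      exact key
  simpa only [hybrid_last] using step n le_rfl

end Chain

/-! ### Smoothing of distribution functions and choice of scales -/

section Smoothing

variable {Ω : Type*} [MeasurableSpace Ω] {P : Measure Ω}

theorem measureReal_le_abs_le_div_sq {V : Ω → ℝ} (hV : Measurable V) {a ε : ℝ} (ha : 0 ≤ a)
    (hε : 0 < ε) (h : eLpNorm V 2 P = ENNReal.ofReal a) :
    P.real {ω | ε ≤ |V ω|} ≤ (a / ε) ^ 2 := by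
  have h1 := meas_ge_le_mul_pow_eLpNorm_enorm P (p := 2) (by simp) (by simp)
    hV.aestronglyMeasurable (ε := ENNReal.ofReal ε) (by simpa using hε) (by simp)
  have e : {ω | ENNReal.ofReal ε ≤ ‖V ω‖ₑ} = {ω | ε ≤ |V ω|} := by
    ext ω
    simp only [mem_ofPred_eq]
    rw [Real.enorm_eq_ofReal_abs, ENNReal.ofReal_le_ofReal_iff (abs_nonneg _)]
  rw [e, h, ← ENNReal.ofReal_inv_of_pos hε, ENNReal.toReal_ofNat,
    ENNReal.ofReal_rpow_of_nonneg (by positivity) (by norm_num),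
    ENNReal.ofReal_rpow_of_nonneg ha (by norm_num), ← ENNReal.ofReal_mul (by positivity)] at h1
  refine ENNReal.toReal_le_of_le_ofReal (by positivity) (h1.trans (le_of_eq ?_))
  congr 1
  rw [Real.rpow_two, Real.rpow_two]
  field_simp

variable [IsProbabilityMeasure P]

/-- Comparison of distribution functions through a smoothed indicator. -/
theorem abs_measureReal_le_sub_le {F U T : Ω → ℝ} (hU : Measurable U)
    (hT : Measurable T) {h : ℝ → ℝ} (hc : Continuous h) (h0 : ∀ x, 0 ≤ h x) (h1 : ∀ x, h x ≤ 1)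
    (hl : ∀ x ≤ 0, h x = 1) (hr : ∀ x, 1 ≤ x → h x = 0) {ε δ s A L R : ℝ} (hδ : 0 < δ)
    (hA : P.real {ω | ε ≤ |F ω - U ω|} ≤ A) (hR : P.real {ω | |T ω - s| ≤ ε + δ} ≤ R)
    (hε : 0 < ε)
    (hL : ∀ c, |∫ ω, h ((U ω - c) / δ) ∂P - ∫ ω, h ((T ω - c) / δ) ∂P| ≤ L) :
    |P.real {ω | F ω ≤ s} - P.real {ω | T ω ≤ s}| ≤ A + L + R := by
  have hInt : ∀ {V : Ω → ℝ}, Measurable V → ∀ c, Integrable (fun ω => h ((V ω - c) / δ)) P := by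
    intro V hV c
    refine Integrable.of_bound (C := 1) (Measurable.aestronglyMeasurable ?_)
      (ae_of_all _ fun ω => ?_)
    · exact hc.measurable.comp ((hV.sub_const c).div_const δ)
    · rw [Real.norm_eq_abs, abs_of_nonneg (h0 _)]; exact h1 _
  have lo : ∀ {V : Ω → ℝ}, Measurable V → ∀ c,
      P.real {ω | V ω ≤ c} ≤ ∫ ω, h ((V ω - c) / δ) ∂P := by
    intro V hV c
    have hs : MeasurableSet {ω | V ω ≤ c} := measurableSet_le hV measurable_const
    rw [← integral_indicator_one hs]
    refine integral_mono ((integrable_const 1).indicator hs) (hInt hV c) fun ω => ?_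
    by_cases hω : V ω ≤ c
    · rw [indicator_of_mem (by simpa using hω)]
      simp [hl _ (div_nonpos_of_nonpos_of_nonneg (sub_nonpos.2 hω) hδ.le)]
    · rw [indicator_of_notMem (by simpa using hω)]
      exact h0 _
  have hi : ∀ {V : Ω → ℝ}, Measurable V → ∀ c,
      ∫ ω, h ((V ω - c) / δ) ∂P ≤ P.real {ω | V ω ≤ c + δ} := by
    intro V hV c
    have hs : MeasurableSet {ω | V ω ≤ c + δ} := measurableSet_le hV measurable_const
    rw [← integral_indicator_one hs]
    refine integral_mono (hInt hV c) ((integrable_const 1).indicator hs) fun ω => ?_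
    by_cases hω : V ω ≤ c + δ
    · rw [indicator_of_mem (by simpa using hω)]
      exact h1 _
    · rw [indicator_of_notMem (by simpa using hω)]
      refine (hr _ ?_).le
      rw [le_div_iff₀ hδ]
      push Not at hω
      linarith
  have un : ∀ {S S₁ S₂ : Set Ω}, S ⊆ S₁ ∪ S₂ → P.real S ≤ P.real S₁ + P.real S₂ := fun h =>
    (measureReal_mono h).trans (measureReal_union_le _ _)
  rw [abs_le]
  constructor
  -- The threshold for `T` is lowered by `δ` for the smoothing and by `ε` for the passage from `U`
  -- to `F`. The window of radius `ε + δ` around `s` pays for both.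
  · have s1 : P.real {ω | U ω ≤ s - ε} ≤ P.real {ω | F ω ≤ s} + P.real {ω | ε ≤ |F ω - U ω|} := by
      refine un fun ω hω => ?_
      simp only [mem_ofPred_eq, mem_union] at hω ⊢
      by_contra! hh
      have := (abs_lt.1 hh.2).2
      linarith [hh.1]
    have s2 : P.real {ω | T ω ≤ s} ≤ P.real {ω | T ω ≤ s - ε - δ}
        + P.real {ω | |T ω - s| ≤ ε + δ} := by
      refine un fun ω hω => ?_
      simp only [mem_ofPred_eq, mem_union] at hω ⊢
      by_contra! hh
      rcases lt_abs.1 hh.2 with h | h <;> linarith [hh.1]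
    have s3 := hi hU (s - ε - δ)
    rw [sub_add_cancel] at s3
    have s4 := lo hT (s - ε - δ)
    have s5 := (abs_le.1 (hL (s - ε - δ))).1
    linarith
  · have s1 : P.real {ω | F ω ≤ s} ≤ P.real {ω | U ω ≤ s + ε} + P.real {ω | ε ≤ |F ω - U ω|} := by
      refine un fun ω hω => ?_
      simp only [mem_ofPred_eq, mem_union] at hω ⊢
      by_contra! hh
      have := (abs_lt.1 hh.2).1
      linarith [hh.1]
    have s2 : P.real {ω | T ω ≤ s + ε + δ} ≤ P.real {ω | T ω ≤ s}
        + P.real {ω | |T ω - s| ≤ ε + δ} := by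
      refine un fun ω hω => ?_
      simp only [mem_ofPred_eq, mem_union] at hω ⊢
      by_contra! hh
      rcases lt_abs.1 hh.2 with h | h <;> linarith [hh.1]
    have s3 := hi hT (s + ε)
    have s4 := lo hU (s + ε)
    have s5 := (abs_le.1 (hL (s + ε))).2
    linarith

/-- Optimisation over the two smoothing scales. -/
theorem le_of_forall_scales {D a S ν κ K : ℝ} {m : ℕ} (hm : 1 ≤ m) (ha : 0 ≤ a) (hS : 0 ≤ S)
    (hν : 0 < ν) (hκ : 0 ≤ κ) (hK : 0 ≤ K)
    (h : ∀ ε δ : ℝ, 0 < ε → 0 < δ →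
      D ≤ (a / ε) ^ 2 + K * (δ ^ (-ν) * S) + κ * m * (ε + δ) ^ (1 / (m : ℝ))) :
    D ≤ (κ + 1 + K) * m * (a ^ (2 / (2 * (m : ℝ) + 1)) + S ^ (1 / (ν * (m : ℝ) + 1))) := by
  have hm1 : (1 : ℝ) ≤ m := by exact_mod_cast hm
  have hm0 : (0 : ℝ) < m := by linarith
  have hp1 : 0 < 2 * (m : ℝ) + 1 := by positivity
  have hp2 : 0 < ν * (m : ℝ) + 1 := by positivity
  -- The optimal scales vanish when `a` or `S` does, so both are shifted by `η > 0`, which tends to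
  -- `0` at the end.
  have main : ∀ η : ℝ, 0 < η → D ≤ (κ + 1 + K) * m *
      ((a + η) ^ (2 / (2 * (m : ℝ) + 1)) + (S + η) ^ (1 / (ν * (m : ℝ) + 1))) := by
    intro η hη
    set b := a + η with hb
    set r := S + η with hr
    have hb0 : 0 < b := by positivity
    have hr0 : 0 < r := by positivity
    set x := b ^ (2 / (2 * (m : ℝ) + 1)) with hx
    set y := r ^ (1 / (ν * (m : ℝ) + 1)) with hy
    have hx0 : 0 < x := Real.rpow_pos_of_pos hb0 _
    have hy0 : 0 < y := Real.rpow_pos_of_pos hr0 _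
    -- With `ε = x ^ m` and `δ = y ^ m` one has `(b / ε)² = x`, `δ^(-ν) r = y` and `(ε + δ)^(1/m) ≤
    -- x + y`, so all terms balance.
    have k := h (x ^ (m : ℝ)) (y ^ (m : ℝ)) (Real.rpow_pos_of_pos hx0 _)
      (Real.rpow_pos_of_pos hy0 _)
    have k1 : (a / x ^ (m : ℝ)) ^ 2 ≤ x := by
      have : (a / x ^ (m : ℝ)) ^ 2 ≤ (b / x ^ (m : ℝ)) ^ 2 := by
        gcongr
        linarith
      refine this.trans (le_of_eq ?_)
      rw [hx, ← Real.rpow_mul hb0.le]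
      nth_rewrite 1 [← Real.rpow_one b]
      rw [← Real.rpow_sub hb0, ← Real.rpow_two, ← Real.rpow_mul hb0.le]
      congr 1
      field_simp
      ring
    have k2 : (y ^ (m : ℝ)) ^ (-ν) * S ≤ y := by
      have : (y ^ (m : ℝ)) ^ (-ν) * S ≤ (y ^ (m : ℝ)) ^ (-ν) * r :=
        mul_le_mul_of_nonneg_left (by linarith) (by positivity)
      refine this.trans (le_of_eq ?_)
      rw [hy, ← Real.rpow_mul hr0.le, ← Real.rpow_mul hr0.le, ← Real.rpow_add_one hr0.ne']
      congr 1
      field_simp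
      ring
    have k3 : (x ^ (m : ℝ) + y ^ (m : ℝ)) ^ (1 / (m : ℝ)) ≤ x + y := by
      refine (Real.rpow_add_le_add_rpow (by positivity) (by positivity) (by positivity)
        (by rw [div_le_one hm0]; exact hm1)).trans (le_of_eq ?_)
      rw [one_div, Real.rpow_rpow_inv hx0.le hm0.ne', Real.rpow_rpow_inv hy0.le hm0.ne']
    have k4 : K * ((y ^ (m : ℝ)) ^ (-ν) * S) ≤ K * y := mul_le_mul_of_nonneg_left k2 hK
    have k5 := mul_le_mul_of_nonneg_left k3 (mul_nonneg hκ hm0.le)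
    have k6 : x + K * y ≤ (1 + K) * m * (x + y) := by
      have : (1 + K) * 1 * (x + y) ≤ (1 + K) * m * (x + y) := by gcongr
      nlinarith [mul_nonneg hK hx0.le]
    linarith
  have hcont : Continuous fun η : ℝ => (κ + 1 + K) * m *
      ((a + η) ^ (2 / (2 * (m : ℝ) + 1)) + (S + η) ^ (1 / (ν * (m : ℝ) + 1))) := by
    refine continuous_const.mul (Continuous.add ?_ ?_)
    · exact (continuous_const.add continuous_id).rpow_const fun _ => Or.inr (by positivity)
    · exact (continuous_const.add continuous_id).rpow_const fun _ => Or.inr (by positivity)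
  have ht := (hcont.tendsto 0).mono_left (nhdsWithin_le_nhds (s := Ioi 0))
  rw [add_zero, add_zero] at ht
  exact ge_of_tendsto ht (eventually_nhdsWithin_of_forall fun η hη => main η hη)

end Smoothing

/-! ### Anti-concentration of Gaussian polynomials -/

section Gaussian

variable {Ω : Type*} [MeasurableSpace Ω] {P : Measure Ω} {n m d : ℕ}
  {X Z : Fin n → Ω → EuclideanSpace ℝ (Fin d)} {q : (Fin n → EuclideanSpace ℝ (Fin d)) → ℝ}

/-- The real-valued variance is `0` by convention when the second moment is infinite, so a positive
standard deviation already forces `L²`. -/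
theorem memLp_two_of_stdDev_pos [IsFiniteMeasure P] {U : Ω → ℝ} (hU : AEStronglyMeasurable U P)
    (h : 0 < stdDev P U) : MemLp U 2 P := by
  rw [stdDev, Real.sqrt_pos, variance] at h
  exact (evariance_lt_top_iff_memLp hU).1 (ENNReal.toReal_pos_iff.1 h).2

theorem IsPolyDegLE.one_le_of_stdDev_pos [IsProbabilityMeasure P] (hq : IsPolyDegLE m q)
    {Y : Ω → Fin n → EuclideanSpace ℝ (Fin d)} (h : 0 < stdDev P fun ω => q (Y ω)) : 1 ≤ m := by
  by_contra hm
  obtain ⟨p, hp, hpq⟩ := hq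
  have h0 := MvPolynomial.totalDegree_eq_zero_iff_eq_C.1 (show p.totalDegree = 0 by omega)
  have e : (fun ω => q (Y ω)) = fun _ => p.coeff 0 := by
    ext ω
    rw [hpq, h0]
    simp
  rw [stdDev, e] at h
  have h1 : Var[fun _ : Ω => p.coeff 0; P] = 0 := by
    rw [variance_eq_integral aemeasurable_const]; simp
  simp [h1] at h

theorem ofReal_stdDev_sq_le_lintegral [IsProbabilityMeasure P] {U : Ω → ℝ} (hU : MemLp U 2 P)
    (t : ℝ) :
    ENNReal.ofReal (stdDev P U ^ 2) ≤ ∫⁻ ω, ENNReal.ofReal ((U ω - t) ^ 2) ∂P := by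
  have hUt : MemLp (fun ω => U ω - t) 2 P := hU.sub (memLp_const t)
  rw [← ofReal_integral_eq_lintegral_ofReal hUt.integrable_sq (ae_of_all _ fun ω => sq_nonneg _),
    stdDev, Real.sq_sqrt (variance_nonneg _ _)]
  refine ENNReal.ofReal_le_ofReal ?_
  rw [← variance_sub_const hU.1 t]
  exact variance_le_expectation_sq hUt.1

/-- Small ball estimate for a polynomial in independent Gaussian vectors. -/
theorem measureReal_abs_sub_le_of_gaussian [IsProbabilityMeasure P] (hZm : ∀ i, Measurable (Z i))
    (hZ : ∀ i, HasGaussianLaw (Z i) P) (hi : iIndepFun Z P) (hq : IsPolyDegLE m q) (hm : 1 ≤ m)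
    {σ s ε : ℝ} (hσ : 0 < σ)
    (h2 : ENNReal.ofReal (σ ^ 2) ≤ ∫⁻ ω, ENNReal.ofReal (((q fun i => Z i ω) - s) ^ 2) ∂P)
    (hε : 0 < ε) :
    P.real {ω | |(q fun i => Z i ω) - s| ≤ σ * ε} ≤ smallBallConst * m * ε ^ (1 / (m : ℝ)) := by
  obtain ⟨p, hp, hpq⟩ := hq
  set Y : Ω → Fin n × Fin d → ℝ := fun ω jk => Z jk.1 ω jk.2 with hY
  have hYm : Measurable Y := by
    refine measurable_pi_lambda _ fun jk => ?_
    have := hZm jk.1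
    fun_prop
  have hprob := Measure.isProbabilityMeasure_map (μ := P) hYm.aemeasurable
  -- Centring at `s` and dividing by `σ` gives second moment at least one, the normalisation of
  -- Carbery–Wright.
  set r : MvPolynomial (Fin n × Fin d) ℝ := MvPolynomial.C σ⁻¹ * (p - MvPolynomial.C s) with hr
  have hre : ∀ ω, MvPolynomial.eval (Y ω) r = σ⁻¹ * ((q fun i => Z i ω) - s) := fun ω => by
    simp [hr, hpq, hY]
  have hrd : r.totalDegree ≤ m := by
    refine (MvPolynomial.totalDegree_mul _ _).trans ?_
    rw [MvPolynomial.totalDegree_C, zero_add]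
    exact (MvPolynomial.totalDegree_sub_C_le _ _).trans hp
  have mr : Measurable fun y : Fin n × Fin d → ℝ => MvPolynomial.eval y r :=
    (MvPolynomial.continuous_eval r).measurable
  have h1 : 1 ≤ ∫⁻ x, ENNReal.ofReal (MvPolynomial.eval x r ^ 2) ∂(P.map Y) := by
    rw [lintegral_map (by fun_prop) hYm]
    simp only [hre, mul_pow]
    have e : ∀ ω, ENNReal.ofReal (σ⁻¹ ^ 2 * ((q fun i => Z i ω) - s) ^ 2)
        = ENNReal.ofReal (σ⁻¹ ^ 2) * ENNReal.ofReal (((q fun i => Z i ω) - s) ^ 2) := fun ω =>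
      ENNReal.ofReal_mul (by positivity)
    simp only [e]
    rw [lintegral_const_mul' _ _ ENNReal.ofReal_ne_top]
    calc (1 : ℝ≥0∞) = ENNReal.ofReal (σ⁻¹ ^ 2) * ENNReal.ofReal (σ ^ 2) := by
          rw [← ENNReal.ofReal_mul (by positivity), ← mul_pow, inv_mul_cancel₀ hσ.ne']; simp
      _ ≤ _ := mul_le_mul_right h2 _
  have key := (prekopaLeindler_map_gaussian hZ hi).measure_abs_eval_le hm hrd h1 hε
  rw [Measure.map_apply hYm (measurableSet_le (by fun_prop) measurable_const)] at key
  have e : Y ⁻¹' {x | |MvPolynomial.eval x r| ≤ ε} = {ω | |(q fun i => Z i ω) - s| ≤ σ * ε} := by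
    ext ω
    simp only [mem_preimage, mem_ofPred_eq, hre]
    rw [abs_mul, abs_of_pos (inv_pos.2 hσ), inv_mul_le_iff₀ hσ]
  rw [e] at key
  have := smallBallConst_pos
  exact ENNReal.toReal_le_of_le_ofReal (by positivity) key

end Gaussian

/-! ### Assembly -/

theorem theorem2 (ν : ℝ) (hν : 2 < ν) (hν' : ν ≤ 3) :
    ∃ C : ℝ≥0, 0 < C ∧
      ∀ (n m d : ℕ)
        {Ω : Type*} [MeasurableSpace Ω] (P : Measure Ω) [IsProbabilityMeasure P]
        (X Z : Fin n → Ω → EuclideanSpace ℝ (Fin d)),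
        (∀ i, Measurable (X i)) → (∀ i, Measurable (Z i)) →
        (∀ i, MemLp (X i) 2 P) →
        iIndepFun X P → iIndepFun Z P →
        IndepFun (fun ω i => X i ω) (fun ω i => Z i ω) P →
        (∀ i, IsGaussianMatch P (X i) (Z i)) →
        ∀ q : (Fin n → EuclideanSpace ℝ (Fin d)) → ℝ,
          IsPolyDegLE m q → IsMultilinearFn q →
          ∀ σ : ℝ, σ = stdDev P (fun ω => q (fun i => X i ω)) → 0 < σ →
          ∀ f : (Fin n → EuclideanSpace ℝ (Fin d)) → ℝ, Measurable f →
            kolmogorovDist P (fun ω => σ⁻¹ * f (fun i => X i ω))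
                (fun ω => σ⁻¹ * q (fun i => Z i ω))
              ≤ (C : ℝ≥0∞) * (m : ℝ≥0∞) *
                ((eLpNorm (fun ω => f (fun i => X i ω) - q (fun i => X i ω)) 2 P
                      / ENNReal.ofReal σ) ^ (2 / (2 * (m : ℝ) + 1))
                  + ((∑ i, influence P q X Z ν i ^ ν) / ENNReal.ofReal σ ^ ν)
                      ^ (1 / (ν * (m : ℝ) + 1))) := by
  obtain ⟨h, h₁, h₂, K, hK, hc, h0, h1, hl, hr, hT⟩ := exists_smooth_step
  have hν0 : 0 < ν := by linarith
  have hG0 := gaussianMoment_ne_top hν0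
  set K' := K * (1 + (gaussianMoment ν).toReal) with hK'
  have hK'0 : 0 ≤ K' := by positivity
  have hκ := smallBallConst_pos
  refine ⟨(smallBallConst + 1 + K').toNNReal, by rw [Real.toNNReal_pos]; positivity, ?_⟩
  intro n m d Ω _ P _ X Z hXm hZm hX hXi hZi hXZ hG q hq hqm σ hσ hσ0 f hf
  have hm : 1 ≤ m := hq.one_le_of_stdDev_pos (P := P) (Y := fun ω i => X i ω) (hσ ▸ hσ0)
  have hm0 : (0 : ℝ) < m := by exact_mod_cast hm
  set A := eLpNorm (fun ω => f (fun i => X i ω) - q (fun i => X i ω)) 2 P / ENNReal.ofReal σ with hA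
  set S := (∑ i, influence P q X Z ν i ^ ν) / ENNReal.ofReal σ ^ ν with hS
  have hp1 : 0 < 2 / (2 * (m : ℝ) + 1) := by positivity
  have hp2 : 0 < 1 / (ν * (m : ℝ) + 1) := by positivity
  have hσE : ENNReal.ofReal σ ≠ 0 := by simpa using hσ0
  have hC : ((smallBallConst + 1 + K').toNNReal : ℝ≥0∞) * (m : ℝ≥0∞) ≠ 0 := by
    refine mul_ne_zero ?_ (by exact_mod_cast (by omega : m ≠ 0))
    simp only [ne_eq, ENNReal.coe_eq_zero, Real.toNNReal_eq_zero, not_le]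
    positivity
  -- An infinite error term makes the bound trivial because its exponent and the prefactor are
  -- positive; otherwise the argument runs in the reals.
  by_cases hAt : A = ∞
  · rw [hAt, ENNReal.top_rpow_of_pos hp1, top_add, ENNReal.mul_top hC]; exact le_top
  by_cases hSt : S = ∞
  · rw [hSt, ENNReal.top_rpow_of_pos hp2, add_top, ENNReal.mul_top hC]; exact le_top
  set a := A.toReal with ha
  set b := S.toReal with hb
  have hXt : Measurable fun ω i => X i ω := measurable_pi_lambda _ hXm
  have hZt : Measurable fun ω i => Z i ω := measurable_pi_lambda _ hZm
  have mU : Measurable fun ω => q fun i => X i ω := hq.continuous.measurable.comp hXt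
  have mT : Measurable fun ω => q fun i => Z i ω := hq.continuous.measurable.comp hZt
  have mF : Measurable fun ω => f fun i => X i ω := hf.comp hXt
  have hU2 := memLp_two_of_stdDev_pos mU.aestronglyMeasurable (hσ ▸ hσ0)
  have hind := hXi.sumElim hZi hXZ
  have eA : eLpNorm (fun ω => f (fun i => X i ω) - q (fun i => X i ω)) 2 P
      = ENNReal.ofReal (σ * a) := by
    rw [ENNReal.ofReal_mul hσ0.le, ha, ENNReal.ofReal_toReal hAt, hA,
      ENNReal.mul_div_cancel hσE ENNReal.ofReal_ne_top]
  have eS : ∑ i, influence P q X Z ν i ^ ν = ENNReal.ofReal (σ ^ ν * b) := by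
    rw [ENNReal.ofReal_mul (by positivity), hb, ENNReal.ofReal_toReal hSt, hS,
      ← ENNReal.ofReal_rpow_of_pos hσ0, ENNReal.mul_div_cancel
        (ENNReal.rpow_pos (pos_of_ne_zero hσE) ENNReal.ofReal_ne_top).ne'
        (ENNReal.rpow_ne_top_of_nonneg hν0.le ENNReal.ofReal_ne_top)]
  refine iSup_le fun t => ?_
  set s := σ * t with hs
  have scale : ∀ V : Ω → ℝ, {ω | σ⁻¹ * V ω ≤ t} = {ω | V ω ≤ s} := fun V => by
    ext ω; simp only [mem_ofPred_eq]; rw [inv_mul_le_iff₀ hσ0]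
  rw [scale fun ω => f fun i => X i ω, scale fun ω => q fun i => Z i ω]
  have h2 : ENNReal.ofReal (σ ^ 2)
      ≤ ∫⁻ ω, ENNReal.ofReal (((q fun i => Z i ω) - s) ^ 2) ∂P := by
    rw [← lintegral_sq_sub_eq hXm hZm hX hind hG hq hqm s, hσ]
    exact ofReal_stdDev_sq_le_lintegral hU2 s
  have key := le_of_forall_scales (D := |P.real {ω | (f fun i => X i ω) ≤ s}
    - P.real {ω | (q fun i => Z i ω) ≤ s}|) (a := a) (S := b) (ν := ν) (κ := smallBallConst)
    (K := K') hm ENNReal.toReal_nonneg ENNReal.toReal_nonneg hν0 hκ.le hK'0 fun ε δ hε hδ => ?_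
  · refine (ENNReal.ofReal_le_ofReal key).trans (le_of_eq ?_)
    rw [ENNReal.ofReal_mul (by positivity), ENNReal.ofReal_mul (by positivity),
      ENNReal.ofReal_natCast,
      ENNReal.ofReal_add (p := a ^ _) (q := b ^ _) (by positivity) (by positivity),
      ← ENNReal.ofReal_rpow_of_nonneg ENNReal.toReal_nonneg hp1.le,
      ← ENNReal.ofReal_rpow_of_nonneg ENNReal.toReal_nonneg hp2.le,
      ENNReal.ofReal_toReal hAt, ENNReal.ofReal_toReal hSt]
    rfl
  have hσδ : 0 < σ * δ := by positivity
  refine abs_measureReal_le_sub_le (ε := σ * ε) mU mT hc h0 h1 hl hr hσδ ?_ ?_ (by positivity)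
    fun c => ?_
  · have := measureReal_le_abs_le_div_sq (mF.sub mU) (a := σ * a) (ε := σ * ε) (by positivity)
      (by positivity) eA
    rw [mul_div_mul_left _ _ hσ0.ne'] at this
    exact this
  · rw [← mul_add]
    exact measureReal_abs_sub_le_of_gaussian hZm (fun i => (hG i).gaussian) hZi hq hm hσ0 h2
      (by positivity)
  -- Rescaling the step to width `σ δ` multiplies the remainder constant by `(σ δ)^(-ν)`; its factor
  -- `σ^(-ν)` normalises the influences.
  · have hLin := abs_integral_comp_multilinear_sub_le (P := P) hXm hZm hX hind hG hq hqm
      (H := fun x => h ((x - c) / (σ * δ))) (by fun_prop) (B := 1)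
      (fun x => by rw [abs_of_nonneg (h0 _)]; exact h1 _) (K := K * (σ * δ) ^ (-ν)) (ν := ν)
      (by positivity) hν.le (fun x => ⟨h₁ ((x - c) / (σ * δ)) / (σ * δ),
        h₂ ((x - c) / (σ * δ)) / (σ * δ) ^ 2, fun y => ?_⟩)
    · rw [eS] at hLin
      have e1 : (1 + gaussianMoment ν) = ENNReal.ofReal (1 + (gaussianMoment ν).toReal) := by
        rw [ENNReal.ofReal_add zero_le_one ENNReal.toReal_nonneg, ENNReal.ofReal_toReal hG0]
        simp
      rw [e1, ← ENNReal.ofReal_mul (by positivity), ← ENNReal.ofReal_mul (by positivity),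
        ENNReal.ofReal_le_ofReal_iff (by positivity)] at hLin
      refine hLin.trans (le_of_eq ?_)
      rw [hK', Real.mul_rpow hσ0.le hδ.le, Real.rpow_neg hσ0.le]
      have := (Real.rpow_pos_of_pos hσ0 ν).ne'
      field_simp
    · have := hT ν hν.le hν' ((x - c) / (σ * δ)) (y / (σ * δ))
      rw [abs_div, abs_of_pos hσδ, Real.div_rpow (abs_nonneg _) hσδ.le] at this
      convert this using 1
      · congr 1
        rw [← add_div, show x + y - c = x - c + y by ring]
        field_simp
      · rw [Real.rpow_neg hσδ.le]; field_simp
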